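/- **Setting.** Let $d\ge1$, $N\ge1$. On $\mathbb R^k$, with the Euclidean distance, $\mathcal P_p$ is the set of probability measures with finite $p$-th moment, $W_p$ is the $p$-Wasserstein distance and $H(\nu|\mu)\in[0,\infty]$ is the relative entropy. For measures with finite second moment write $\langle U,\sigma^{\otimes2}\rangle=\iint U(x,y)\,\sigma(dx)\sigma(dy)$. A symmetric kernel $U:\mathbb R^d\times\mathbb R^d\to\mathbb R$ is *of positive type* if $|U(x,y)|\le C(1+|x|^2+|y|^2)$ for some constant $C$ and $\langle U,\sigma^{\otimes 2}\rangle\ge0$ for every signed measure $\sigma$ with $\int d\sigma=0$ and finite second moment. Let $V:\mathbb R^d\to\mathbb R$ be $\mathcal C^1$ and $W=W_+-W_-$, where $W_+,W_-$ are $\mathcal C^2$, of positive type, and satisfy $\|\nabla^2_{1,2}W_\pm\|_{L^\infty}\le L_W^\pm$ (operator norm of the matrix $\partial_{x_i}\partial_{y_j}W_\pm(x,y)$). Assume that $$m_*^N(d\mathbf x)\ \propto\ \exp\Bigl(-\sum_{i=1}^N V(x^i)-\frac1{2N}\sum_{i,j=1}^N W(x^i,x^j)\Bigr)\,d\mathbf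 x$$ has finite normalizing constant, so that it is a probability measure on $\mathbb R^{Nd}$. Let $m_*\in\mathcal P_2(\mathbb R^d)$ be a solution of the fixed point equation $$m_*(dx)=\frac{\exp\bigl(-V(x)-\int W(x,y)\,m_*(dy)\bigr)\,dx}{\int\exp\bigl(-V(x')-\int W(x',y)\,m_*(dy)\bigr)\,dx'},$$ and let $\operatorname{Var}m_*$ be the sum of the variances of its $d$ components. **Theorem.** Suppose that for some $\varepsilon\in[0,1/2]$ and $\lambda\ge0$, for all $\nu\in\mathcal P_2(\mathbb R^d)$, $$\frac\lambda2W_2^2(\nu,m_*)\le-\frac{1+\varepsilon}2\langle W_-,(\nu-m_*)^{\otimes2}\rangle+H(\nu|m_*).$$ Then for all $\nu^N\in\mathcal P_2(\mathbb R^{Nd})$, $$\frac{\lambda_N}2W_2^2(\nu^N,m_*^{\otimes N})\le H(\nu^N|m_*^N)+\delta_N,\qquad(1)$$ where $$\lambda_N=\begin{cases}\lambda-3\bigl(\tfrac1{\sqrt{2\varepsilon}}+3\bigr)L_W^-N^{-1},&\varepsilon\in(0,1/2],\\ \lambda-2(\log N+3)L_W^-N^{-1},&\varepsilon=0,\end{cases}$$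 $$\delta_N=\begin{cases}\bigl(3(\tfrac1{\sqrt{2\varepsilon}}+3)L_W^-+L_W^+\bigr)\operatorname{Var}m_*,&\varepsilon\in(0,1/2],\\ \bigl(2(\log N+3)L_W^-+L_W^+\bigr)\operatorname{Var}m_*,&\varepsilon=0.\end{cases}$$ If moreover $\lambda_N>0$, then for all $\nu^N\in\mathcal P_1(\mathbb R^{Nd})$, $$W_1^2(\nu^N,m_*^N)\le\frac{64(1+\delta_N)^2}{\lambda_N}H(\nu^N|m_*^N),\qquad(2)$$ and for every $S\subseteq\{1,\dots,N\}$ the marginal distribution of $m_*^N$ on the particles $(x^i)_{i\in S}$ satisfies the same $T_1$ inequality, with the same constant. In particular, if $W=W_+$ (that is, $W_-=0$) and $\frac\lambda2W_2^2(\nu,m_*)\le H(\nu|m_*)$ for all $\nu\in\mathcal P_2(\mathbb R^d)$, then (1) holds with $\lambda_N=\lambda$ and $\delta_N=L_W^+\operatorname{Var}m_*$; and if $\lambda>0$, then (2), and the same inequality for all the marginals, holds with these constants. -/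

import Mathlib

open MeasureTheory ProbabilityTheory InformationTheory
open scoped ENNReal

noncomputable section

/-- The state space `ℝ^d` of one particle, with its Euclidean norm. -/
abbrev Pt (d : ℕ) : Type := EuclideanSpace ℝ (Fin d)

/-- Configurations of particles in `ℝ^d` indexed by `ι`; for `ι = Fin N` this is `ℝ^{Nd}`.
Only its vector space, its product σ-algebra and its Lebesgue measure are used:
distances are measured with `configDist`, not with the sup norm of the function type. -/
abbrev Config (ι : Type) (d : ℕ) : Type := ι → Pt d

/-- The Euclidean distance on the configuration space. -/
def configDist {ι : Type} [Fintype ι] {d : ℕ} (x y : Config ι d) : ℝ :=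
  Real.sqrt (∑ i, dist (x i) (y i) ^ 2)

/-- Finiteness of the `p`-th moment of `μ` for the distance `ρ`. -/
def FiniteMoment {X : Type} [MeasurableSpace X] [Zero X] (ρ : X → X → ℝ) (p : ℕ)
    (μ : Measure X) : Prop :=
  ∫⁻ x, ENNReal.ofReal (ρ x 0 ^ p) ∂μ < ⊤

/-- `μ ∈ 𝒫_p(X)`: a probability measure with finite `p`-th moment for the distance `ρ`. -/
def InP {X : Type} [MeasurableSpace X] [Zero X] (ρ : X → X → ℝ) (p : ℕ)
    (μ : Measure X) : Prop :=
  IsProbabilityMeasure μ ∧ FiniteMoment ρ p μ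

/-- Couplings (transport plans) of `μ` and `ν`. -/
def couplings {X : Type} [MeasurableSpace X] (μ ν : Measure X) : Set (Measure (X × X)) :=
  {π | π.map Prod.fst = μ ∧ π.map Prod.snd = ν}

/-- The `p`-th power `W_p^p(μ, ν)` of the `p`-Wasserstein distance for the distance `ρ`;
thus `W_1` is the case `p = 1` and `W_2^2` is the case `p = 2`. -/
def wassersteinPow {X : Type} [MeasurableSpace X] (ρ : X → X → ℝ) (p : ℕ)
    (μ ν : Measure X) : ℝ≥0∞ :=
  ⨅ π ∈ couplings μ ν, ∫⁻ z, ENNReal.ofReal (ρ z.1 z.2 ^ p) ∂π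

/-- `⟨U, (μ - ν)^{⊗2}⟩` for finite measures `μ`, `ν`. -/
def kernelForm {X : Type} [MeasurableSpace X] (U : X → X → ℝ) (μ ν : Measure X) : ℝ :=
  (∫ z, U z.1 z.2 ∂(μ.prod μ)) - (∫ z, U z.1 z.2 ∂(μ.prod ν))
    - (∫ z, U z.1 z.2 ∂(ν.prod μ)) + ∫ z, U z.1 z.2 ∂(ν.prod ν)

/-- Symmetric kernels of positive type on `ℝ^d`: quadratic growth, and
`⟨U, σ^{⊗2}⟩ ≥ 0` for every signed measure `σ` with zero total mass and finite second moment.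
The signed measures with finite second moment are exactly the differences `μ - ν` of two finite
measures with finite second moment, and `⟨U, (μ - ν)^{⊗2}⟩` depends on `μ - ν` only. -/
structure PositiveType {d : ℕ} (U : Pt d → Pt d → ℝ) : Prop where
  symm : ∀ x y, U x y = U y x
  growth : ∃ C : ℝ, ∀ x y, |U x y| ≤ C * (1 + ‖x‖ ^ 2 + ‖y‖ ^ 2)
  nonneg : ∀ μ ν : Measure (Pt d), IsFiniteMeasure μ → IsFiniteMeasure ν →
    FiniteMoment dist 2 μ → FiniteMoment dist 2 ν →
    μ Set.univ = ν Set.univ → 0 ≤ kernelForm U μ ν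

/-- The mixed second derivative `∇²_{1,2} U (x, y)`, as the bilinear form
`(u, v) ↦ ∑ i j, ∂_{x_i} ∂_{y_j} U (x, y) u_i v_j`. -/
def mixedHessian {d : ℕ} (U : Pt d → Pt d → ℝ) (x y : Pt d) : Pt d →L[ℝ] Pt d →L[ℝ] ℝ :=
  fderiv ℝ (fun x' => fderiv ℝ (U x') y) x

/-- `∑_i V(x^i) + (1 / 2N) ∑_{i,j} W(x^i, x^j)`. -/
def particleEnergy {d : ℕ} (V : Pt d → ℝ) (W : Pt d → Pt d → ℝ) (N : ℕ)
    (x : Config (Fin N) d) : ℝ :=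
  (∑ i, V (x i)) + 1 / (2 * (N : ℝ)) * ∑ i, ∑ j, W (x i) (x j)

/-- The `N`-particle Gibbs measure `m^N_*`, of density proportional to `exp (-energy)`. -/
def gibbsMeasure {d : ℕ} (V : Pt d → ℝ) (W : Pt d → Pt d → ℝ) (N : ℕ) :
    Measure (Config (Fin N) d) :=
  (volume : Measure (Config (Fin N) d)).tilted (fun x => -particleEnergy V W N x)

/-- `Π[m]`, of density proportional to `exp (-V - ⟨W(x, ·), m⟩)`. -/
def meanFieldMap {d : ℕ} (V : Pt d → ℝ) (W : Pt d → Pt d → ℝ) (m : Measure (Pt d)) :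
    Measure (Pt d) :=
  (volume : Measure (Pt d)).tilted (fun x => -V x - ∫ y, W x y ∂m)

/-- The product measure `m^{⊗N}`. -/
def tensorPower {d : ℕ} (m : Measure (Pt d)) (N : ℕ) : Measure (Config (Fin N) d) :=
  Measure.pi (fun _ => m)

/-- The marginal distribution of the particles with indices in `S`. -/
def marginal {d N : ℕ} (μ : Measure (Config (Fin N) d)) (S : Finset (Fin N)) :
    Measure (Config {i // i ∈ S} d) :=
  μ.map (fun x i => x i.1)

/-- The sum of the variances of the components. -/
def totalVar {d : ℕ} (m : Measure (Pt d)) : ℝ :=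
  ∑ j : Fin d, variance (fun x : Pt d => x j) m

/-- The non-linear `T2` inequality: for all `ν ∈ 𝒫_2(ℝ^d)`,
`(lam / 2) W_2²(ν, m) ≤ - ((1 + ε) / 2) ⟨Wm, (ν - m)^{⊗2}⟩ + H(ν | m)`. -/
def NonlinearT2 {d : ℕ} (Wm : Pt d → Pt d → ℝ) (m : Measure (Pt d)) (ε lam : ℝ) : Prop :=
  ∀ ν : Measure (Pt d), InP dist 2 ν →
    ((lam / 2 : ℝ) : EReal) * ((wassersteinPow dist 2 ν m : ℝ≥0∞) : EReal) ≤
      ((-((1 + ε) / 2) * kernelForm Wm ν m : ℝ) : EReal) + ((klDiv ν m : ℝ≥0∞) : EReal)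

/-- The `T2` inequality with constant `lam`: `(lam / 2) W_2²(ν, m) ≤ H(ν | m)`
for all `ν ∈ 𝒫_2(ℝ^d)`. -/
def TalagrandT2 {d : ℕ} (m : Measure (Pt d)) (lam : ℝ) : Prop :=
  ∀ ν : Measure (Pt d), InP dist 2 ν →
    ((lam / 2 : ℝ) : EReal) * ((wassersteinPow dist 2 ν m : ℝ≥0∞) : EReal) ≤
      ((klDiv ν m : ℝ≥0∞) : EReal)

/-- The defective `T2` inequality: for all `ν^N ∈ 𝒫_2(ℝ^{Nd})`,
`(lam / 2) W_2²(ν^N, m^{⊗N}) ≤ H(ν^N | μ) + δ`; `lam` may be negative. -/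
def DefectiveT2 {d N : ℕ} (m : Measure (Pt d)) (μ : Measure (Config (Fin N) d))
    (lam δ : ℝ) : Prop :=
  ∀ ν : Measure (Config (Fin N) d), InP configDist 2 ν →
    ((lam / 2 : ℝ) : EReal) *
        ((wassersteinPow configDist 2 ν (tensorPower m N) : ℝ≥0∞) : EReal) ≤
      ((klDiv ν μ : ℝ≥0∞) : EReal) + (δ : EReal)

/-- The `T1` inequality `W_1²(ν, μ) ≤ C H(ν | μ)` for all `ν ∈ 𝒫_1`. -/
def TransportT1 {ι : Type} [Fintype ι] {d : ℕ} (μ : Measure (Config ι d)) (C : ℝ) : Prop :=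
  ∀ ν : Measure (Config ι d), InP configDist 1 ν →
    wassersteinPow configDist 1 ν μ ^ 2 ≤ ENNReal.ofReal C * klDiv ν μ

/-- The constant `λ_N`. -/
def lambdaN (N : ℕ) (ε lam Lm : ℝ) : ℝ :=
  if ε = 0 then lam - 2 * (Real.log N + 3) * Lm / N
  else lam - 3 * (1 / Real.sqrt (2 * ε) + 3) * Lm / N

/-- The constant `δ_N`, where `v` is the total variance of the mean field measure. -/
def deltaN (N : ℕ) (ε Lp Lm v : ℝ) : ℝ :=
  if ε = 0 then (2 * (Real.log N + 3) * Lm + Lp) * v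
  else (3 * (1 / Real.sqrt (2 * ε) + 3) * Lm + Lp) * v

end

/-!
The relative entropy with respect to the Gibbs measure is compared with the one with respect to
the product measure `P = m^{⊗N}`, for which transport inequalities can be proved one particle at
a time.

*Centering.* Replacing a kernel `U` by `K(x, y) = ⟨U, (δ_x - m) ⊗ (δ_y - m)⟩` (`centered`) turns
a kernel of positive type into a kernel that is positive semidefinite on all signed measures with
finite second moment (`PositiveType.psdKernel_centered`). By the fixed point equation the
first-order terms of the energy are absorbed into `P`, and the Gibbs measure is `P` tilted by
`-(1 / 2N) ∑ K(x^i, x^j)` for `K = K₊ - K₋` (`gibbsMeasure_eq_tilted`). Jensen's inequality bounds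
the partition function by the mean of the energy under `P`, where only the diagonal terms survive;
they are at most `L₊ Var m` (`klDiv_le_of_tilted_neg`, `integral_sum_sum_tensorPower`,
`centered_diag_le`).

*One particle at a time.* It remains to bound `(λ/2) W₂²(ν, P) + (1 / 2N) ∫ ∑ K₋(x^i, x^j) dν` by
`H(ν | P)` and diagonal terms. The entropy is the sum of the mean entropies of the conditional laws
`κ` of each particle given the previous ones. The non-linear `T2` inequality applied to `κ`
gives the transport cost of the new particle, and in addition `((1 + ε) / 2) ⟨K₋, κ ⊗ κ⟩`.
This pays for the growth of the energy, since `|v + κ|² / (a + b) ≤ |v|² / a + |κ|² / b` in the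
Hilbert seminorm of `K₋`: with `v` the sum of the Dirac masses of the previous particles,
`b = 1 / (1 + ε)`, and `a` growing by `b` at each step from `N ε / (1 + ε)` up to `N`
(`PSDKernel.div_add_le`, `PSDKernel.exists_coupling_tensorPower`). The couplings of the conditional
laws have to be chosen measurably (`exists_kernel_coupling`). What remains are the diagonal terms,
with the weights `(1 + ε) / (N ε + i)`. Listing the particles by increasing diagonal energy lets
Chebyshev's sum inequality replace each weight by the mean of the weights, whose sum is logarithmic
in `N`, or bounded when `ε > 0` (`two_mul_weightSum_zero_le`, `two_mul_weightSum_le`). The diagonal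
terms themselves are at most `L₋ (2 W₂² + 4 N Var m)` (`sum_diag_le`).
Together this is the defective `T2` inequality (`defectiveT2_gibbsMeasure`).

*From defective `T2` to `T1`.* For `ν = f μ` only the excess mass `τ = ∫ (f - 1)₊ dμ` has to be
moved, from `(f - 1)₊ μ / τ` to `(1 - f)₊ μ / τ`. The defective `T2` inequality compares both laws
to `P`. Although the defect `δ` does not vanish with the entropy, it enters multiplied by
`τ² ≤ 2 H(ν | μ)`, and so do the entropies of the two laws up to multiples of `H(ν | μ)`
(`wassersteinPow_one_sq_le`). Marginals inherit the inequality, because a law on the marginal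
space lifts to one with the same entropy, and projections are `1`-Lipschitz.
-/

noncomputable section

/-! ### Kernels of quadratic growth and their pairings with measures -/

lemma finiteMoment_two_iff {d : ℕ} {μ : Measure (Pt d)} :
    FiniteMoment dist 2 μ ↔ Integrable (fun x : Pt d => ‖x‖ ^ 2) μ := by
  have hm : AEStronglyMeasurable (fun x : Pt d => ‖x‖ ^ 2) μ := by fun_prop
  rw [FiniteMoment, lt_top_iff_ne_top, ← lintegral_ofReal_ne_top_iff_integrable hm
    (Filter.Eventually.of_forall fun x => by positivity)]
  simp [dist_zero_right]

lemma integral_sub_sub_add {X : Type*} [MeasurableSpace X] {μ : Measure X} {f g h k : X → ℝ}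
    (hf : Integrable f μ) (hg : Integrable g μ) (hh : Integrable h μ) (hk : Integrable k μ) :
    ∫ x, (f x - g x - h x + k x) ∂μ
      = (∫ x, f x ∂μ) - (∫ x, g x ∂μ) - (∫ x, h x ∂μ) + ∫ x, k x ∂μ := by
  have h1 := integral_sub hf hg
  have h2 := integral_sub (hf.sub hg) hh
  have h3 := integral_add ((hf.sub hg).sub hh) hk
  simp only [Pi.sub_apply] at h2 h3
  rw [h3, h2, h1]

/-- Measurable kernels on `ℝ^d` of at most quadratic growth. -/
structure QuadraticKernel {d : ℕ} (U : Pt d → Pt d → ℝ) : Prop where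
  measurable : Measurable (fun z : Pt d × Pt d => U z.1 z.2)
  growth : ∃ C : ℝ, ∀ x y, |U x y| ≤ C * (1 + ‖x‖ ^ 2 + ‖y‖ ^ 2)

/-- The bilinear pairing `∬ U(x, y) α(dx) β(dy)`. -/
def pairing {d : ℕ} (U : Pt d → Pt d → ℝ) (α β : Measure (Pt d)) : ℝ :=
  ∫ x, ∫ y, U x y ∂β ∂α

namespace QuadraticKernel

variable {d : ℕ} {U : Pt d → Pt d → ℝ} {α β γ : Measure (Pt d)}

lemma integrable_prod (hU : QuadraticKernel U) [IsFiniteMeasure α] [IsFiniteMeasure β]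
    (hα : FiniteMoment dist 2 α) (hβ : FiniteMoment dist 2 β) :
    Integrable (fun z : Pt d × Pt d => U z.1 z.2) (α.prod β) := by
  obtain ⟨C, hC⟩ := hU.growth
  rw [finiteMoment_two_iff] at hα hβ
  refine Integrable.mono' (g := fun z : Pt d × Pt d => C * (1 + ‖z.1‖ ^ 2 + ‖z.2‖ ^ 2)) ?_
    hU.measurable.aestronglyMeasurable (Filter.Eventually.of_forall fun z => hC z.1 z.2)
  exact (((integrable_const _).add (hα.comp_fst β)).add (hβ.comp_snd α)).const_mul C

lemma integrable_section (hU : QuadraticKernel U) [IsFiniteMeasure β]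
    (hβ : FiniteMoment dist 2 β) (x : Pt d) : Integrable (U x) β := by
  obtain ⟨C, hC⟩ := hU.growth
  rw [finiteMoment_two_iff] at hβ
  refine Integrable.mono' (g := fun y : Pt d => C * (1 + ‖x‖ ^ 2 + ‖y‖ ^ 2)) ?_
    (hU.measurable.comp measurable_prodMk_left).aestronglyMeasurable
    (Filter.Eventually.of_forall fun y => hC x y)
  exact ((integrable_const _).add hβ).const_mul C

lemma integrable_integral (hU : QuadraticKernel U) [IsFiniteMeasure α] [IsFiniteMeasure β]
    (hα : FiniteMoment dist 2 α) (hβ : FiniteMoment dist 2 β) :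
    Integrable (fun x => ∫ y, U x y ∂β) α :=
  (hU.integrable_prod hα hβ).integral_prod_left

lemma integral_growth (hU : QuadraticKernel U) [IsFiniteMeasure β]
    (hβ : FiniteMoment dist 2 β) :
    ∃ C : ℝ, 0 ≤ C ∧ ∀ x, |∫ y, U x y ∂β| ≤ C * (1 + ‖x‖ ^ 2) := by
  obtain ⟨C, hC⟩ := hU.growth
  have hC0 : 0 ≤ C := by
    have := (abs_nonneg _).trans (hC 0 0)
    simpa using this
  have hβ' := finiteMoment_two_iff.1 hβ
  refine ⟨C * (β.real Set.univ + ∫ y, ‖y‖ ^ 2 ∂β), by positivity, fun x => ?_⟩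
  have h1 : |∫ y, U x y ∂β| ≤ ∫ y, C * (1 + ‖x‖ ^ 2 + ‖y‖ ^ 2) ∂β := by
    refine (abs_integral_le_integral_abs).trans ?_
    exact integral_mono (hU.integrable_section hβ x).abs
      (((integrable_const _).add hβ').const_mul C) fun y => hC x y
  refine h1.trans ?_
  rw [integral_const_mul, integral_add (integrable_const _) hβ', integral_const, smul_eq_mul]
  have h2 : 0 ≤ ∫ y, ‖y‖ ^ 2 ∂β := integral_nonneg fun _ => by positivity
  have : C * (β.real Set.univ + ∫ y, ‖y‖ ^ 2 ∂β) * (1 + ‖x‖ ^ 2)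
    = C * (β.real Set.univ * (1 + ‖x‖ ^ 2) + ∫ y, ‖y‖ ^ 2 ∂β)
      + C * (∫ y, ‖y‖ ^ 2 ∂β) * ‖x‖ ^ 2 := by ring
  rw [this]
  have : 0 ≤ C * (∫ y, ‖y‖ ^ 2 ∂β) * ‖x‖ ^ 2 := by positivity
  linarith

lemma pairing_eq_prod (hU : QuadraticKernel U) [IsFiniteMeasure α] [IsFiniteMeasure β]
    (hα : FiniteMoment dist 2 α) (hβ : FiniteMoment dist 2 β) :
    ∫ z, U z.1 z.2 ∂(α.prod β) = pairing U α β :=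
  integral_prod _ (hU.integrable_prod hα hβ)

lemma pairing_add_left (hU : QuadraticKernel U) [IsFiniteMeasure α] [IsFiniteMeasure β]
    [IsFiniteMeasure γ] (hα : FiniteMoment dist 2 α) (hβ : FiniteMoment dist 2 β)
    (hγ : FiniteMoment dist 2 γ) :
    pairing U (α + γ) β = pairing U α β + pairing U γ β :=
  integral_add_measure (hU.integrable_integral hα hβ) (hU.integrable_integral hγ hβ)

lemma pairing_add_right (hU : QuadraticKernel U) [IsFiniteMeasure α] [IsFiniteMeasure β]
    [IsFiniteMeasure γ] (hα : FiniteMoment dist 2 α) (hβ : FiniteMoment dist 2 β)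
    (hγ : FiniteMoment dist 2 γ) :
    pairing U α (β + γ) = pairing U α β + pairing U α γ := by
  unfold pairing
  rw [← integral_add (hU.integrable_integral hα hβ) (hU.integrable_integral hα hγ)]
  congr 1 with x
  exact integral_add_measure (hU.integrable_section hβ x) (hU.integrable_section hγ x)

lemma pairing_comm (hU : QuadraticKernel U) (hs : ∀ x y, U x y = U y x) [IsFiniteMeasure α]
    [IsFiniteMeasure β] (hα : FiniteMoment dist 2 α) (hβ : FiniteMoment dist 2 β) :
    pairing U α β = pairing U β α := by
  unfold pairing
  rw [integral_integral_swap (hU.integrable_prod hα hβ)]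
  simp_rw [hs]

end QuadraticKernel

lemma quadraticKernel_dist_sq {d : ℕ} : QuadraticKernel fun x y : Pt d => ‖x - y‖ ^ 2 := by
  refine ⟨by fun_prop, 2, fun x y => ?_⟩
  rw [abs_of_nonneg (by positivity)]
  nlinarith [norm_sub_le x y, norm_nonneg (x - y), sq_nonneg (‖x‖ - ‖y‖)]

lemma pairing_smul_left {d : ℕ} (U : Pt d → Pt d → ℝ) (α β : Measure (Pt d)) (c : NNReal) :
    pairing U (c • α) β = c * pairing U α β := by
  unfold pairing
  rw [integral_smul_nnreal_measure]; rfl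

lemma pairing_smul_right {d : ℕ} (U : Pt d → Pt d → ℝ) (α β : Measure (Pt d)) (c : NNReal) :
    pairing U α (c • β) = c * pairing U α β := by
  unfold pairing
  simp_rw [integral_smul_nnreal_measure, NNReal.smul_def, smul_eq_mul]
  rw [integral_const_mul]

lemma FiniteMoment.add {d : ℕ} {α β : Measure (Pt d)} (hα : FiniteMoment dist 2 α)
    (hβ : FiniteMoment dist 2 β) : FiniteMoment dist 2 (α + β) := by
  rw [FiniteMoment, lintegral_add_measure]
  exact ENNReal.add_lt_top.2 ⟨hα, hβ⟩

lemma FiniteMoment.smul {d : ℕ} {α : Measure (Pt d)} (hα : FiniteMoment dist 2 α) (c : NNReal) :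
    FiniteMoment dist 2 (c • α) := by
  rw [finiteMoment_two_iff] at *
  exact hα.smul_measure_nnreal

lemma finiteMoment_dirac {d : ℕ} (x : Pt d) : FiniteMoment dist 2 (Measure.dirac x) := by
  rw [FiniteMoment, lintegral_dirac]
  exact ENNReal.ofReal_lt_top

/-- The empirical sum `∑ i, δ_{x i}`, a measure of mass `n`. -/
def diracSum {d n : ℕ} (x : Config (Fin n) d) : Measure (Pt d) := ∑ i, Measure.dirac (x i)

section diracSum
variable {d n : ℕ} (x : Config (Fin n) d)

instance : IsFiniteMeasure (diracSum x) := by unfold diracSum; infer_instance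

lemma finiteMoment_diracSum : FiniteMoment dist 2 (diracSum x) := by
  rw [FiniteMoment, diracSum, lintegral_finsetSum_measure]
  exact ENNReal.sum_lt_top.2 fun i _ => finiteMoment_dirac (x i)

lemma integral_diracSum (f : Pt d → ℝ) :
    ∫ y, f y ∂(diracSum x) = ∑ i, f (x i) := by
  rw [diracSum, integral_finsetSum_measure]
  · simp
  · intro i _
    exact integrable_dirac (by simp)
end diracSum

lemma measurable_integral_section {d : ℕ} {U : Pt d → Pt d → ℝ} (hU : QuadraticKernel U)
    (β : Measure (Pt d)) [SFinite β] : Measurable (fun x => ∫ y, U x y ∂β) :=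
  (hU.measurable.stronglyMeasurable.integral_prod_right (ν := β)).measurable

/-- Kernels which are positive semidefinite on all signed measures `α - β` with finite second
moment, without the restriction to total mass zero. -/
structure PSDKernel {d : ℕ} (K : Pt d → Pt d → ℝ) : Prop extends QuadraticKernel K where
  symm : ∀ x y, K x y = K y x
  nonneg : ∀ α β : Measure (Pt d), IsFiniteMeasure α → IsFiniteMeasure β →
    FiniteMoment dist 2 α → FiniteMoment dist 2 β →
    0 ≤ pairing K α α - 2 * pairing K α β + pairing K β β

namespace PSDKernel
variable {d n : ℕ} {K : Pt d → Pt d → ℝ}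

lemma pairing_diracSum (x : Config (Fin n) d) (κ : Measure (Pt d)) [SFinite κ] :
    pairing K (diracSum x) κ = ∑ i, ∫ y, K (x i) y ∂κ :=
  integral_diracSum x _

lemma pairing_diracSum_self (x : Config (Fin n) d) :
    pairing K (diracSum x) (diracSum x) = ∑ i, ∑ j, K (x i) (x j) := by
  rw [pairing_diracSum]
  congr 1 with i
  exact integral_diracSum x _

lemma pairing_self_nonneg (hK : PSDKernel K) (κ : Measure (Pt d)) [IsFiniteMeasure κ]
    (hκ : FiniteMoment dist 2 κ) : 0 ≤ pairing K κ κ := by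
  have := hK.nonneg κ 0 inferInstance inferInstance hκ (by simp [FiniteMoment])
  simpa [pairing] using this

lemma sum_sum_nonneg (hK : PSDKernel K) (x : Config (Fin n) d) :
    0 ≤ ∑ i, ∑ j, K (x i) (x j) := by
  rw [← pairing_diracSum_self]
  exact hK.pairing_self_nonneg _ (finiteMoment_diracSum x)

lemma diag_nonneg (hK : PSDKernel K) (x : Pt d) : 0 ≤ K x x := by
  simpa using hK.sum_sum_nonneg (n := 1) (fun _ => x)

lemma quadratic_nonneg (hK : PSDKernel K) (x : Config (Fin n) d) (κ : Measure (Pt d))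
    [IsFiniteMeasure κ] (hκ : FiniteMoment dist 2 κ) {s t : ℝ} (hs : 0 ≤ s) (ht : 0 ≤ t) :
    0 ≤ s ^ 2 * (∑ i, ∑ j, K (x i) (x j)) - 2 * (s * t) * (∑ i, ∫ y, K (x i) y ∂κ)
      + t ^ 2 * pairing K κ κ := by
  lift s to NNReal using hs
  lift t to NNReal using ht
  have := hK.nonneg (s • diracSum x) (t • κ) inferInstance inferInstance
    ((finiteMoment_diracSum x).smul s) (hκ.smul t)
  simp only [pairing_smul_left, pairing_smul_right, pairing_diracSum_self] at this
  rw [pairing_diracSum] at this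
  linarith

/-- Convexity of `(v, r) ↦ |v|² / r`, for the vectors `v = ∑ i, δ_{x i}` and `κ`, of squared
norms `Q` and `R` for the kernel. The cases `a = 0` and `n = 0` have to go together, because then
`Q / a = 0 / 0 = 0`. -/
lemma div_add_le (hK : PSDKernel K) (x : Config (Fin n) d) (κ : Measure (Pt d))
    [IsFiniteMeasure κ] (hκ : FiniteMoment dist 2 κ) {a b : ℝ} (ha : 0 ≤ a) (hb : 0 < b)
    (ha0 : a = 0 → n = 0) :
    (a + b)⁻¹ * ((∑ i, ∑ j, K (x i) (x j)) + 2 * (∑ i, ∫ y, K (x i) y ∂κ) + pairing K κ κ)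
      ≤ a⁻¹ * (∑ i, ∑ j, K (x i) (x j)) + b⁻¹ * pairing K κ κ := by
  rcases ha.eq_or_lt with h | h
  · subst h
    obtain rfl := ha0 rfl
    simp
  · have := hK.quadratic_nonneg x κ hκ hb.le ha
    set Q := ∑ i, ∑ j, K (x i) (x j)
    set B := ∑ i, ∫ y, K (x i) y ∂κ
    set R := pairing K κ κ
    rw [← sub_nonneg]
    have e : a⁻¹ * Q + b⁻¹ * R - (a + b)⁻¹ * (Q + 2 * B + R)
        = (a * b * (a + b))⁻¹ * (b ^ 2 * Q - 2 * (b * a) * B + a ^ 2 * R) := by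
      field_simp
      ring
    rw [e]
    positivity
end PSDKernel

/-! ### Centering a kernel of positive type -/

/-- The kernel `⟨U, (δ_x - m) ⊗ (δ_y - m)⟩` of a symmetric kernel `U` and a probability
measure `m`; its integrals against `m` vanish. -/
def centered {d : ℕ} (U : Pt d → Pt d → ℝ) (m : Measure (Pt d)) (x y : Pt d) : ℝ :=
  U x y - (∫ z, U x z ∂m) - (∫ z, U y z ∂m) + pairing U m m

section centered
variable {d : ℕ} {U : Pt d → Pt d → ℝ} {m : Measure (Pt d)} [IsProbabilityMeasure m]

lemma QuadraticKernel.quadraticKernel_centered (hU : QuadraticKernel U)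
    (hm : FiniteMoment dist 2 m) : QuadraticKernel (centered U m) := by
  have h := measurable_integral_section hU m
  refine ⟨((hU.measurable.sub (h.comp measurable_fst)).sub (h.comp measurable_snd)).add_const _, ?_⟩
  obtain ⟨C, hC⟩ := hU.growth
  obtain ⟨D, hD0, hD⟩ := hU.integral_growth hm
  refine ⟨C + 2 * D + |pairing U m m|, fun x y => ?_⟩
  have h1 := hC x y
  have h2 := hD x
  have h3 := hD y
  have h4 : |centered U m x y| ≤
      |U x y| + |∫ z, U x z ∂m| + |∫ z, U y z ∂m| + |pairing U m m| := by
    unfold centered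
    refine (abs_add_le _ _).trans (add_le_add_left ?_ _)
    refine (abs_sub _ _).trans (add_le_add_left ?_ _)
    exact abs_sub _ _
  have h5 : 0 ≤ |pairing U m m| * (‖x‖ ^ 2 + ‖y‖ ^ 2) := by positivity
  have h6 : 0 ≤ D * ‖x‖ ^ 2 := by positivity
  have h7 : 0 ≤ D * ‖y‖ ^ 2 := by positivity
  nlinarith

lemma integral_centered (hU : QuadraticKernel U) (hm : FiniteMoment dist 2 m) (x : Pt d) :
    ∫ y, centered U m x y ∂m = 0 := by
  unfold centered
  have h1 := hU.integrable_section hm x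
  have h2 := hU.integrable_integral hm hm
  rw [integral_sub_sub_add h1 (integrable_const _) h2 (integrable_const _)]
  simp [pairing]

lemma pairing_centered (hU : QuadraticKernel U) (hm : FiniteMoment dist 2 m) {α β : Measure (Pt d)}
    [IsFiniteMeasure α] [IsFiniteMeasure β] (hα : FiniteMoment dist 2 α)
    (hβ : FiniteMoment dist 2 β) :
    pairing (centered U m) α β = pairing U α β - β.real Set.univ * pairing U α m
      - α.real Set.univ * pairing U β m + α.real Set.univ * β.real Set.univ * pairing U m m := by
  have h0 : ∀ x, ∫ y, centered U m x y ∂β = (∫ y, U x y ∂β) - β.real Set.univ * (∫ z, U x z ∂m)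
      - pairing U β m + β.real Set.univ * pairing U m m := by
    intro x
    unfold centered
    have h1 := hU.integrable_section hβ x
    have h2 := hU.integrable_integral hβ hm
    rw [integral_sub_sub_add h1 (integrable_const _) h2 (integrable_const _)]
    simp [pairing]
  have h1 := hU.integrable_integral hα hβ
  have h2 := (hU.integrable_integral hα hm).const_mul (β.real Set.univ)
  rw [pairing]
  simp_rw [h0]
  rw [integral_sub_sub_add h1 h2 (integrable_const _) (integrable_const _), integral_const_mul]
  simp [pairing]
  ring

lemma kernelForm_eq (hU : QuadraticKernel U) {α β : Measure (Pt d)}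
    [IsFiniteMeasure α] [IsFiniteMeasure β] (hα : FiniteMoment dist 2 α)
    (hβ : FiniteMoment dist 2 β) :
    kernelForm U α β = pairing U α α - pairing U α β - pairing U β α + pairing U β β := by
  unfold kernelForm
  rw [hU.pairing_eq_prod hα hα, hU.pairing_eq_prod hα hβ, hU.pairing_eq_prod hβ hα,
    hU.pairing_eq_prod hβ hβ]

lemma kernelForm_eq_pairing_centered (hU : QuadraticKernel U) (hs : ∀ x y, U x y = U y x)
    (hm : FiniteMoment dist 2 m) {ν : Measure (Pt d)} [IsProbabilityMeasure ν]
    (hν : FiniteMoment dist 2 ν) : kernelForm U ν m = pairing (centered U m) ν ν := by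
  rw [kernelForm_eq hU hν hm, pairing_centered hU hm hν hν, hU.pairing_comm hs hm hν]
  simp

/-- The value of the centered kernel on `α - β` is that of `U` on the difference of
`α + β(univ) m` and `β + α(univ) m`, two measures of equal mass. -/
lemma PositiveType.psdKernel_centered (hp : PositiveType U)
    (hU : Measurable (fun z : Pt d × Pt d => U z.1 z.2)) (hm : FiniteMoment dist 2 m) :
    PSDKernel (centered U m) := by
  have hU : QuadraticKernel U := ⟨hU, hp.growth⟩
  refine ⟨hU.quadraticKernel_centered hm, fun x y => ?_, fun α β _ _ hα hβ => ?_⟩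
  · unfold centered
    rw [hp.symm x y]
    ring
  · set p : NNReal := (α Set.univ).toNNReal with hpdef
    set q : NNReal := (β Set.univ).toNNReal with hqdef
    have hp1 : α.real Set.univ = p := rfl
    have hq1 : β.real Set.univ = q := rfl
    have hqm := hm.smul q
    have hpm := hm.smul p
    have key := hp.nonneg (α + q • m) (β + p • m) inferInstance inferInstance
      (hα.add hqm) (hβ.add hpm) (by
        simp only [Measure.add_apply, Measure.smul_apply, measure_univ]
        rw [show α Set.univ = p by simp [hpdef], show β Set.univ = q by simp [hqdef]]
        simp [ENNReal.smul_def, add_comm])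
    rw [kernelForm_eq hU (hα.add hqm) (hβ.add hpm)] at key
    simp only [hU.pairing_add_left hα (hα.add hqm) hqm, hU.pairing_add_left hα (hβ.add hpm) hqm,
      hU.pairing_add_left hβ (hα.add hqm) hpm, hU.pairing_add_left hβ (hβ.add hpm) hpm,
      hU.pairing_add_right hα hα hqm, hU.pairing_add_right hα hβ hpm,
      hU.pairing_add_right hβ hα hqm, hU.pairing_add_right hβ hβ hpm,
      hU.pairing_add_right hqm hα hqm, hU.pairing_add_right hqm hβ hpm,
      hU.pairing_add_right hpm hα hqm, hU.pairing_add_right hpm hβ hpm,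
      pairing_smul_left, pairing_smul_right, hU.pairing_comm hp.symm hm hα,
      hU.pairing_comm hp.symm hm hβ, hU.pairing_comm hp.symm hβ hα] at key
    rw [pairing_centered hU hm hα hα, pairing_centered hU hm hα hβ,
      pairing_centered hU hm hβ hβ, hp1, hq1]
    linarith

end centered

/-! ### Consequences of a bounded mixed Hessian -/

/-- A bound on the mixed Hessian controls the mixed second differences. -/
lemma abs_mixed_difference_le {d : ℕ} {U : Pt d → Pt d → ℝ}
    (hU : ContDiff ℝ 2 (fun z : Pt d × Pt d => U z.1 z.2)) {L : ℝ}
    (hL : ∀ x y, ‖mixedHessian U x y‖ ≤ L) (x x' y y' : Pt d) :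
    |(U x y - U x' y) - (U x y' - U x' y')| ≤ L * ‖x - x'‖ * ‖y - y'‖ := by
  have hd : ∀ a b : Pt d, HasFDerivAt (U a) ((fderiv ℝ (fun z : Pt d × Pt d => U z.1 z.2)
      (a, b)).comp (ContinuousLinearMap.inr ℝ (Pt d) (Pt d))) b := by
    intro a b
    have h1 := ((hU.differentiable (by norm_num)) (a, b)).hasFDerivAt
    exact h1.comp b (hasFDerivAt_prodMk_right a b)
  have hd2 : ∀ b : Pt d, Differentiable ℝ (fun a => fderiv ℝ (U a) b) := by
    intro b
    have h1 : ContDiff ℝ 1 (fderiv ℝ (fun z : Pt d × Pt d => U z.1 z.2)) :=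
      hU.fderiv_right (by norm_num)
    have h2 : Differentiable ℝ (fun a : Pt d => (fderiv ℝ (fun z : Pt d × Pt d => U z.1 z.2)
      (a, b)).comp (ContinuousLinearMap.inr ℝ (Pt d) (Pt d))) := by
      have h3 : Differentiable ℝ (fun a : Pt d => fderiv ℝ (fun z : Pt d × Pt d => U z.1 z.2)
        (a, b)) := (h1.differentiable (by norm_num)).comp (by fun_prop)
      exact h3.clm_comp (differentiable_const _)
    convert h2 using 2 with a
    exact (hd a b).fderiv
  have hb : ∀ b : Pt d, ‖fderiv ℝ (U x) b - fderiv ℝ (U x') b‖ ≤ L * ‖x - x'‖ := by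
    intro b
    exact Convex.norm_image_sub_le_of_norm_fderiv_le (f := fun a => fderiv ℝ (U a) b)
      (s := Set.univ) (fun a _ => hd2 b a) (fun a _ => hL a b) convex_univ trivial trivial
  have := Convex.norm_image_sub_le_of_norm_fderiv_le (𝕜 := ℝ) (f := fun b => U x b - U x' b)
    (s := Set.univ) (C := L * ‖x - x'‖) (x := y') (y := y)
    (fun b _ => ((hd x b).sub (hd x' b)).differentiableAt)
    (fun b _ => by
      rw [HasFDerivAt.fderiv (f := fun b => U x b - U x' b) ((hd x b).sub (hd x' b)),
        ← (hd x b).fderiv, ← (hd x' b).fderiv]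
      exact hb b) convex_univ trivial trivial
  simpa [Real.norm_eq_abs] using this

/-- The diagonal `⟨U, (δ_x - m)^{⊗2}⟩` is the mean, over two independent samples of `m`, of the
mixed second differences of `U` based at `(x, x)`. -/
lemma centered_diag_le {d : ℕ} {U : Pt d → Pt d → ℝ} {m : Measure (Pt d)} [IsProbabilityMeasure m]
    (hU : QuadraticKernel U) (hs : ∀ x y, U x y = U y x) (hm : FiniteMoment dist 2 m)
    (hC : ContDiff ℝ 2 (fun z : Pt d × Pt d => U z.1 z.2)) {L : ℝ}
    (hL : ∀ x y, ‖mixedHessian U x y‖ ≤ L) (x : Pt d) :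
    centered U m x x ≤ L * ∫ z, ‖x - z‖ ^ 2 ∂m := by
  have hL0 : 0 ≤ L := (norm_nonneg (mixedHessian U 0 0)).trans (hL 0 0)
  have hsq : Integrable (fun z : Pt d => ‖x - z‖ ^ 2) m :=
    quadraticKernel_dist_sq.integrable_section hm x
  have hab : Integrable (fun w : Pt d × Pt d => L / 2 * (‖x - w.1‖ ^ 2 + ‖x - w.2‖ ^ 2))
      (m.prod m) := ((hsq.comp_fst m).add (hsq.comp_snd m)).const_mul _
  have hi := hU.integrable_prod hm hm
  have h1 := (hU.integrable_section hm x).comp_fst m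
  have h2 := (hU.integrable_section hm x).comp_snd m
  have e : centered U m x x = ∫ w : Pt d × Pt d, (U x x - U x w.1 - U x w.2 + U w.1 w.2)
      ∂(m.prod m) := by
    rw [integral_sub_sub_add (integrable_const _) h1 h2 hi,
      hU.pairing_eq_prod hm hm, integral_fun_fst (f := U x), integral_fun_snd (f := U x)]
    simp [centered]
  rw [e]
  refine (integral_mono (((((integrable_const _).sub h1).sub h2)).add hi) hab fun w => ?_).trans ?_
  · have := (le_abs_self _).trans (abs_mixed_difference_le hC hL x w.1 x w.2)
    have h3 : L * ‖x - w.1‖ * ‖x - w.2‖ ≤ L / 2 * (‖x - w.1‖ ^ 2 + ‖x - w.2‖ ^ 2) := by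
      nlinarith [mul_nonneg hL0 (sq_nonneg (‖x - w.1‖ - ‖x - w.2‖))]
    have h4 := hs w.1 x
    simp only [Pi.add_apply, Pi.sub_apply]
    linarith
  · rw [integral_const_mul, integral_add (hsq.comp_fst m) (hsq.comp_snd m),
      integral_fun_fst (f := fun z => ‖x - z‖ ^ 2), integral_fun_snd (f := fun z => ‖x - z‖ ^ 2)]
    simp
    linarith

/-- The mean squared distance of two independent samples is twice the total variance. -/
lemma integral_integral_dist_sq {d : ℕ} {m : Measure (Pt d)} [IsProbabilityMeasure m]
    (hm : FiniteMoment dist 2 m) : ∫ x, ∫ z, ‖x - z‖ ^ 2 ∂m ∂m = 2 * totalVar m := by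
  have hm' := finiteMoment_two_iff.1 hm
  have hsq : ∀ j : Fin d, Integrable (fun x : Pt d => (x j) ^ 2) m := by
    intro j
    refine hm'.mono' (by fun_prop) (Filter.Eventually.of_forall fun x => ?_)
    rw [Real.norm_of_nonneg (by positivity), EuclideanSpace.real_norm_sq_eq]
    exact Finset.single_le_sum (f := fun j => (x j) ^ 2) (fun i _ => by positivity)
      (Finset.mem_univ j)
  have hl : ∀ j : Fin d, MemLp (fun x : Pt d => x j) 2 m := fun j =>
    (memLp_two_iff_integrable_sq (by fun_prop)).2 (hsq j)
  have h1 : ∀ j : Fin d, Integrable (fun x : Pt d => x j) m := fun j =>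
    (hl j).integrable (by norm_num)
  have e1 : ∀ x : Pt d, ∫ z, ‖x - z‖ ^ 2 ∂m =
      ∑ j, ((x j) ^ 2 - 2 * x j * (∫ z, z j ∂m) + ∫ z, (z j) ^ 2 ∂m) := by
    intro x
    have : ∀ z : Pt d, ‖x - z‖ ^ 2 = ∑ j, ((x j) ^ 2 - 2 * x j * z j + (z j) ^ 2) := by
      intro z
      rw [EuclideanSpace.real_norm_sq_eq]
      refine Finset.sum_congr rfl fun j _ => ?_
      simp only [PiLp.sub_apply]
      ring
    simp_rw [this]
    rw [integral_finsetSum]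
    · refine Finset.sum_congr rfl fun j _ => ?_
      have h2 : Integrable (fun z : Pt d => 2 * x j * z j) m := (h1 j).const_mul _
      have := integral_sub_sub_add (integrable_const (x j ^ 2)) h2 (integrable_const (0 : ℝ)) (hsq j)
      simp only [sub_zero, integral_const, probReal_univ, one_smul, smul_zero, integral_const_mul] at this
      exact this
    · intro j _
      exact ((integrable_const _).sub ((h1 j).const_mul _)).add (hsq j)
  simp_rw [e1]
  rw [integral_finsetSum]
  · rw [totalVar, Finset.mul_sum]
    refine Finset.sum_congr rfl fun j _ => ?_
    rw [variance_eq_sub (hl j)]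
    have h2 : Integrable (fun x : Pt d => 2 * x j * (∫ z : Pt d, z j ∂m)) m :=
      ((h1 j).const_mul 2).mul_const _
    have := integral_sub_sub_add (hsq j) h2 (integrable_const (0 : ℝ))
      (integrable_const (∫ z : Pt d, z j ^ 2 ∂m))
    simp only [sub_zero, integral_const, probReal_univ, one_smul, smul_zero, integral_const_mul,
      integral_mul_const] at this
    rw [this]
    simp only [Pi.pow_apply]
    ring
  · intro j _
    exact ((hsq j).sub (((h1 j).const_mul 2).mul_const _)).add (integrable_const _)

/-! ### Couplings -/

/-- Gluing of two couplings along their common marginal. -/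
lemma exists_gluing {X Y Z : Type} [MeasurableSpace X] [MeasurableSpace Y] [MeasurableSpace Z]
    [StandardBorelSpace Z] [Nonempty Z] {π : Measure (X × Y)} {ρ : Measure (Y × Z)}
    [IsProbabilityMeasure π] [IsProbabilityMeasure ρ] (h : π.map Prod.snd = ρ.map Prod.fst) :
    ∃ ω : Measure ((X × Y) × Z), IsProbabilityMeasure ω ∧ ω.map Prod.fst = π ∧
      ω.map (fun p => (p.1.2, p.2)) = ρ := by
  refine ⟨π ⊗ₘ (ρ.condKernel.comap Prod.snd measurable_snd), inferInstance,
    Measure.fst_compProd _ _, ?_⟩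
  refine Measure.ext_of_lintegral _ fun f hf => ?_
  rw [lintegral_map hf (by fun_prop), Measure.lintegral_compProd (by fun_prop)]
  simp only [Kernel.comap_apply]
  have hm : Measurable fun y => ∫⁻ z, f (y, z) ∂(ρ.condKernel y) := by
    exact hf.lintegral_kernel_prod_right'
  have e1 : ∫⁻ p, ∫⁻ z, f (p.2, z) ∂(ρ.condKernel p.2) ∂π
      = ∫⁻ y, ∫⁻ z, f (y, z) ∂(ρ.condKernel y) ∂(π.map Prod.snd) :=
    (lintegral_map hm measurable_snd).symm
  rw [e1, h]
  conv_rhs => rw [← ρ.disintegrate ρ.condKernel]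
  rw [Measure.lintegral_compProd hf]
  rfl

section TotalVariation

variable {E : Type} [MeasurableSpace E]

/-- The coupling of the measures of densities `f` and `g` which leaves the common mass
`min f g` in place, and couples the excess masses `f - g` and `g - f` independently. -/
def excessCoupling (m : Measure E) (f g : E → ℝ≥0∞) : Measure (E × E) :=
  (m.withDensity fun y => min (f y) (g y)).map (fun y => (y, y)) +
    (m.prod m).withDensity
      fun z => (f z.1 - g z.1) * (g z.2 - f z.2) / ∫⁻ y, (f y - g y) ∂m

variable {m : Measure E} {f g : E → ℝ≥0∞}

lemma min_add_tsub (a b : ℝ≥0∞) : min a b + (a - b) = a := by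
  rcases le_total a b with h | h
  · simp [h, tsub_eq_zero_of_le]
  · simp [h]

lemma lintegral_tsub_comm (hf : Measurable f) (hg : Measurable g) (h1 : ∫⁻ y, f y ∂m = 1)
    (h2 : ∫⁻ y, g y ∂m = 1) : ∫⁻ y, (f y - g y) ∂m = ∫⁻ y, (g y - f y) ∂m := by
  have e1 : ∫⁻ y, min (f y) (g y) ∂m + ∫⁻ y, (f y - g y) ∂m = 1 := by
    rw [← lintegral_add_left (hf.min hg), ← h1]
    simp_rw [min_add_tsub]
  have e2 : ∫⁻ y, min (f y) (g y) ∂m + ∫⁻ y, (g y - f y) ∂m = 1 := by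
    rw [← lintegral_add_left (hf.min hg), ← h2]
    simp_rw [min_comm (f _), min_add_tsub]
  have hne : ∫⁻ y, min (f y) (g y) ∂m ≠ ∞ := by
    intro h
    simp [h] at e1
  exact (ENNReal.add_right_inj hne).1 (e1.trans e2.symm)

lemma lintegral_excessCoupling (hf : Measurable f) (hg : Measurable g) {c : E × E → ℝ≥0∞}
    (hc : Measurable c) : ∫⁻ z, c z ∂(excessCoupling m f g) =
      ∫⁻ y, min (f y) (g y) * c (y, y) ∂m + (∫⁻ y, (f y - g y) ∂m)⁻¹ *
        ∫⁻ z : E × E, (f z.1 - g z.1) * (g z.2 - f z.2) * c z ∂(m.prod m) := by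
  rw [excessCoupling, lintegral_add_measure, lintegral_map hc (by fun_prop),
    lintegral_withDensity_eq_lintegral_mul _ (hf.min hg) (by fun_prop),
    lintegral_withDensity_eq_lintegral_mul _ (by fun_prop) hc,
    ← lintegral_const_mul _ (by fun_prop)]
  congr 1
  refine lintegral_congr fun z => ?_
  simp only [Pi.mul_apply, div_eq_mul_inv]
  ring

variable [SFinite m]

lemma lintegral_excess_fst (hf : Measurable f) (hg : Measurable g) (h1 : ∫⁻ y, f y ∂m = 1)
    (h2 : ∫⁻ y, g y ∂m = 1) {a : E → ℝ≥0∞} (ha : Measurable a) :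
    (∫⁻ y, (f y - g y) ∂m)⁻¹ *
      ∫⁻ z : E × E, (f z.1 - g z.1) * (g z.2 - f z.2) * a z.1 ∂(m.prod m)
      = ∫⁻ y, (f y - g y) * a y ∂m := by
  have e : ∫⁻ z : E × E, (f z.1 - g z.1) * (g z.2 - f z.2) * a z.1 ∂(m.prod m)
      = (∫⁻ y, (f y - g y) * a y ∂m) * ∫⁻ y, (f y - g y) ∂m := by
    rw [lintegral_tsub_comm hf hg h1 h2, ← lintegral_prod_mul
      (f := fun y => (f y - g y) * a y) (g := fun y => g y - f y) (by fun_prop) (by fun_prop)]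
    exact lintegral_congr fun z => by ring
  rw [e]
  by_cases h0 : ∫⁻ y, (f y - g y) ∂m = 0
  · have : (fun y => f y - g y) =ᵐ[m] 0 := (lintegral_eq_zero_iff (by fun_prop)).1 h0
    have h3 : ∫⁻ y, (f y - g y) * a y ∂m = 0 := by
      rw [lintegral_eq_zero_iff (by fun_prop)]
      filter_upwards [this] with y hy
      simp only [Pi.zero_apply] at hy ⊢
      simp [hy]
    simp [h0, h3]
  · have htop : ∫⁻ y, (f y - g y) ∂m ≠ ∞ := by
      refine ne_top_of_le_ne_top (b := 1) (by simp) ?_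
      rw [← h1]
      exact lintegral_mono fun y => tsub_le_self
    rw [mul_comm (∫⁻ y, (f y - g y) * a y ∂m), ← mul_assoc, ENNReal.inv_mul_cancel h0 htop,
      one_mul]

lemma lintegral_excess_snd (hf : Measurable f) (hg : Measurable g) (h1 : ∫⁻ y, f y ∂m = 1)
    (h2 : ∫⁻ y, g y ∂m = 1) {a : E → ℝ≥0∞} (ha : Measurable a) :
    (∫⁻ y, (f y - g y) ∂m)⁻¹ *
      ∫⁻ z : E × E, (f z.1 - g z.1) * (g z.2 - f z.2) * a z.2 ∂(m.prod m)
      = ∫⁻ y, (g y - f y) * a y ∂m := by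
  rw [← lintegral_excess_fst hg hf h2 h1 ha, lintegral_tsub_comm hf hg h1 h2,
    ← lintegral_prod_swap]
  congr 1
  exact lintegral_congr fun z => by simp only [Prod.fst_swap, Prod.snd_swap]; ring

lemma map_fst_excessCoupling (hf : Measurable f) (hg : Measurable g) (h1 : ∫⁻ y, f y ∂m = 1)
    (h2 : ∫⁻ y, g y ∂m = 1) : (excessCoupling m f g).map Prod.fst = m.withDensity f := by
  refine Measure.ext_of_lintegral _ fun a ha => ?_
  rw [lintegral_map ha measurable_fst, lintegral_excessCoupling hf hg (by fun_prop),
    lintegral_excess_fst hf hg h1 h2 ha, ← lintegral_add_left (by fun_prop),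
    lintegral_withDensity_eq_lintegral_mul _ hf ha]
  simp_rw [← add_mul, min_add_tsub]
  rfl

lemma map_snd_excessCoupling (hf : Measurable f) (hg : Measurable g) (h1 : ∫⁻ y, f y ∂m = 1)
    (h2 : ∫⁻ y, g y ∂m = 1) : (excessCoupling m f g).map Prod.snd = m.withDensity g := by
  refine Measure.ext_of_lintegral _ fun a ha => ?_
  rw [lintegral_map ha measurable_snd, lintegral_excessCoupling hf hg (by fun_prop),
    lintegral_excess_snd hf hg h1 h2 ha, ← lintegral_add_left (by fun_prop),
    lintegral_withDensity_eq_lintegral_mul _ hg ha]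
  simp_rw [← add_mul, min_comm (f _), min_add_tsub]
  rfl

/-- If `c(y, z) ≤ a(y) + a(z)`, the excess coupling costs at most the total variation weighted
by `a`. -/
lemma lintegral_excessCoupling_le (hf : Measurable f) (hg : Measurable g)
    (h1 : ∫⁻ y, f y ∂m = 1) (h2 : ∫⁻ y, g y ∂m = 1) {c : E × E → ℝ≥0∞} (hc : Measurable c)
    {a : E → ℝ≥0∞} (ha : Measurable a) (hc0 : ∀ y, c (y, y) = 0)
    (hca : ∀ z, c z ≤ a z.1 + a z.2) :
    ∫⁻ z, c z ∂(excessCoupling m f g) ≤ ∫⁻ y, ((f y - g y) + (g y - f y)) * a y ∂m := by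
  rw [lintegral_excessCoupling hf hg hc]
  simp only [hc0, mul_zero, lintegral_zero, zero_add]
  calc _ ≤ (∫⁻ y, (f y - g y) ∂m)⁻¹ * ∫⁻ z : E × E, ((f z.1 - g z.1) * (g z.2 - f z.2) * a z.1
        + (f z.1 - g z.1) * (g z.2 - f z.2) * a z.2) ∂(m.prod m) := by
        gcongr with z
        rw [← mul_add]
        gcongr
        exact hca z
    _ = ∫⁻ y, ((f y - g y) + (g y - f y)) * a y ∂m := by
        rw [lintegral_add_left (by fun_prop), mul_add, lintegral_excess_fst hf hg h1 h2 ha,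
          lintegral_excess_snd hf hg h1 h2 ha, ← lintegral_add_left (by fun_prop)]
        simp_rw [add_mul]

end TotalVariation

lemma exists_kernel_excessCoupling {X E : Type} [MeasurableSpace X] [MeasurableSpace E]
    (m : Measure E) [IsFiniteMeasure m] {f g : X → E → ℝ≥0∞}
    (hf : Measurable (Function.uncurry f)) (hg : Measurable (Function.uncurry g)) :
    ∃ T : Kernel X (E × E), ∀ x, T x = excessCoupling m (f x) (g x) := by
  have hM : Measurable fun x => ∫⁻ y, (f x y - g x y) ∂m :=
    Measurable.lintegral_prod_right' (f := fun p : X × E => f p.1 p.2 - g p.1 p.2) (hf.sub hg)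
  have h1 : Measurable (Function.uncurry fun x y => min (f x y) (g x y)) := hf.min hg
  have h2 : Measurable (Function.uncurry fun x (z : E × E) =>
      (f x z.1 - g x z.1) * (g x z.2 - f x z.2) / ∫⁻ y, (f x y - g x y) ∂m) := by
    have a1 : Measurable fun p : X × (E × E) => (p.1, p.2.1) := by fun_prop
    have a2 : Measurable fun p : X × (E × E) => (p.1, p.2.2) := by fun_prop
    exact (((hf.comp a1).sub (hg.comp a1)).mul ((hg.comp a2).sub (hf.comp a2))).div
      (hM.comp measurable_fst)
  refine ⟨(Kernel.withDensity (Kernel.const X m) fun x y => min (f x y) (g x y)).map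
      (fun y => (y, y)) + Kernel.withDensity (Kernel.const X (m.prod m)) fun x z =>
        (f x z.1 - g x z.1) * (g x z.2 - f x z.2) / ∫⁻ y, (f x y - g x y) ∂m, fun x => ?_⟩
  rw [add_apply, Kernel.map_apply _ (by fun_prop), Kernel.withDensity_apply _ h1,
    Kernel.withDensity_apply _ h2]
  rfl

/-! ### Measurable choice of nearly optimal couplings -/

/-- A measurable family of densities, together with a measurable function, takes up to any `η`
only countably many values; the error of the densities is measured in `L¹(w m)`. -/
lemma exists_measurable_approx {X E : Type} [MeasurableSpace X] [MeasurableSpace E]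
    [MeasurableSpace.CountablyGenerated E] [Nonempty X] (m : Measure E) [IsFiniteMeasure m]
    {f : X → E → NNReal} (hf : Measurable (Function.uncurry f)) {w : E → ℝ≥0∞}
    (hw : Measurable w) (hwm : ∫⁻ y, w y ∂m < ∞) (hfw : ∀ x, ∫⁻ y, f x y * w y ∂m < ∞)
    {G : X → NNReal} (hG : Measurable G) {η : NNReal} (hη : 0 < η) :
    ∃ (u : ℕ → X) (k : X → ℕ), Measurable k ∧ ∀ x, G (u (k x)) ≤ G x + η ∧
      ∫⁻ y, (((f x y : ℝ≥0∞) - f (u (k x)) y) + (f (u (k x)) y - f x y)) * w y ∂m ≤ η := by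
  classical
  have hfx : ∀ x, Measurable (f x) := fun x => hf.comp measurable_prodMk_left
  let m' := m.withDensity w
  have : IsFiniteMeasure m' := isFiniteMeasure_withDensity hwm.ne
  have hL : ∀ x, Integrable (fun y => (f x y : ℝ)) m' := by
    intro x
    refine ⟨(hfx x).coe_nnreal_real.aestronglyMeasurable, ?_⟩
    rw [HasFiniteIntegral, lintegral_withDensity_eq_lintegral_mul _ hw (by
      exact (hfx x).coe_nnreal_real.enorm)]
    refine lt_of_le_of_lt (le_of_eq ?_) (hfw x)
    refine lintegral_congr fun y => ?_
    simp [mul_comm]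
  have : Fact ((1 : ℝ≥0∞) ≠ ∞) := ⟨by simp⟩
  let Φ : X → Lp ℝ 1 m' × ℝ := fun x => ((hL x).toL1 _, (G x : ℝ))
  obtain ⟨v, hv⟩ := TopologicalSpace.exists_dense_seq (Set.range Φ)
  choose u hu using fun n => (v n).2
  have hsymm : ∀ (a b : NNReal), ((a : ℝ≥0∞) - b) + (b - a) = edist (a : ℝ) (b : ℝ) := by
    intro a b
    rw [edist_dist, Real.dist_eq]
    rcases le_total a b with h | h
    · rw [tsub_eq_zero_of_le (by exact_mod_cast h), zero_add, abs_sub_comm,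
        abs_of_nonneg (by simpa using h), ENNReal.ofReal_sub _ (by positivity)]
      simp
    · rw [tsub_eq_zero_of_le (a := (b : ℝ≥0∞)) (by exact_mod_cast h), add_zero,
        abs_of_nonneg (by simpa using h), ENNReal.ofReal_sub _ (by positivity)]
      simp
  have hdist : ∀ x x', ∫⁻ y, (((f x y : ℝ≥0∞) - f x' y) + (f x' y - f x y)) * w y ∂m
      = edist ((hL x).toL1 _) ((hL x').toL1 _) := by
    intro x x'
    rw [Integrable.edist_toL1_toL1, lintegral_withDensity_eq_lintegral_mul _ hw (by
      exact (hfx x).coe_nnreal_real.edist (hfx x').coe_nnreal_real)]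
    refine lintegral_congr fun y => ?_
    rw [hsymm, mul_comm]
    rfl
  have hex : ∀ x, ∃ n, G (u n) ≤ G x + η ∧
      ∫⁻ y, (((f x y : ℝ≥0∞) - f (u n) y) + (f (u n) y - f x y)) * w y ∂m ≤ η := by
    intro x
    obtain ⟨n, hn⟩ := hv.exists_dist_lt (⟨Φ x, x, rfl⟩ : Set.range Φ) (ε := η) (by exact_mod_cast hη)
    have hn' : dist (Φ x) (Φ (u n)) < η := by rw [hu n]; exact hn
    refine ⟨n, ?_, ?_⟩
    · have h1 := (le_max_right _ _).trans_lt hn'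
      simp only [Φ] at h1
      rw [dist_comm, Real.dist_eq] at h1
      have h2 := (le_abs_self _).trans h1.le
      have : (G (u n) : ℝ) ≤ G x + η := by linarith
      exact_mod_cast this
    · have h1 := (le_max_left _ _).trans_lt hn'
      rw [hdist, edist_dist]
      refine (ENNReal.ofReal_le_ofReal h1.le).trans ?_
      simp
  refine ⟨u, fun x => Nat.find (hex x), measurable_find hex fun n => ?_,
    fun x => Nat.find_spec (hex x)⟩
  have h1 : Measurable fun p : X × E => (f p.1 p.2 : ℝ≥0∞) := hf.coe_nnreal_ennreal
  have h2 : Measurable fun p : X × E => (f (u n) p.2 : ℝ≥0∞) :=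
    ((hfx (u n)).comp measurable_snd).coe_nnreal_ennreal
  have h3 : Measurable fun x => ∫⁻ y, (((f x y : ℝ≥0∞) - f (u n) y) + (f (u n) y - f x y)) * w y ∂m :=
    Measurable.lintegral_prod_right' (f := fun p : X × E =>
    (((f p.1 p.2 : ℝ≥0∞) - f (u n) p.2) + (f (u n) p.2 - f p.1 p.2)) * w p.2)
    (((h1.sub h2).add (h2.sub h1)).mul (hw.comp measurable_snd))
  have h4 : MeasurableSet {x | G (u n) ≤ G x + η} := measurableSet_le measurable_const (hG.add_const η)
  exact h4.inter (measurableSet_le h3 measurable_const)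

lemma isProbabilityMeasure_of_coupling {X : Type} [MeasurableSpace X] {μ ν : Measure X}
    [IsProbabilityMeasure μ] {π : Measure (X × X)} (h : π ∈ couplings μ ν) :
    IsProbabilityMeasure π := by
  constructor
  have := congrArg (fun ρ : Measure X => ρ Set.univ) h.1
  simpa [Measure.map_apply measurable_fst MeasurableSet.univ] using this

/-- A nearly optimal coupling. The cost is scaled by `l` so that `l = 0`, where the Wasserstein
cost is unrestricted, needs no separate treatment. -/
lemma exists_coupling_le {X : Type} [MeasurableSpace X] (ρ : X → X → ℝ) (p : ℕ) {μ ν : Measure X}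
    [IsProbabilityMeasure μ] [IsProbabilityMeasure ν] {l G η : NNReal} (hη : 0 < η)
    (h : l * wassersteinPow ρ p μ ν ≤ G) :
    ∃ π ∈ couplings μ ν, l * ∫⁻ z, ENNReal.ofReal (ρ z.1 z.2 ^ p) ∂π ≤ G + η := by
  rcases eq_or_ne l 0 with rfl | hl
  · exact ⟨μ.prod ν, ⟨by simp, by simp⟩, by simp⟩
  · have hl' : (l : ℝ≥0∞) ≠ 0 := by simpa using hl
    have h1 : wassersteinPow ρ p μ ν < (G + η) / l := by
      rw [ENNReal.lt_div_iff_mul_lt (.inl hl') (.inl (by simp)), mul_comm]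
      refine h.trans_lt (ENNReal.lt_add_right (by simp) (by exact_mod_cast hη.ne'))
    rw [wassersteinPow] at h1
    simp only [iInf_lt_iff] at h1
    obtain ⟨π, hπ, h2⟩ := h1
    refine ⟨π, hπ, ?_⟩
    rw [ENNReal.lt_div_iff_mul_lt (.inl hl') (.inl (by simp)), mul_comm] at h2
    exact h2.le

lemma dist_sq_le_weighted {d : ℕ} {θ : ℝ} (hθ : 0 < θ) (x y z : Pt d) :
    dist x z ^ 2 ≤ (1 + θ) * dist y z ^ 2 + (1 + θ⁻¹) * dist x y ^ 2 := by
  have h1 := dist_triangle x y z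
  have h2 : dist x z ^ 2 ≤ (dist x y + dist y z) ^ 2 := by gcongr
  have h3 : 0 ≤ θ⁻¹ * (θ * dist y z - dist x y) ^ 2 := by positivity
  have h4 : θ⁻¹ * (θ * dist y z - dist x y) ^ 2
      = θ * dist y z ^ 2 - 2 * (dist x y * dist y z) + θ⁻¹ * dist x y ^ 2 := by
    field_simp
    ring
  nlinarith

/-- Measurable choice of nearly optimal couplings of the laws `f x m` with `m`: the parameter is
cut into countably many pieces on which `f x m` varies little, a coupling is chosen for one
parameter of each piece, and it is glued to the excess coupling of `f x m` with the law
at that parameter. -/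
lemma exists_kernel_coupling {X : Type} [MeasurableSpace X] [Nonempty X] {d : ℕ}
    (m : Measure (Pt d)) [IsProbabilityMeasure m] (hm : FiniteMoment dist 2 m)
    {f : X → Pt d → NNReal} (hf : Measurable (Function.uncurry f))
    (hf1 : ∀ x, ∫⁻ y, f x y ∂m = 1)
    (hf2 : ∀ x, FiniteMoment dist 2 (m.withDensity fun y => f x y))
    {l : NNReal} {G : X → NNReal} (hG : Measurable G)
    (hGW : ∀ x, l * wassersteinPow dist 2 (m.withDensity fun y => f x y) m ≤ G x)
    {θ : NNReal} (hθ : 0 < θ) :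
    ∃ π : Kernel X (Pt d × Pt d), ∀ x,
      π x ∈ couplings (m.withDensity fun y => f x y) m ∧
      l * ∫⁻ z, ENNReal.ofReal (dist z.1 z.2 ^ 2) ∂(π x) ≤ (1 + θ) * G x + θ := by
  have hfx : ∀ x, Measurable fun y => (f x y : ℝ≥0∞) := fun x =>
    (hf.comp measurable_prodMk_left).coe_nnreal_ennreal
  have hprob : ∀ x, IsProbabilityMeasure (m.withDensity fun y => (f x y : ℝ≥0∞)) := fun x =>
    ⟨by rw [withDensity_apply _ MeasurableSet.univ, setLIntegral_univ, hf1]⟩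
  -- the error of the pieces is chosen such that all errors add up to `θ`
  obtain ⟨η, hη, hηθ⟩ : ∃ η : NNReal, 0 < η ∧
      ((1 + θ) * 2 + (1 + θ⁻¹) * l) * η ≤ θ := by
    refine ⟨θ / ((1 + θ) * 2 + (1 + θ⁻¹) * l), by positivity, ?_⟩
    rw [mul_div_cancel₀ _ (by positivity)]
  have hw : Measurable fun y : Pt d => ENNReal.ofReal (2 * dist y 0 ^ 2) := by fun_prop
  have hwm : ∫⁻ y, ENNReal.ofReal (2 * dist y 0 ^ 2) ∂m < ∞ := by
    simp_rw [ENNReal.ofReal_mul (zero_le_two)]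
    rw [lintegral_const_mul _ (by fun_prop)]
    exact ENNReal.mul_lt_top (by simp) hm
  have hfw : ∀ x, ∫⁻ y, f x y * ENNReal.ofReal (2 * dist y 0 ^ 2) ∂m < ∞ := by
    intro x
    have h1 := hf2 x
    rw [FiniteMoment, lintegral_withDensity_eq_lintegral_mul _ (hfx x) (by fun_prop)] at h1
    have h2 : ∀ y : Pt d, f x y * ENNReal.ofReal (2 * dist y 0 ^ 2)
        = ENNReal.ofReal 2 * (f x y * ENNReal.ofReal (dist y 0 ^ 2)) := fun y => by
      rw [ENNReal.ofReal_mul zero_le_two]; ring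
    simp_rw [h2]
    rw [lintegral_const_mul' _ _ ENNReal.ofReal_ne_top]
    exact ENNReal.mul_lt_top (by simp) h1
  obtain ⟨u, k, hk, huk⟩ := exists_measurable_approx m hf hw hwm hfw hG hη
  choose ρ hρ hρc using fun n => exists_coupling_le dist 2 hη (hGW (u n))
  have : ∀ n, IsProbabilityMeasure (ρ n) := fun n => isProbabilityMeasure_of_coupling (hρ n)
  have hg : Measurable (Function.uncurry fun x y => (f (u (k x)) y : ℝ≥0∞)) := by
    have h1 : Measurable fun p : ℕ × Pt d => (f (u p.1) p.2 : ℝ≥0∞) :=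
      measurable_from_prod_countable_right fun n => hfx (u n)
    exact h1.comp ((hk.comp measurable_fst).prodMk measurable_snd)
  obtain ⟨T, hT⟩ := exists_kernel_excessCoupling m (f := fun x y => (f x y : ℝ≥0∞))
    hf.coe_nnreal_ennreal hg
  have hT1 : ∀ x, (T x).map Prod.fst = m.withDensity fun y => (f x y : ℝ≥0∞) := fun x => by
    rw [hT]; exact map_fst_excessCoupling (hfx x) (hfx _) (hf1 x) (hf1 _)
  have hT2 : ∀ x, (T x).map Prod.snd = m.withDensity fun y => (f (u (k x)) y : ℝ≥0∞) := fun x => by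
    rw [hT]; exact map_snd_excessCoupling (hfx x) (hfx _) (hf1 x) (hf1 _)
  have : IsMarkovKernel T := ⟨fun x => isProbabilityMeasure_of_coupling ⟨hT1 x, hT2 x⟩⟩
  have hTc : ∀ x, ∫⁻ z, ENNReal.ofReal (dist z.1 z.2 ^ 2) ∂(T x) ≤ η := by
    intro x
    rw [hT]
    refine (lintegral_excessCoupling_le (hfx x) (hfx _) (hf1 x) (hf1 _) (by fun_prop) hw
      (by simp) fun z => ?_).trans (huk x).2
    rw [← ENNReal.ofReal_add (by positivity) (by positivity)]
    refine ENNReal.ofReal_le_ofReal ?_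
    have h1 := dist_triangle_right z.1 z.2 0
    have h2 : dist z.1 z.2 ^ 2 ≤ (dist z.1 0 + dist z.2 0) ^ 2 := by gcongr
    nlinarith [sq_nonneg (dist z.1 0 - dist z.2 0)]
  let p : Kernel (ℕ × Pt d) (Pt d) := ⟨fun q => (ρ q.1).condKernel q.2,
    measurable_from_prod_countable_right fun n => (ρ n).condKernel.measurable⟩
  have : IsMarkovKernel p := ⟨fun q => by
    change IsProbabilityMeasure ((ρ q.1).condKernel q.2); infer_instance⟩
  have hq : Measurable fun r : X × (Pt d × Pt d) => (k r.1, r.2.2) :=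
    (hk.comp measurable_fst).prodMk (by fun_prop)
  let Ω : Kernel X ((Pt d × Pt d) × Pt d) := T ⊗ₖ p.comap _ hq
  have hΩ : ∀ x {c : (Pt d × Pt d) × Pt d → ℝ≥0∞}, Measurable c → ∫⁻ r, c r ∂(Ω x)
      = ∫⁻ z, ∫⁻ y, c (z, y) ∂((ρ (k x)).condKernel z.2) ∂(T x) := fun x c hc =>
    Kernel.lintegral_compProd _ _ _ hc
  have hΩ1 : ∀ x {c : Pt d × Pt d → ℝ≥0∞}, Measurable c →
      ∫⁻ r, c r.1 ∂(Ω x) = ∫⁻ z, c z ∂(T x) := fun x c hc => by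
    rw [hΩ x (by fun_prop)]
    simp
  have hΩ2 : ∀ x {c : Pt d × Pt d → ℝ≥0∞}, Measurable c →
      ∫⁻ r, c (r.1.2, r.2) ∂(Ω x) = ∫⁻ z, c z ∂(ρ (k x)) := fun x c hc => by
    rw [hΩ x (by fun_prop)]
    have hmc : Measurable fun y => ∫⁻ z, c (y, z) ∂((ρ (k x)).condKernel y) :=
      hc.lintegral_kernel_prod_right'
    have e1 := lintegral_map (μ := T x) hmc measurable_snd
    simp only
    rw [← e1, hT2, ← (hρ (k x)).1]
    conv_rhs => rw [← (ρ (k x)).disintegrate (ρ (k x)).condKernel]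
    rw [Measure.lintegral_compProd hc]
    rfl
  refine ⟨Ω.map fun r => (r.1.1, r.2), fun x => ⟨⟨?_, ?_⟩, ?_⟩⟩
  · refine Measure.ext_of_lintegral _ fun c hc => ?_
    rw [Kernel.map_apply _ (by fun_prop), Measure.map_map (by fun_prop) (by fun_prop),
      lintegral_map hc (by fun_prop)]
    simp only [Function.comp_apply]
    rw [hΩ1 x (c := fun z => c z.1) (by fun_prop), ← hT1, lintegral_map hc measurable_fst]
  · refine Measure.ext_of_lintegral _ fun c hc => ?_
    rw [Kernel.map_apply _ (by fun_prop), Measure.map_map (by fun_prop) (by fun_prop),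
      lintegral_map hc (by fun_prop)]
    simp only [Function.comp_apply]
    rw [hΩ2 x (c := fun z => c z.2) (by fun_prop), ← (hρ (k x)).2, lintegral_map hc measurable_snd]
  · rw [Kernel.map_apply _ (by fun_prop), lintegral_map (by fun_prop) (by fun_prop)]
    have hθ' : (0 : ℝ) < θ := by exact_mod_cast hθ
    calc (l : ℝ≥0∞) * ∫⁻ r, ENNReal.ofReal (dist r.1.1 r.2 ^ 2) ∂(Ω x)
        ≤ l * ∫⁻ r, ((1 + θ) * ENNReal.ofReal (dist r.1.2 r.2 ^ 2)
            + (1 + (θ⁻¹ : NNReal)) * ENNReal.ofReal (dist r.1.1 r.1.2 ^ 2)) ∂(Ω x) := by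
          gcongr with r
          refine (ENNReal.ofReal_le_ofReal (dist_sq_le_weighted hθ' r.1.1 r.1.2 r.2)).trans ?_
          rw [ENNReal.ofReal_add (by positivity) (by positivity),
            ENNReal.ofReal_mul (by positivity), ENNReal.ofReal_mul (by positivity),
            ENNReal.ofReal_add (by positivity) (by positivity),
            ENNReal.ofReal_add (by positivity) (by positivity), ← NNReal.coe_inv,
            ENNReal.ofReal_one, ENNReal.ofReal_coe_nnreal, ENNReal.ofReal_coe_nnreal]
      _ = (1 + θ) * (l * ∫⁻ z, ENNReal.ofReal (dist z.1 z.2 ^ 2) ∂(ρ (k x)))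
            + (1 + (θ⁻¹ : NNReal)) * l * ∫⁻ z, ENNReal.ofReal (dist z.1 z.2 ^ 2) ∂(T x) := by
          rw [lintegral_add_left (by fun_prop), lintegral_const_mul _ (by fun_prop),
            lintegral_const_mul _ (by fun_prop),
            hΩ2 x (c := fun z => ENNReal.ofReal (dist z.1 z.2 ^ 2)) (by fun_prop),
            hΩ1 x (c := fun z => ENNReal.ofReal (dist z.1 z.2 ^ 2)) (by fun_prop)]
          ring
      _ ≤ (1 + θ) * (((G x + η : NNReal) : ℝ≥0∞) + η) + (1 + (θ⁻¹ : NNReal)) * l * η := by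
          gcongr
          · refine (hρc (k x)).trans ?_
            gcongr
            exact (huk x).1
          · exact hTc x
      _ = (1 + θ) * G x + (((1 + θ) * 2 + (1 + θ⁻¹) * l) * η : NNReal) := by
          push_cast
          ring
      _ ≤ (1 + θ) * G x + θ := by
          gcongr

/-! ### Disintegration of the relative entropy -/

lemma exists_nnreal_density {X : Type} [MeasurableSpace X] {μ ν : Measure X} [SigmaFinite μ]
    [IsFiniteMeasure ν] (h : ν ≪ μ) :
    ∃ f : X → NNReal, Measurable f ∧ ν = μ.withDensity fun x => (f x : ℝ≥0∞) := by
  refine ⟨fun x => (ν.rnDeriv μ x).toNNReal, (Measure.measurable_rnDeriv ν μ).ennreal_toNNReal, ?_⟩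
  conv_lhs => rw [← Measure.withDensity_rnDeriv_eq ν μ h]
  refine withDensity_congr_ae ?_
  filter_upwards [Measure.rnDeriv_lt_top ν μ] with x hx
  rw [ENNReal.coe_toNNReal hx.ne]

lemma klDiv_withDensity {X : Type} [MeasurableSpace X] {μ : Measure X} [IsFiniteMeasure μ]
    {f : X → NNReal} (hf : Measurable f) (hf1 : ∫⁻ x, f x ∂μ ≠ ∞) :
    klDiv (μ.withDensity fun x => (f x : ℝ≥0∞)) μ = ∫⁻ x, ENNReal.ofReal (klFun (f x)) ∂μ := by
  have : IsFiniteMeasure (μ.withDensity fun x => (f x : ℝ≥0∞)) := isFiniteMeasure_withDensity hf1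
  rw [klDiv_eq_lintegral_klFun_of_ac (withDensity_absolutelyContinuous _ _)]
  refine lintegral_congr_ae ?_
  filter_upwards [Measure.rnDeriv_withDensity μ hf.coe_nnreal_ennreal] with x hx
  rw [hx]
  rfl

lemma klDiv_map_equiv {X Y : Type} [MeasurableSpace X] [MeasurableSpace Y] (e : X ≃ᵐ Y)
    (μ ν : Measure X) [IsFiniteMeasure μ] [IsFiniteMeasure ν] :
    klDiv (μ.map e) (ν.map e) = klDiv μ ν := by
  refine le_antisymm (klDiv_map_le μ ν e.measurable) ?_
  have := klDiv_map_le (μ.map e) (ν.map e) e.symm.measurable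
  simpa using this

/-- A law on a product with finite entropy relative to `P ⊗ m` disintegrates along a kernel of
densities with respect to `m`, and its entropy is that of the first marginal
plus the mean entropy of the conditional laws. The properties of the conditional laws, which are
natural almost surely, can be made to hold everywhere. -/
lemma exists_density_kernel {X : Type} [MeasurableSpace X] {d : ℕ} (P : Measure X)
    [IsProbabilityMeasure P] (m : Measure (Pt d)) [IsProbabilityMeasure m]
    (hm : FiniteMoment dist 2 m) (ν : Measure (X × Pt d)) [IsProbabilityMeasure ν]
    (hν : klDiv ν (P.prod m) ≠ ∞) (hν2 : ∫⁻ p, ENNReal.ofReal (dist p.2 0 ^ 2) ∂ν < ∞) :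
    ∃ (f : X → Pt d → NNReal) (κ : Kernel X (Pt d)) (H : X → NNReal),
      Measurable (Function.uncurry f) ∧ Measurable H ∧ IsMarkovKernel κ ∧
      (∀ x, κ x = m.withDensity fun y => (f x y : ℝ≥0∞)) ∧
      (∀ x, ∫⁻ y, f x y ∂m = 1) ∧
      (∀ x, FiniteMoment dist 2 (κ x)) ∧ (∀ x, klDiv (κ x) m = H x) ∧ ν = ν.fst ⊗ₘ κ ∧
      klDiv ν (P.prod m) = klDiv ν.fst P + ∫⁻ x, H x ∂ν.fst := by
  classical
  set μ := ν.fst with hμ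
  have hchain : klDiv ν (P.prod m) = klDiv μ P + klDiv ν (μ.prod m) := by
    have := klDiv_compProd_eq_add μ P ν.condKernel (Kernel.const X m)
    rwa [Measure.compProd_const, Measure.compProd_const, ν.disintegrate] at this
  have hν' : klDiv ν (μ.prod m) ≠ ∞ := by
    intro h
    rw [hchain, h] at hν
    simp at hν
  have hac : ν ≪ μ.prod m := (klDiv_ne_top_iff.1 hν').1
  have hμP : IsProbabilityMeasure μ := by rw [hμ]; infer_instance
  clear_value μ
  obtain ⟨f₀, hf₀, hν0⟩ : ∃ f₀ : X → Pt d → NNReal, Measurable (Function.uncurry f₀) ∧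
      ν = (μ.prod m).withDensity fun p => (f₀ p.1 p.2 : ℝ≥0∞) := by
    obtain ⟨F, hF, hνF⟩ := exists_nnreal_density hac
    exact ⟨fun x y => F (x, y), hF, hνF⟩
  have hf₀' : Measurable fun p : X × Pt d => (f₀ p.1 p.2 : ℝ≥0∞) := hf₀.coe_nnreal_ennreal
  have hw : Measurable fun p : X × Pt d => ENNReal.ofReal (dist p.2 0 ^ 2) := by fun_prop
  have hkl : Measurable fun p : X × Pt d => ENNReal.ofReal (klFun (f₀ p.1 p.2)) :=
    (measurable_klFun.comp hf₀.coe_nnreal_real).ennreal_ofReal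
  have m1 : Measurable fun x => ∫⁻ y, f₀ x y ∂m := hf₀'.lintegral_prod_right'
  have m2 : Measurable fun x => ∫⁻ y, f₀ x y * ENNReal.ofReal (dist y 0 ^ 2) ∂m :=
    (hf₀'.mul hw).lintegral_prod_right'
  have m3 : Measurable fun x => ∫⁻ y, ENNReal.ofReal (klFun (f₀ x y)) ∂m :=
    hkl.lintegral_prod_right'
  have a1 : (fun x => ∫⁻ y, f₀ x y ∂m) =ᵐ[μ] fun _ => 1 := by
    refine ae_eq_of_forall_setLIntegral_eq_of_sigmaFinite m1 measurable_const fun s hs _ => ?_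
    have h1 : μ s = ∫⁻ x in s, ∫⁻ y, f₀ x y ∂m ∂μ := by
      have h2 : μ s = ν (s ×ˢ Set.univ) := by
        rw [hμ, Measure.fst_apply hs, Set.prod_univ]
      rw [h2, hν0, withDensity_apply _ (hs.prod MeasurableSet.univ),
        setLIntegral_prod _ hf₀'.aemeasurable.restrict]
      simp
    rw [← h1, setLIntegral_one]
  have a2 : ∀ᵐ x ∂μ, ∫⁻ y, f₀ x y * ENNReal.ofReal (dist y 0 ^ 2) ∂m < ∞ := by
    refine ae_lt_top m2 ?_
    rw [hν0, lintegral_withDensity_eq_lintegral_mul _ hf₀' hw,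
      lintegral_prod _ (hf₀'.mul hw).aemeasurable] at hν2
    exact hν2.ne
  have hent : klDiv ν (μ.prod m) = ∫⁻ x, ∫⁻ y, ENNReal.ofReal (klFun (f₀ x y)) ∂m ∂μ := by
    have h1 := klDiv_withDensity (μ := μ.prod m) (f := fun p => f₀ p.1 p.2) hf₀ (by
      have h2 := congrArg (fun ρ : Measure (X × Pt d) => ρ Set.univ) hν0
      simp only [measure_univ, withDensity_apply _ MeasurableSet.univ, setLIntegral_univ] at h2
      exact h2 ▸ ENNReal.one_ne_top)
    rw [← hν0] at h1
    rw [h1]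
    exact lintegral_prod _ hkl.aemeasurable
  have a3 : ∀ᵐ x ∂μ, ∫⁻ y, ENNReal.ofReal (klFun (f₀ x y)) ∂m < ∞ :=
    ae_lt_top m3 (hent ▸ hν')
  -- outside of `A`, on a null set of parameters, the density is replaced by `1`
  let A : Set X := {x | ∫⁻ y, f₀ x y ∂m = 1 ∧
    ∫⁻ y, f₀ x y * ENNReal.ofReal (dist y 0 ^ 2) ∂m < ∞ ∧
    ∫⁻ y, ENNReal.ofReal (klFun (f₀ x y)) ∂m < ∞}
  have hA : MeasurableSet A := (m1 (measurableSet_singleton 1)).inter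
    ((measurableSet_lt m2 measurable_const).inter (measurableSet_lt m3 measurable_const))
  have hAae : ∀ᵐ x ∂μ, x ∈ A := by
    filter_upwards [a1, a2, a3] with x h1 h2 h3 using ⟨h1, h2, h3⟩
  let f : X → Pt d → NNReal := fun x y => if x ∈ A then f₀ x y else 1
  have hf : Measurable (Function.uncurry f) :=
    Measurable.ite (measurable_fst hA) hf₀ measurable_const
  have hfA : ∀ x ∈ A, f x = f₀ x := fun x hx => funext fun y => if_pos hx
  have hfA' : ∀ x ∉ A, f x = fun _ => 1 := fun x hx => funext fun y => if_neg hx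
  have hfx : ∀ x, Measurable (f x) := fun x => hf.comp measurable_prodMk_left
  have hf1 : ∀ x, ∫⁻ y, f x y ∂m = 1 := by
    intro x
    by_cases hx : x ∈ A
    · rw [hfA x hx]; exact hx.1
    · rw [hfA' x hx]; simp
  have hkl' : Measurable fun p : X × Pt d => ENNReal.ofReal (klFun (f p.1 p.2)) :=
    (measurable_klFun.comp hf.coe_nnreal_real).ennreal_ofReal
  have hH : ∀ x, ∫⁻ y, ENNReal.ofReal (klFun (f x y)) ∂m ≠ ∞ := by
    intro x
    by_cases hx : x ∈ A
    · rw [hfA x hx]; exact hx.2.2.ne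
    · rw [hfA' x hx]; simp [klFun_one]
  let κ : Kernel X (Pt d) := Kernel.withDensity (Kernel.const X m) fun x y => f x y
  have hκ : ∀ x, κ x = m.withDensity fun y => (f x y : ℝ≥0∞) := fun x =>
    Kernel.withDensity_apply _ hf.coe_nnreal_ennreal x
  have hκM : IsMarkovKernel κ := ⟨fun x => ⟨by
    rw [hκ, withDensity_apply _ MeasurableSet.univ, setLIntegral_univ, hf1]⟩⟩
  refine ⟨f, κ, fun x => (∫⁻ y, ENNReal.ofReal (klFun (f x y)) ∂m).toNNReal, hf,
    (hkl'.lintegral_prod_right').ennreal_toNNReal, hκM, hκ, hf1, fun x => ?_, fun x => ?_, ?_, ?_⟩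
  · rw [FiniteMoment, hκ, lintegral_withDensity_eq_lintegral_mul _ (hfx x).coe_nnreal_ennreal
      (by fun_prop)]
    by_cases hx : x ∈ A
    · rw [hfA x hx]; exact hx.2.1
    · rw [hfA' x hx]; simpa [FiniteMoment] using hm
  · rw [hκ, klDiv_withDensity (hfx x) (by rw [hf1]; simp), ENNReal.coe_toNNReal (hH x)]
  · have h1 : μ ⊗ₘ κ = (μ ⊗ₘ Kernel.const X m).withDensity fun p => (f p.1 p.2 : ℝ≥0∞) :=
      Measure.compProd_withDensity hf.coe_nnreal_ennreal
    rw [h1, Measure.compProd_const]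
    conv_lhs => rw [hν0]
    refine withDensity_congr_ae ?_
    have h2 : ∀ᵐ p ∂(μ.prod m), p.1 ∈ A := Measure.quasiMeasurePreserving_fst.ae hAae
    filter_upwards [h2] with p hp
    rw [hfA p.1 hp]
  · rw [hchain, hent]
    congr 1
    refine lintegral_congr_ae ?_
    filter_upwards [hAae] with x hx
    rw [hfA x hx, ENNReal.coe_toNNReal]
    exact hx.2.2.ne

/-- A coupling of the first marginals followed by couplings of the conditional laws. -/
lemma exists_coupling_compProd {X E : Type} [MeasurableSpace X] [MeasurableSpace E]
    {μ P : Measure X} [IsProbabilityMeasure μ] [IsProbabilityMeasure P] {m : Measure E}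
    [IsProbabilityMeasure m] {κ : Kernel X E} [IsMarkovKernel κ] {π' : Measure (X × X)}
    (hπ' : π' ∈ couplings μ P) {π : Kernel X (E × E)} (hπ : ∀ x, π x ∈ couplings (κ x) m)
    {c : X × X → ℝ≥0∞} (hc : Measurable c) {c' : E × E → ℝ≥0∞} (hc' : Measurable c') :
    ∃ Θ ∈ couplings (μ ⊗ₘ κ) (P.prod m),
      ∫⁻ z, (c (z.1.1, z.2.1) + c' (z.1.2, z.2.2)) ∂Θ
        = ∫⁻ z, c z ∂π' + ∫⁻ x, ∫⁻ z, c' z ∂(π x) ∂μ := by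
  have := isProbabilityMeasure_of_coupling hπ'
  have : IsMarkovKernel π := ⟨fun x => isProbabilityMeasure_of_coupling (hπ x)⟩
  have hT : ∀ {g : (X × X) × (E × E) → ℝ≥0∞}, Measurable g →
      ∫⁻ z, g z ∂(π' ⊗ₘ π.comap Prod.fst measurable_fst)
        = ∫⁻ x, ∫⁻ y, g (x, y) ∂(π x.1) ∂π' := fun hg => by
    rw [Measure.lintegral_compProd hg]; rfl
  refine ⟨(π' ⊗ₘ π.comap Prod.fst measurable_fst).map
    (fun z => ((z.1.1, z.2.1), (z.1.2, z.2.2))), ⟨?_, ?_⟩, ?_⟩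
  · refine Measure.ext_of_lintegral _ fun g hg => ?_
    rw [Measure.map_map (by fun_prop) (by fun_prop), lintegral_map hg (by fun_prop),
      hT (by exact hg.comp (by fun_prop)), Measure.lintegral_compProd hg, ← hπ'.1,
      lintegral_map (by exact hg.lintegral_kernel_prod_right') measurable_fst]
    refine lintegral_congr fun x => ?_
    rw [← (hπ x.1).1, lintegral_map (by fun_prop) measurable_fst]
    rfl
  · refine Measure.ext_of_lintegral _ fun g hg => ?_
    rw [Measure.map_map (by fun_prop) (by fun_prop), lintegral_map hg (by fun_prop),
      hT (by exact hg.comp (by fun_prop)), lintegral_prod _ hg.aemeasurable, ← hπ'.2,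
      lintegral_map (by exact hg.lintegral_prod_right') measurable_snd]
    refine lintegral_congr fun x => ?_
    rw [← (hπ x.1).2, lintegral_map (by fun_prop) measurable_snd]
    rfl
  · rw [lintegral_map (by fun_prop) (by fun_prop), hT (by fun_prop), ← hπ'.1,
      lintegral_map (by exact (hc'.comp measurable_snd).lintegral_kernel_prod_right')
      measurable_fst, ← lintegral_add_left (by fun_prop)]
    refine lintegral_congr fun x => ?_
    simp only
    rw [lintegral_add_left (by fun_prop)]
    simp

/-! ### Second moments of configurations -/

section Moments
variable {ι : Type} [Fintype ι] {d : ℕ}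

lemma configDist_sq (x y : Config ι d) : configDist x y ^ 2 = ∑ i, dist (x i) (y i) ^ 2 :=
  Real.sq_sqrt (Finset.sum_nonneg fun _ _ => by positivity)

@[fun_prop]
lemma Measurable.configDist {Ω : Type} [MeasurableSpace Ω] {f g : Ω → Config ι d}
    (hf : Measurable f) (hg : Measurable g) :
    Measurable fun ω => configDist (f ω) (g ω) := by
  unfold _root_.configDist
  fun_prop

lemma finiteMoment_configDist_iff {ν : Measure (Config ι d)} :
    FiniteMoment configDist 2 ν ↔ ∀ i, FiniteMoment dist 2 (ν.map fun x => x i) := by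
  simp only [FiniteMoment, configDist_sq]
  have h1 : ∀ x : Config ι d, ENNReal.ofReal (∑ i, dist (x i) ((0 : Config ι d) i) ^ 2)
      = ∑ i, ENNReal.ofReal (dist (x i) 0 ^ 2) := fun x =>
    ENNReal.ofReal_sum_of_nonneg fun i _ => by positivity
  simp_rw [h1]
  rw [lintegral_finsetSum _ (by fun_prop), ENNReal.sum_lt_top]
  simp only [Finset.mem_univ, true_implies]
  refine forall_congr' fun i => ?_
  rw [lintegral_map (by fun_prop) (by fun_prop)]

lemma integrable_norm_sq_coord {ν : Measure (Config ι d)} (h : FiniteMoment configDist 2 ν)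
    (i : ι) : Integrable (fun x : Config ι d => ‖x i‖ ^ 2) ν := by
  have := finiteMoment_two_iff.1 (finiteMoment_configDist_iff.1 h i)
  exact (integrable_map_measure (f := fun x : Config ι d => x i) (by fun_prop)
    (measurable_pi_apply i).aemeasurable).1 this

lemma QuadraticKernel.integrable_comp {Ω : Type} [MeasurableSpace Ω] {ν : Measure Ω}
    [IsFiniteMeasure ν] {K : Pt d → Pt d → ℝ} (hK : QuadraticKernel K) {X Y : Ω → Pt d}
    (hX : Measurable X) (hY : Measurable Y) (hX2 : Integrable (fun ω => ‖X ω‖ ^ 2) ν)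
    (hY2 : Integrable (fun ω => ‖Y ω‖ ^ 2) ν) : Integrable (fun ω => K (X ω) (Y ω)) ν := by
  obtain ⟨C, hC⟩ := hK.growth
  exact Integrable.mono' (g := fun ω => C * (1 + ‖X ω‖ ^ 2 + ‖Y ω‖ ^ 2))
    ((((integrable_const 1).add hX2).add hY2).const_mul C) (hK.measurable.comp (hX.prodMk hY)).aestronglyMeasurable
    (Filter.Eventually.of_forall fun ω => hC _ _)

/-- Every coupling of two laws with finite second moments has finite cost. -/
lemma lintegral_configDist_sq_lt_top {μ ν : Measure (Config ι d)} {π}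
    (hπ : π ∈ couplings μ ν) (hμ : FiniteMoment configDist 2 μ)
    (hν : FiniteMoment configDist 2 ν) :
    ∫⁻ z, ENNReal.ofReal (configDist z.1 z.2 ^ 2) ∂π < ∞ := by
  have hm : Measurable fun x : Config ι d => ENNReal.ofReal (configDist x 0 ^ 2) := by fun_prop
  have h1 : ∀ z : Config ι d × Config ι d, ENNReal.ofReal (configDist z.1 z.2 ^ 2)
      ≤ ENNReal.ofReal 2 * ENNReal.ofReal (configDist z.1 0 ^ 2)
        + ENNReal.ofReal 2 * ENNReal.ofReal (configDist z.2 0 ^ 2) := by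
    intro z
    rw [← ENNReal.ofReal_mul zero_le_two, ← ENNReal.ofReal_mul zero_le_two,
      ← ENNReal.ofReal_add (by positivity) (by positivity)]
    refine ENNReal.ofReal_le_ofReal ?_
    simp only [configDist_sq]
    rw [Finset.mul_sum, Finset.mul_sum, ← Finset.sum_add_distrib]
    refine Finset.sum_le_sum fun i _ => ?_
    have h1 := dist_triangle_right (z.1 i) (z.2 i) 0
    have h2 : dist (z.1 i) (z.2 i) ^ 2 ≤ (dist (z.1 i) 0 + dist (z.2 i) 0) ^ 2 := by gcongr
    have h3 := sq_nonneg (dist (z.1 i) 0 - dist (z.2 i) 0)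
    simp only [Pi.zero_apply]
    linarith
  refine (lintegral_mono h1).trans_lt ?_
  rw [lintegral_add_left (by fun_prop), lintegral_const_mul _ (by fun_prop),
    lintegral_const_mul _ (by fun_prop)]
  have e1 := lintegral_map (μ := π) hm measurable_fst
  have e2 := lintegral_map (μ := π) hm measurable_snd
  rw [hπ.1] at e1
  rw [hπ.2] at e2
  rw [← e1, ← e2]
  exact ENNReal.add_lt_top.2 ⟨ENNReal.mul_lt_top (by simp) hμ, ENNReal.mul_lt_top (by simp) hν⟩

instance (m : Measure (Pt d)) [IsProbabilityMeasure m] (N : ℕ) :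
    IsProbabilityMeasure (tensorPower m N) := by
  unfold tensorPower; infer_instance

lemma finiteMoment_tensorPower {m : Measure (Pt d)} [IsProbabilityMeasure m]
    (hm : FiniteMoment dist 2 m) (N : ℕ) : FiniteMoment configDist 2 (tensorPower m N) := by
  refine finiteMoment_configDist_iff.2 fun i => ?_
  have := (measurePreserving_eval (fun _ : Fin N => m) i).map_eq
  rw [tensorPower]
  exact this.symm ▸ hm

end Moments

/-! ### Adding one particle -/

/-- Splitting off the last particle. -/
def splitLast (n d : ℕ) : Config (Fin (n + 1)) d ≃ᵐ Config (Fin n) d × Pt d :=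
  (MeasurableEquiv.piFinSuccAbove (fun _ => Pt d) (Fin.last n)).trans MeasurableEquiv.prodComm

section splitLast
variable {n d : ℕ}

lemma splitLast_apply (x : Config (Fin (n + 1)) d) :
    splitLast n d x = (fun i => x i.castSucc, x (Fin.last n)) := by
  refine Prod.ext (funext fun i => ?_) rfl
  change x ((Fin.last n).succAbove i) = _
  rw [Fin.succAbove_last]

lemma map_splitLast_tensorPower (m : Measure (Pt d)) [IsProbabilityMeasure m] :
    (tensorPower m (n + 1)).map (splitLast n d) = (tensorPower m n).prod m := by
  have h := (measurePreserving_piFinSuccAbove (fun _ : Fin (n + 1) => m) (Fin.last n)).map_eq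
  have e : (splitLast n d : Config (Fin (n + 1)) d → Config (Fin n) d × Pt d)
      = Prod.swap ∘ MeasurableEquiv.piFinSuccAbove (fun _ => Pt d) (Fin.last n) := rfl
  rw [e, ← Measure.map_map measurable_swap (MeasurableEquiv.measurable _), tensorPower, h,
    Measure.prod_swap]
  rfl

lemma configDist_sq_splitLast (x y : Config (Fin (n + 1)) d) :
    configDist x y ^ 2 = configDist (splitLast n d x).1 (splitLast n d y).1 ^ 2
      + dist (splitLast n d x).2 (splitLast n d y).2 ^ 2 := by
  simp only [configDist_sq, splitLast_apply, Fin.sum_univ_castSucc]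

lemma sum_sum_splitLast {K : Pt d → Pt d → ℝ} (hs : ∀ x y, K x y = K y x)
    (x : Config (Fin (n + 1)) d) :
    ∑ i, ∑ j, K (x i) (x j)
      = (∑ i, ∑ j, K ((splitLast n d x).1 i) ((splitLast n d x).1 j))
        + 2 * (∑ i, K ((splitLast n d x).1 i) (splitLast n d x).2)
        + K (splitLast n d x).2 (splitLast n d x).2 := by
  simp only [splitLast_apply, Fin.sum_univ_castSucc, Finset.sum_add_distrib]
  simp_rw [hs (x (Fin.last n))]
  ring
end splitLast

/-- The mean of the energy `∑ i j, K (x i) (x j)`, divided by a weight which grows with the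
number of particles, increases by at most the energies of the conditional law and of the new
particle. -/
lemma PSDKernel.weighted_energy_step {d n : ℕ} {K : Pt d → Pt d → ℝ} (hK : PSDKernel K)
    {μ : Measure (Config (Fin n) d)} [IsProbabilityMeasure μ]
    {κ : Kernel (Config (Fin n) d) (Pt d)} [IsMarkovKernel κ]
    (hμ : ∀ i, Integrable (fun p : Config (Fin n) d × Pt d => ‖p.1 i‖ ^ 2) (μ ⊗ₘ κ))
    (hκ2 : Integrable (fun p : Config (Fin n) d × Pt d => ‖p.2‖ ^ 2) (μ ⊗ₘ κ))
    (hκ : ∀ x, FiniteMoment dist 2 (κ x))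
    (hR : Integrable (fun x => pairing K (κ x) (κ x)) μ) {a b : ℝ} (ha : 0 ≤ a) (hb : 0 < b)
    (ha0 : a = 0 → n = 0) :
    (a + b)⁻¹ * ∫ p, ((∑ i, ∑ j, K (p.1 i) (p.1 j)) + 2 * (∑ i, K (p.1 i) p.2) + K p.2 p.2)
        ∂(μ ⊗ₘ κ)
      ≤ a⁻¹ * (∫ x, ∑ i, ∑ j, K (x i) (x j) ∂μ) + b⁻¹ * (∫ x, pairing K (κ x) (κ x) ∂μ)
        + (a + b)⁻¹ * ∫ p, K p.2 p.2 ∂(μ ⊗ₘ κ) := by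
  have hfst : (μ ⊗ₘ κ).map Prod.fst = μ := Measure.fst_compProd μ κ
  have i1 : ∀ i j, Integrable (fun p : Config (Fin n) d × Pt d => K (p.1 i) (p.1 j)) (μ ⊗ₘ κ) :=
    fun i j => hK.integrable_comp (by fun_prop) (by fun_prop) (hμ i) (hμ j)
  have i2 : ∀ i, Integrable (fun p : Config (Fin n) d × Pt d => K (p.1 i) p.2) (μ ⊗ₘ κ) :=
    fun i => hK.integrable_comp (by fun_prop) (by fun_prop) (hμ i) hκ2
  have i3 : Integrable (fun p : Config (Fin n) d × Pt d => K p.2 p.2) (μ ⊗ₘ κ) :=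
    hK.integrable_comp (by fun_prop) (by fun_prop) hκ2 hκ2
  have j1 : Integrable (fun p : Config (Fin n) d × Pt d => ∑ i, ∑ j, K (p.1 i) (p.1 j))
      (μ ⊗ₘ κ) := integrable_finsetSum _ fun i _ => integrable_finsetSum _ fun j _ => i1 i j
  have j2 : Integrable (fun p : Config (Fin n) d × Pt d => ∑ i, K (p.1 i) p.2) (μ ⊗ₘ κ) :=
    integrable_finsetSum _ fun i _ => i2 i
  have mQ : Measurable fun x : Config (Fin n) d => ∑ i, ∑ j, K (x i) (x j) :=
    Finset.measurable_sum _ fun i _ => Finset.measurable_sum _ fun j _ =>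
      hK.measurable.comp (by fun_prop : Measurable fun x : Config (Fin n) d => (x i, x j))
  have jQ : Integrable (fun x : Config (Fin n) d => ∑ i, ∑ j, K (x i) (x j)) μ := by
    rw [← hfst]
    exact (integrable_map_measure mQ.aestronglyMeasurable measurable_fst.aemeasurable).2 j1
  have iB : ∀ i, Integrable (fun x : Config (Fin n) d => ∫ y, K (x i) y ∂(κ x)) μ := fun i =>
    Integrable.integral_compProd (κ := Kernel.const Unit μ) (η := Kernel.prodMkLeft Unit κ)
      (a := ()) (i2 i)
  have jB : Integrable (fun x : Config (Fin n) d => ∑ i, ∫ y, K (x i) y ∂(κ x)) μ :=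
    integrable_finsetSum _ fun i _ => iB i
  have e1 : ∫ p, ∑ i, ∑ j, K (p.1 i) (p.1 j) ∂(μ ⊗ₘ κ) = ∫ x, ∑ i, ∑ j, K (x i) (x j) ∂μ := by
    conv_rhs => rw [← hfst]
    rw [integral_map measurable_fst.aemeasurable mQ.aestronglyMeasurable]
  have e2 : ∫ p, ∑ i, K (p.1 i) p.2 ∂(μ ⊗ₘ κ) = ∫ x, ∑ i, ∫ y, K (x i) y ∂(κ x) ∂μ := by
    rw [integral_finsetSum _ fun i _ => i2 i, integral_finsetSum _ fun i _ =>
      iB i]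
    exact Finset.sum_congr rfl fun i _ => Measure.integral_compProd (i2 i)
  have e3 : ∫ p : Config (Fin n) d × Pt d, ((∑ i, ∑ j, K (p.1 i) (p.1 j))
      + 2 * (∑ i, K (p.1 i) p.2) + K p.2 p.2) ∂(μ ⊗ₘ κ)
      = (∫ x, ∑ i, ∑ j, K (x i) (x j) ∂μ) + 2 * (∫ x, ∑ i, ∫ y, K (x i) y ∂(κ x) ∂μ)
        + ∫ p, K p.2 p.2 ∂(μ ⊗ₘ κ) := by
    have h1 := integral_add (j1.add (j2.const_mul 2)) i3
    have h2 := integral_add j1 (j2.const_mul 2)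
    simp only [Pi.add_apply] at h1 h2
    rw [h1, h2, integral_const_mul, e1, e2]
  have key : ∫ x, (a + b)⁻¹ * ((∑ i, ∑ j, K (x i) (x j)) + 2 * (∑ i, ∫ y, K (x i) y ∂(κ x))
        + pairing K (κ x) (κ x)) ∂μ
      ≤ ∫ x, (a⁻¹ * (∑ i, ∑ j, K (x i) (x j)) + b⁻¹ * pairing K (κ x) (κ x)) ∂μ :=
    integral_mono (((jQ.add (jB.const_mul 2)).add hR).const_mul _)
      ((jQ.const_mul _).add (hR.const_mul _))
      fun x => hK.div_add_le x (κ x) (hκ x) ha hb ha0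
  rw [integral_const_mul, integral_add (jQ.const_mul _) (hR.const_mul _), integral_const_mul,
    integral_const_mul] at key
  have h1 := integral_add (jQ.add (jB.const_mul 2)) hR
  have h2 := integral_add jQ (jB.const_mul 2)
  simp only [Pi.add_apply] at h1 h2
  rw [h1, h2, integral_const_mul] at key
  have hR0 : 0 ≤ (a + b)⁻¹ * ∫ x, pairing K (κ x) (κ x) ∂μ :=
    mul_nonneg (by positivity) (integral_nonneg fun x => hK.pairing_self_nonneg _ (hκ x))
  rw [e3]
  nlinarith

/-- Transport-entropy inequality for laws of several particles, relative to the product measure.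
The hypothesis `hT` on one particle is applied to the conditional law of each
particle given the previous ones; the energies of the conditional laws pay for the growth of
the energy `∑ i j, K (x i) (x j)`, up to the diagonal terms. -/
lemma PSDKernel.exists_coupling_tensorPower {d : ℕ} {K : Pt d → Pt d → ℝ} (hK : PSDKernel K)
    {m : Measure (Pt d)} [IsProbabilityMeasure m] (hm : FiniteMoment dist 2 m) {l : NNReal}
    {b : ℝ} (hb : 0 < b)
    (hT : ∀ κ : Measure (Pt d), IsProbabilityMeasure κ → FiniteMoment dist 2 κ →
      ENNReal.ofReal (b⁻¹ / 2 * pairing K κ κ) + l * wassersteinPow dist 2 κ m ≤ klDiv κ m)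
    {a₀ : ℝ} (ha₀ : 0 ≤ a₀) (n : ℕ) (ν : Measure (Config (Fin n) d)) [IsProbabilityMeasure ν]
    (hν2 : FiniteMoment configDist 2 ν) (hν : klDiv ν (tensorPower m n) ≠ ∞) {η : ℝ}
    (hη : 0 < η) :
    ∃ π ∈ couplings ν (tensorPower m n),
      l * (∫⁻ z, ENNReal.ofReal (configDist z.1 z.2 ^ 2) ∂π).toReal
        + (a₀ + n * b)⁻¹ / 2 * ∫ x, ∑ i, ∑ j, K (x i) (x j) ∂ν
      ≤ (klDiv ν (tensorPower m n)).toReal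
        + 1 / 2 * ∑ i : Fin n, (a₀ + ((i : ℕ) + 1) * b)⁻¹ * ∫ x, K (x i) (x i) ∂ν + η := by
  induction n generalizing η with
  | zero =>
    refine ⟨ν.prod (tensorPower m 0), ⟨by simp, by simp⟩, ?_⟩
    have : ∀ z : Config (Fin 0) d × Config (Fin 0) d,
        ENNReal.ofReal (configDist z.1 z.2 ^ 2) = 0 := fun z => by simp [configDist]
    simp_rw [this]
    simp only [lintegral_zero, ENNReal.toReal_zero, mul_zero, Finset.univ_eq_empty,
      Finset.sum_empty, integral_zero, add_zero]
    positivity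
  | succ n ih =>
    set e := splitLast n d with he
    set P := tensorPower m n with hP
    have hνe : IsProbabilityMeasure (ν.map e) :=
      Measure.isProbabilityMeasure_map e.measurable.aemeasurable
    have hkl : klDiv (ν.map e) (P.prod m) = klDiv ν (tensorPower m (n + 1)) := by
      rw [hP, ← map_splitLast_tensorPower]
      exact klDiv_map_equiv e _ _
    have hcoord := integrable_norm_sq_coord hν2
    have hlast : ∫⁻ p, ENNReal.ofReal (dist p.2 0 ^ 2) ∂(ν.map e) < ∞ := by
      rw [lintegral_map (by fun_prop) e.measurable]
      have := finiteMoment_configDist_iff.1 hν2 (Fin.last n)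
      rw [FiniteMoment, lintegral_map (by fun_prop) (by fun_prop)] at this
      simpa only [he, splitLast_apply] using this
    obtain ⟨f, κ, H, hf, hHm, hκM, hκ, hf1, hκ2, hH, hdis, hent⟩ :=
      exists_density_kernel P m hm (ν.map e) (hkl ▸ hν) hlast
    set μ := (ν.map e).fst with hμ
    have hμν : μ = ν.map fun x i => x i.castSucc := by
      rw [hμ, Measure.fst, Measure.map_map measurable_fst e.measurable]
      congr 1
      ext1 x
      simp [he, splitLast_apply]
    rw [hkl] at hent
    have hμkl : klDiv μ P ≠ ∞ := fun h => by simp [hent, h] at hν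
    have hHfin : ∫⁻ x, H x ∂μ ≠ ∞ := fun h => by simp [hent, h] at hν
    have hμ2 : FiniteMoment configDist 2 μ := by
      refine finiteMoment_configDist_iff.2 fun i => ?_
      rw [hμν, Measure.map_map (by fun_prop) (by fun_prop)]
      exact finiteMoment_configDist_iff.1 hν2 i.castSucc
    have hμP : IsProbabilityMeasure μ := by rw [hμ]; infer_instance
    clear_value μ
    have hmR : Measurable fun x => pairing K (κ x) (κ x) := by
      have h1 : StronglyMeasurable fun q : Config (Fin n) d × Pt d => ∫ y', K q.2 y' ∂(κ q.1) :=
        StronglyMeasurable.integral_kernel_prod_right'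
          (κ := κ.comap Prod.fst measurable_fst)
          (f := fun q : (Config (Fin n) d × Pt d) × Pt d => K q.1.2 q.2)
          (hK.measurable.comp (by fun_prop :
            Measurable fun q : (Config (Fin n) d × Pt d) × Pt d => (q.1.2, q.2))).stronglyMeasurable
      exact h1.integral_kernel_prod_right'.measurable
    have hR0 : ∀ x, 0 ≤ pairing K (κ x) (κ x) := fun x => hK.pairing_self_nonneg _ (hκ2 x)
    have hTx : ∀ x, ENNReal.ofReal (b⁻¹ / 2 * pairing K (κ x) (κ x))
        + l * wassersteinPow dist 2 (κ x) m ≤ H x := fun x => hH x ▸ hT (κ x) inferInstance (hκ2 x)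
    have hRH : ∀ x, b⁻¹ / 2 * pairing K (κ x) (κ x) ≤ H x := fun x => by
      have h1 := le_self_add.trans (hTx x)
      exact (ENNReal.ofReal_le_iff_le_toReal ENNReal.coe_ne_top).1 h1
    have hHint : Integrable (fun x => (H x : ℝ)) μ := by
      refine ⟨hHm.coe_nnreal_real.aestronglyMeasurable, ?_⟩
      simpa [HasFiniteIntegral] using hHfin.lt_top
    have hRint : Integrable (fun x => pairing K (κ x) (κ x)) μ := by
      have h1 : Integrable (fun x => b⁻¹ / 2 * pairing K (κ x) (κ x)) μ := by
        refine hHint.mono' (hmR.const_mul _).aestronglyMeasurable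
          (Filter.Eventually.of_forall fun x => ?_)
        rw [Real.norm_of_nonneg (mul_nonneg (by positivity) (hR0 x))]
        exact hRH x
      exact (integrable_const_mul_iff (by positivity : b⁻¹ / 2 ≠ 0).isUnit _).1 h1
    -- the part of the entropy of the conditional law that remains for the transport cost
    let G : Config (Fin n) d → NNReal := fun x =>
      (H x - b⁻¹ / 2 * pairing K (κ x) (κ x)).toNNReal
    have hGm : Measurable G := (hHm.coe_nnreal_real.sub (hmR.const_mul _)).real_toNNReal
    have hGW : ∀ x, l * wassersteinPow dist 2 (κ x) m ≤ G x := fun x => by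
      have h1 := ENNReal.le_sub_of_add_le_left ENNReal.ofReal_ne_top (hTx x)
      have h2 : ((G x : NNReal) : ℝ≥0∞) = ENNReal.ofReal (H x - b⁻¹ / 2 * pairing K (κ x) (κ x)) :=
        rfl
      rw [h2, ENNReal.ofReal_sub _ (mul_nonneg (by positivity) (hR0 x))]
      simpa using h1
    have hGr : ∀ x, (G x : ℝ) = H x - b⁻¹ / 2 * pairing K (κ x) (κ x) := fun x =>
      Real.coe_toNNReal _ (sub_nonneg.2 (hRH x))
    have hGint : Integrable (fun x => (G x : ℝ)) μ := by
      simp_rw [hGr]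
      exact hHint.sub (hRint.const_mul _)
    set g := ∫ x, (G x : ℝ) ∂μ with hg
    have hg0 : 0 ≤ g := integral_nonneg fun x => NNReal.coe_nonneg _
    have hgeq : g = (∫ x, (H x : ℝ) ∂μ) - b⁻¹ / 2 * ∫ x, pairing K (κ x) (κ x) ∂μ := by
      rw [hg, ← integral_const_mul, ← integral_sub hHint (hRint.const_mul _)]
      exact integral_congr_ae (Filter.Eventually.of_forall hGr)
    -- `θ` is chosen such that `θ * (g + 1) = η / 2`
    have hθ : 0 < (η / 2 / (g + 1)).toNNReal := Real.toNNReal_pos.2 (by positivity)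
    set θ := (η / 2 / (g + 1)).toNNReal
    have hθr : (θ : ℝ) = η / 2 / (g + 1) := Real.coe_toNNReal _ (by positivity)
    simp_rw [hκ] at hGW
    have hκ2' := hκ2
    simp_rw [hκ] at hκ2'
    have : Nonempty (Config (Fin n) d) := ⟨0⟩
    obtain ⟨ρ, hρ⟩ := exists_kernel_coupling m hm hf hf1 hκ2' hGm hGW hθ
    simp_rw [← hκ] at hρ
    obtain ⟨π', hπ', hIH⟩ := ih μ hμ2 hμkl (half_pos hη)
    obtain ⟨Θ, hΘ, hΘc⟩ := exists_coupling_compProd hπ' (fun x => (hρ x).1)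
      (c := fun z => ENNReal.ofReal (configDist z.1 z.2 ^ 2)) (by fun_prop)
      (c' := fun z => ENNReal.ofReal (dist z.1 z.2 ^ 2)) (by fun_prop)
    rw [← hdis] at hΘ
    have hsymm : Measurable fun z : (Config (Fin n) d × Pt d) × (Config (Fin n) d × Pt d) =>
      (e.symm z.1, e.symm z.2) := by fun_prop
    have hπ : Θ.map (fun z => (e.symm z.1, e.symm z.2))
        ∈ couplings ν (tensorPower m (n + 1)) := by
      constructor
      · rw [Measure.map_map measurable_fst hsymm,
          ← MeasurableEquiv.map_symm_map (μ := ν) e, ← hΘ.1,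
          Measure.map_map e.symm.measurable measurable_fst]
        rfl
      · rw [Measure.map_map measurable_snd hsymm,
          ← MeasurableEquiv.map_symm_map (μ := tensorPower m (n + 1)) e, he,
          map_splitLast_tensorPower, ← hP, ← hΘ.2,
          Measure.map_map e.symm.measurable measurable_snd]
        rfl
    refine ⟨_, hπ, ?_⟩
    have hcost : ∫⁻ z, ENNReal.ofReal (configDist z.1 z.2 ^ 2)
        ∂(Θ.map fun z => (e.symm z.1, e.symm z.2))
        = ∫⁻ z, ENNReal.ofReal (configDist z.1 z.2 ^ 2) ∂π'
          + ∫⁻ x, ∫⁻ z, ENNReal.ofReal (dist z.1 z.2 ^ 2) ∂(ρ x) ∂μ := by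
      rw [← hΘc, lintegral_map (by fun_prop) hsymm]
      refine lintegral_congr fun z => ?_
      rw [configDist_sq_splitLast, ENNReal.ofReal_add (by positivity) (by positivity)]
      simp only [← he, MeasurableEquiv.apply_symm_apply]
    have hfin := lintegral_configDist_sq_lt_top hπ hν2 (finiteMoment_tensorPower hm _)
    rw [hcost] at hfin ⊢
    rw [ENNReal.toReal_add (ENNReal.add_lt_top.1 hfin).1.ne (ENNReal.add_lt_top.1 hfin).2.ne]
    have hB : (l : ℝ) * (∫⁻ x, ∫⁻ z, ENNReal.ofReal (dist z.1 z.2 ^ 2) ∂(ρ x) ∂μ).toReal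
        ≤ (1 + θ) * g + θ := by
      have h1 : (l : ℝ≥0∞) * ∫⁻ x, ∫⁻ z, ENNReal.ofReal (dist z.1 z.2 ^ 2) ∂(ρ x) ∂μ
          ≤ ENNReal.ofReal ((1 + θ) * g + θ) := by
        rw [← lintegral_const_mul' _ _ ENNReal.coe_ne_top]
        refine (lintegral_mono fun x => (hρ x).2).trans ?_
        rw [lintegral_add_right _ measurable_const, lintegral_const_mul' _ _ (by simp),
          ENNReal.ofReal_add (by positivity) (by positivity), ENNReal.ofReal_mul (by positivity),
          ENNReal.ofReal_add (by positivity) (by positivity), hg,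
          ofReal_integral_eq_lintegral_ofReal hGint
            (Filter.Eventually.of_forall fun x => NNReal.coe_nonneg _)]
        simp
      have h2 := ENNReal.toReal_mono ENNReal.ofReal_ne_top h1
      rwa [ENNReal.toReal_mul, ENNReal.coe_toReal, ENNReal.toReal_ofReal (by positivity)] at h2
    have hθg : θ * (g + 1) = η / 2 := by
      rw [hθr]; field_simp
    have hstep := hK.weighted_energy_step (μ := μ) (κ := κ) (a := a₀ + n * b) (b := b)
      (by
        intro i
        rw [← hdis]
        refine (integrable_map_equiv e _).2 ?_
        simpa only [Function.comp_def, he, splitLast_apply] using hcoord i.castSucc)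
      (by
        rw [← hdis]
        refine (integrable_map_equiv e _).2 ?_
        simpa only [Function.comp_def, he, splitLast_apply] using hcoord (Fin.last n))
      hκ2 hRint (by positivity) hb (by
        intro h0
        have h1 : (n : ℝ) * b = 0 := le_antisymm (by linarith) (by positivity)
        simpa [hb.ne'] using h1)
    rw [← hdis, integral_map_equiv, integral_map_equiv] at hstep
    simp only [he, ← sum_sum_splitLast hK.symm] at hstep
    simp only [splitLast_apply] at hstep
    have hdiag : ∀ i : Fin n, ∫ x, K (x i) (x i) ∂μ
        = ∫ x : Config (Fin (n + 1)) d, K (x i.castSucc) (x i.castSucc) ∂ν := by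
      intro i
      rw [hμν]
      exact integral_map (f := fun x : Config (Fin n) d => K (x i) (x i))
        (by fun_prop : Measurable fun (x : Config (Fin (n + 1)) d) (i : Fin n) =>
          x i.castSucc).aemeasurable
        (hK.measurable.comp
          (by fun_prop : Measurable fun x : Config (Fin n) d => (x i, x i))).aestronglyMeasurable
    simp_rw [hdiag] at hIH
    rw [Fin.sum_univ_castSucc]
    have hentr : (klDiv ν (tensorPower m (n + 1))).toReal
        = (klDiv μ P).toReal + ∫ x, (H x : ℝ) ∂μ := by
      rw [hent, ENNReal.toReal_add hμkl hHfin,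
        integral_eq_lintegral_of_nonneg_ae (Filter.Eventually.of_forall fun x => NNReal.coe_nonneg _)
          hHint.aestronglyMeasurable]
      simp
    rw [hentr]
    simp only [Fin.val_castSucc, Fin.val_last]
    have ecast : a₀ + ((n + 1 : ℕ) : ℝ) * b = a₀ + n * b + b := by push_cast; ring
    have ecast' : a₀ + ((n : ℝ) + 1) * b = a₀ + n * b + b := by ring
    rw [ecast, ecast']
    linarith

/-! ### The Gibbs measure relative to the product measure -/

lemma pi_tilted {X : Type} [MeasurableSpace X] (μ : Measure X) [SigmaFinite μ] (φ : X → ℝ)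
    (N : ℕ) :
    Measure.pi (fun _ : Fin N => μ.tilted φ)
      = (Measure.pi fun _ : Fin N => μ).tilted (fun x => ∑ i, φ (x i)) := by
  refine Measure.pi_eq fun s hs => ?_
  rw [tilted_apply_eq_ofReal_integral' _ (MeasurableSet.univ_pi hs)]
  simp_rw [fun i => tilted_apply_eq_ofReal_integral' (μ := μ) φ (hs i)]
  rw [← ENNReal.ofReal_prod_of_nonneg (fun i _ => integral_nonneg fun x =>
    div_nonneg (Real.exp_nonneg _) (integral_nonneg fun x => Real.exp_nonneg _))]
  rw [← integral_fintype_prod_eq_prod (fun _ x => Real.exp (φ x) / ∫ x, Real.exp (φ x) ∂μ),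
    Measure.restrict_pi_pi]
  simp_rw [Real.exp_sum, Finset.prod_div_distrib]
  rw [integral_fintype_prod_eq_prod (fun _ x => Real.exp (φ x))]

lemma tilted_add_const {X : Type} [MeasurableSpace X] {μ : Measure X} [NeZero μ] {f : X → ℝ}
    (hf : Integrable (fun x => Real.exp (f x)) μ) (c : ℝ) :
    μ.tilted (fun x => f x + c) = μ.tilted f := by
  have := isProbabilityMeasure_tilted hf
  have h := tilted_tilted hf (fun _ => c)
  rw [tilted_const] at h
  exact h.symm

/-- The Gibbs variational principle, with the partition function bounded by Jensen's inequality. -/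
lemma klDiv_le_of_tilted_neg {X : Type} [MeasurableSpace X] {P ν : Measure X}
    [IsProbabilityMeasure P] [IsProbabilityMeasure ν] {Φ : X → ℝ} (hΦP : Integrable Φ P)
    (hΦν : Integrable Φ ν) (hexp : Integrable (fun x => Real.exp (-Φ x)) P)
    (hkl : klDiv ν (P.tilted fun x => -Φ x) ≠ ∞) :
    klDiv ν P ≠ ∞ ∧ (klDiv ν P).toReal + ∫ x, Φ x ∂ν
      ≤ (klDiv ν (P.tilted fun x => -Φ x)).toReal + ∫ x, Φ x ∂P := by
  have hμ := isProbabilityMeasure_tilted hexp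
  have hP : (P.tilted fun x => -Φ x).tilted Φ = P := by
    have := tilted_neg_same hexp
    rwa [show -(fun x => -Φ x) = Φ by ext x; simp] at this
  have hZ := integral_exp_tilted (μ := P) (fun x => -Φ x) Φ
  have hint : Integrable (fun x => Real.exp (Φ x)) (P.tilted fun x => -Φ x) := by
    rw [integrable_tilted_iff hexp]
    simp [← Real.exp_add]
  obtain ⟨hac, hllr⟩ := klDiv_ne_top_iff.1 hkl
  have h1 := integral_llr_tilted_right hac hΦν hint hllr
  have h2 := integrable_llr_tilted_right hac hΦν hllr hint
  rw [hP] at h1 h2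
  have hacP : ν ≪ P := hac.trans (tilted_absolutelyContinuous _ _)
  refine ⟨klDiv_ne_top hacP h2, ?_⟩
  rw [toReal_klDiv_of_measure_eq hacP (by simp), toReal_klDiv_of_measure_eq hac (by simp), h1, hZ]
  have hJ : Real.exp (∫ x, -Φ x ∂P) ≤ ∫ x, Real.exp (-Φ x) ∂P :=
    convexOn_exp.map_integral_le (by fun_prop) isClosed_univ (by simp) hΦP.neg hexp
  have hJ' := Real.log_le_log (Real.exp_pos _) hJ
  rw [Real.log_exp, integral_neg] at hJ'
  simp only [Pi.add_apply, neg_add_cancel, Real.exp_zero, integral_const, probReal_univ,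
    smul_eq_mul, mul_one, one_div, Real.log_inv]
  linarith

lemma integrable_sum_sum_kernel {d N : ℕ} {K : Pt d → Pt d → ℝ} (hK : QuadraticKernel K)
    {ν : Measure (Config (Fin N) d)} [IsFiniteMeasure ν] (hν : FiniteMoment configDist 2 ν) :
    Integrable (fun x => ∑ i, ∑ j, K (x i) (x j)) ν :=
  integrable_finsetSum _ fun i _ => integrable_finsetSum _ fun j _ =>
    hK.integrable_comp (measurable_pi_apply i) (measurable_pi_apply j)
      (integrable_norm_sq_coord hν i) (integrable_norm_sq_coord hν j)

/-- Under the product measure only the diagonal terms of a centered energy survive. -/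
lemma integral_sum_sum_tensorPower {d N : ℕ} {K : Pt d → Pt d → ℝ} (hK : QuadraticKernel K)
    {m : Measure (Pt d)} [IsProbabilityMeasure m] (hm : FiniteMoment dist 2 m)
    (hK0 : ∀ x, ∫ y, K x y ∂m = 0) :
    ∫ x, ∑ i, ∑ j, K (x i) (x j) ∂(tensorPower m N) = N * ∫ x, K x x ∂m := by
  have hP := finiteMoment_tensorPower hm N
  have hint := fun i j : Fin N => hK.integrable_comp (measurable_pi_apply i)
    (measurable_pi_apply j) (integrable_norm_sq_coord hP i) (integrable_norm_sq_coord hP j)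
  have hmap : ∀ i, (tensorPower m N).map (fun x => x i) = m := fun i =>
    (measurePreserving_eval (fun _ : Fin N => m) i).map_eq
  have hval : ∀ i j : Fin N, ∫ x, K (x i) (x j) ∂(tensorPower m N)
      = if i = j then ∫ x, K x x ∂m else 0 := by
    intro i j
    split_ifs with hij
    · subst hij
      have h := integral_map (μ := tensorPower m N) (φ := fun x => x i) (f := fun x => K x x)
        (measurable_pi_apply i).aemeasurable
        (hK.measurable.comp (measurable_id.prodMk measurable_id)).aestronglyMeasurable
      rw [hmap] at h
      exact h.symm
    · have hind : iIndepFun (fun i (x : Config (Fin N) d) => x i) (tensorPower m N) :=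
        iIndepFun_pi (X := fun _ x => x) fun _ => aemeasurable_id
      have hlaw := (indepFun_iff_map_prod_eq_prod_map_map (measurable_pi_apply i).aemeasurable
        (measurable_pi_apply j).aemeasurable).1 (hind.indepFun hij)
      rw [hmap, hmap] at hlaw
      have h := integral_map (μ := tensorPower m N) (φ := fun x => (x i, x j))
        (f := fun z => K z.1 z.2)
        ((measurable_pi_apply i).prodMk (measurable_pi_apply j)).aemeasurable
        hK.measurable.aestronglyMeasurable
      rw [hlaw] at h
      rw [← h, integral_prod _ (hK.integrable_prod hm hm)]
      simp [hK0]
  rw [integral_finsetSum _ fun i _ => integrable_finsetSum _ fun j _ => hint i j]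
  simp_rw [integral_finsetSum _ fun j _ => hint _ j, hval]
  simp

section Gibbs
variable {d N : ℕ} {V : Pt d → ℝ} {W : Pt d → Pt d → ℝ} {m : Measure (Pt d)}
  [IsProbabilityMeasure m]

/-- The interaction energy `(1 / 2N) ∑_{i,j} K(x^i, x^j)`. -/
def meanFieldEnergy {d : ℕ} (K : Pt d → Pt d → ℝ) (N : ℕ) (x : Config (Fin N) d) : ℝ :=
  1 / (2 * (N : ℝ)) * ∑ i, ∑ j, K (x i) (x j)

omit [IsProbabilityMeasure m] in
lemma meanFieldEnergy_centered (hN : 1 ≤ N) (x : Config (Fin N) d) :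
    -particleEnergy V W N x = (∑ i, (-V (x i) - ∫ y, W (x i) y ∂m))
      + -meanFieldEnergy (centered W m) N x + N / 2 * pairing W m m := by
  have hN0 : (N : ℝ) ≠ 0 := by positivity
  unfold particleEnergy meanFieldEnergy centered
  simp only [Finset.sum_add_distrib, Finset.sum_sub_distrib, Finset.sum_const, Finset.card_univ,
    Fintype.card_fin, nsmul_eq_mul, Finset.sum_neg_distrib, ← Finset.mul_sum]
  field_simp
  ring

/-- By the fixed point equation, the Gibbs measure is the product measure `m^{⊗N}` tilted by the
energy of the centered kernel. -/
lemma gibbsMeasure_eq_tilted (hN : 1 ≤ N) (hm_fix : m = meanFieldMap V W m)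
    (hG : Integrable (fun x : Config (Fin N) d => Real.exp (-particleEnergy V W N x)) volume) :
    Integrable (fun x => Real.exp (-meanFieldEnergy (centered W m) N x)) (tensorPower m N) ∧
    gibbsMeasure V W N
      = (tensorPower m N).tilted (fun x => -meanFieldEnergy (centered W m) N x) := by
  set φ : Pt d → ℝ := fun x => -V x - ∫ y, W x y ∂m
  have hmφ : m = (volume : Measure (Pt d)).tilted φ := hm_fix
  have hφ : Integrable (fun x => Real.exp (φ x)) (volume : Measure (Pt d)) := by
    by_contra h
    rw [tilted_of_not_integrable h] at hmφ
    exact IsProbabilityMeasure.ne_zero m hmφ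
  have hP : tensorPower m N
      = (volume : Measure (Config (Fin N) d)).tilted (fun x => ∑ i, φ (x i)) := by
    rw [volume_pi, ← pi_tilted volume φ N, ← hmφ, tensorPower]
  have hψ : Integrable (fun x : Config (Fin N) d => Real.exp (∑ i, φ (x i))) volume := by
    simp_rw [Real.exp_sum]
    exact Integrable.fintype_prod (f := fun _ x => Real.exp (φ x)) fun _ => hφ
  have hE : ∀ x, -particleEnergy V W N x = ((∑ i, φ (x i))
      + -meanFieldEnergy (centered W m) N x) + N / 2 * pairing W m m :=
    meanFieldEnergy_centered hN
  have hsum : Integrable (fun x : Config (Fin N) d => Real.exp ((∑ i, φ (x i))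
      + -meanFieldEnergy (centered W m) N x)) volume := by
    refine (hG.const_mul (Real.exp (-(N / 2 * pairing W m m)))).congr
      (Filter.Eventually.of_forall fun x => ?_)
    simp only
    rw [← Real.exp_add, hE]
    congr 1
    ring
  constructor
  · rw [hP, integrable_tilted_iff hψ]
    simpa only [smul_eq_mul, ← Real.exp_add] using hsum
  · have : NeZero (volume : Measure (Config (Fin N) d)) := by
      refine ⟨fun h => ?_⟩
      rw [h, tilted_zero_measure] at hP
      exact IsProbabilityMeasure.ne_zero _ hP
    rw [gibbsMeasure, hP, tilted_tilted hψ]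
    simp_rw [hE]
    exact tilted_add_const hsum _

end Gibbs

/-! ### The sum of the weights -/

/-- `∑_{i=1}^N (1 + ε) / (N ε + i)`, the sum of the weights of the diagonal terms. The particles
are indexed by `Fin N`, from `0`. -/
def weightSum (N : ℕ) (ε : ℝ) : ℝ := ∑ i : Fin N, (1 + ε) / (N * ε + ((i : ℕ) + 1))

lemma sum_inv_le_log {a : ℝ} (ha : 0 < a) (n : ℕ) :
    ∑ i ∈ Finset.range n, (1 : ℝ) / (a + (i + 1)) ≤ Real.log (a + n) - Real.log a := by
  induction n with
  | zero => simp
  | succ n ih =>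
    rw [Finset.sum_range_succ]
    have h0 : 0 < a + n := by positivity
    have h1 : 0 < a + (n + 1) := by positivity
    have h2 := Real.one_sub_inv_le_log_of_pos (div_pos h1 h0)
    rw [Real.log_div h1.ne' h0.ne'] at h2
    have h3 : (1 : ℝ) / (a + (n + 1)) = 1 - ((a + (n + 1)) / (a + n))⁻¹ := by
      field_simp
      ring
    push_cast
    linarith

lemma two_mul_weightSum_zero_le {N : ℕ} : 2 * weightSum N 0 ≤ 2 * (Real.log N + 3) := by
  have h := harmonic_le_one_add_log N
  have h2 : weightSum N 0 = (harmonic N : ℝ) := by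
    unfold weightSum harmonic
    rw [Fin.sum_univ_eq_sum_range (fun i => (1 + (0 : ℝ)) / (N * 0 + ((i : ℕ) + 1)))]
    push_cast
    simp
  linarith

/-- The sum is at most `(1 + ε) log (1 + 1 / ε)`, and `1 / ε = 2 s²` for `s = 1 / √(2 ε)`. -/
lemma two_mul_weightSum_le {N : ℕ} (hN : 1 ≤ N) {ε : ℝ} (hε : 0 < ε) (hε' : ε ≤ 1 / 2) :
    2 * weightSum N ε ≤ 3 * (1 / Real.sqrt (2 * ε) + 3) := by
  have hN0 : (0 : ℝ) < N := by exact_mod_cast hN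
  have h1 : weightSum N ε = (1 + ε) * ∑ i ∈ Finset.range N, (1 : ℝ) / (N * ε + (i + 1)) := by
    unfold weightSum
    rw [Fin.sum_univ_eq_sum_range (fun i => (1 + ε) / (N * ε + ((i : ℕ) + 1))), Finset.mul_sum]
    exact Finset.sum_congr rfl fun i _ => by ring
  have h2 := sum_inv_le_log (a := N * ε) (by positivity) N
  set s : ℝ := 1 / Real.sqrt (2 * ε) with hs
  have hs0 : 0 ≤ s := by positivity
  have hs2 : 1 + 1 / ε = 1 + 2 * s ^ 2 := by
    rw [hs, div_pow, Real.sq_sqrt (by positivity)]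
    field_simp
  have h3 : Real.log (N * ε + N) - Real.log (N * ε) = Real.log (1 + 2 * s ^ 2) := by
    rw [← Real.log_div (by positivity) (by positivity), ← hs2]
    congr 1
    field_simp
  have h4 : Real.log (1 + 2 * s ^ 2) ≤ s + 3 := by
    rw [Real.log_le_iff_le_exp (by positivity), Real.exp_add]
    have h5 := Real.quadratic_le_exp_of_nonneg hs0
    have h6 := Real.add_one_le_exp (3 : ℝ)
    nlinarith [Real.exp_pos s]
  rw [h3] at h2
  rw [h1]
  have h7 : (1 + ε) * ∑ i ∈ Finset.range N, (1 : ℝ) / (N * ε + (i + 1)) ≤ (3 / 2) * (s + 3) := by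
    refine mul_le_mul (by linarith) (h2.trans h4) (Finset.sum_nonneg fun i _ => ?_) (by norm_num)
    positivity
  linarith

/-! ### From the energy estimate to the defective `T2` inequality -/

section Core
variable {d N : ℕ} {K : Pt d → Pt d → ℝ} {m : Measure (Pt d)} [IsProbabilityMeasure m]

/-- The estimate `PSDKernel.exists_coupling_tensorPower` with the particles taken in another
order: both the product measure and the total energy are invariant under permutations. -/
lemma PSDKernel.exists_coupling_tensorPower_perm (hK : PSDKernel K)
    (hm : FiniteMoment dist 2 m) {l : NNReal} {b : ℝ} (hb : 0 < b)
    (hT : ∀ κ : Measure (Pt d), IsProbabilityMeasure κ → FiniteMoment dist 2 κ →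
      ENNReal.ofReal (b⁻¹ / 2 * pairing K κ κ) + l * wassersteinPow dist 2 κ m ≤ klDiv κ m)
    {a₀ : ℝ} (ha₀ : 0 ≤ a₀) (σ : Equiv.Perm (Fin N)) (ν : Measure (Config (Fin N) d))
    [IsProbabilityMeasure ν] (hν2 : FiniteMoment configDist 2 ν)
    (hν : klDiv ν (tensorPower m N) ≠ ∞) {η : ℝ} (hη : 0 < η) :
    ∃ π ∈ couplings ν (tensorPower m N),
      l * (∫⁻ z, ENNReal.ofReal (configDist z.1 z.2 ^ 2) ∂π).toReal
        + (a₀ + N * b)⁻¹ / 2 * ∫ x, ∑ i, ∑ j, K (x i) (x j) ∂ν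
      ≤ (klDiv ν (tensorPower m N)).toReal
        + 1 / 2 * ∑ i : Fin N, (a₀ + ((i : ℕ) + 1) * b)⁻¹ * ∫ x, K (x (σ i)) (x (σ i)) ∂ν
        + η := by
  set e := MeasurableEquiv.piCongrLeft (fun _ : Fin N => Pt d) σ.symm with he
  have hea : ∀ (x : Config (Fin N) d) i, e x i = x (σ i) := by
    intro x i
    have := MeasurableEquiv.piCongrLeft_apply_apply σ.symm (β := fun _ : Fin N => Pt d) x (σ i)
    rwa [Equiv.symm_apply_apply] at this
  have heP : (tensorPower m N).map e = tensorPower m N :=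
    Measure.pi_map_piCongrLeft σ.symm (fun _ : Fin N => m)
  have hprob : IsProbabilityMeasure (ν.map e) :=
    Measure.isProbabilityMeasure_map e.measurable.aemeasurable
  have hkl : klDiv (ν.map e) (tensorPower m N) = klDiv ν (tensorPower m N) := by
    conv_lhs => rw [← heP]
    exact klDiv_map_equiv e _ _
  have h2 : FiniteMoment configDist 2 (ν.map e) := by
    rw [finiteMoment_configDist_iff] at hν2 ⊢
    intro i
    rw [Measure.map_map (measurable_pi_apply i) e.measurable]
    have : (fun x : Config (Fin N) d => x i) ∘ e = fun x => x (σ i) := by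
      ext1 x
      exact hea x i
    rw [this]
    exact hν2 (σ i)
  obtain ⟨π, hπ, h⟩ := hK.exists_coupling_tensorPower hm hb hT ha₀ N (ν.map e) h2
    (by rwa [hkl]) hη
  have hes : Measurable (Prod.map e.symm e.symm :
      Config (Fin N) d × Config (Fin N) d → Config (Fin N) d × Config (Fin N) d) :=
    e.symm.measurable.prodMap e.symm.measurable
  refine ⟨π.map (Prod.map e.symm e.symm), ⟨?_, ?_⟩, ?_⟩
  · rw [Measure.map_map measurable_fst hes]
    change π.map (e.symm ∘ Prod.fst) = ν
    rw [← Measure.map_map e.symm.measurable measurable_fst, hπ.1,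
      Measure.map_map e.symm.measurable e.measurable]
    simp
  · rw [Measure.map_map measurable_snd hes]
    change π.map (e.symm ∘ Prod.snd) = _
    rw [← Measure.map_map e.symm.measurable measurable_snd, hπ.2]
    conv_lhs => rw [← heP]
    rw [Measure.map_map e.symm.measurable e.measurable]
    simp
  · have hcost : ∀ z : Config (Fin N) d × Config (Fin N) d,
        configDist (e.symm z.1) (e.symm z.2) ^ 2 = configDist z.1 z.2 ^ 2 := by
      intro z
      have h1 : ∀ i, dist (z.1 i) (z.2 i) = dist (e.symm z.1 (σ i)) (e.symm z.2 (σ i)) := by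
        intro i
        rw [← hea (e.symm z.1) i, ← hea (e.symm z.2) i, e.apply_symm_apply, e.apply_symm_apply]
      simp_rw [configDist_sq, h1]
      exact (Equiv.sum_comp σ fun i => dist (e.symm z.1 i) (e.symm z.2 i) ^ 2).symm
    rw [lintegral_map (by fun_prop) hes]
    simp only [Prod.map_fst, Prod.map_snd, hcost]
    rw [hkl, integral_map_equiv] at h
    simp_rw [integral_map_equiv, hea] at h
    have hsum : ∀ x : Config (Fin N) d, ∑ i, ∑ j, K (x (σ i)) (x (σ j))
        = ∑ i, ∑ j, K (x i) (x j) := by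
      intro x
      rw [Equiv.sum_comp σ fun i => ∑ j, K (x i) (x (σ j))]
      exact Finset.sum_congr rfl fun i _ => Equiv.sum_comp σ fun j => K (x i) (x j)
    simpa only [hsum] using h

/-- The diagonal energy of `ν` is controlled by the transport cost to the product measure. -/
lemma sum_diag_le (hK : QuadraticKernel K) (hm : FiniteMoment dist 2 m) {L : ℝ}
    (hL0 : 0 ≤ L) (hL : ∀ x, K x x ≤ L * ∫ z, ‖x - z‖ ^ 2 ∂m) {ν : Measure (Config (Fin N) d)}
    [IsProbabilityMeasure ν] (hν : FiniteMoment configDist 2 ν) :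
    ∑ i, ∫ x, K (x i) (x i) ∂ν
      ≤ L * (2 * (wassersteinPow configDist 2 ν (tensorPower m N)).toReal
        + 4 * N * totalVar m) := by
  set g : Pt d → ℝ := fun x => ∫ z, ‖x - z‖ ^ 2 ∂m with hg
  have hD := quadraticKernel_dist_sq (d := d)
  have hgm : Measurable g := measurable_integral_section hD m
  have hgtri : ∀ x y, g x ≤ 2 * ‖x - y‖ ^ 2 + 2 * g y := by
    intro x y
    have h1 := hD.integrable_section hm x
    have h2 := (integrable_const (μ := m) (2 * ‖x - y‖ ^ 2)).add
      ((hD.integrable_section hm y).const_mul 2)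
    refine (integral_mono h1 h2 fun z => ?_).trans_eq ?_
    · simp only [Pi.add_apply]
      have := norm_sub_le_norm_sub_add_norm_sub x y z
      have h3 := norm_nonneg (x - z)
      nlinarith [sq_nonneg (‖x - y‖ - ‖y - z‖)]
    · have h3 := integral_add (integrable_const (μ := m) (2 * ‖x - y‖ ^ 2))
        ((hD.integrable_section hm y).const_mul 2)
      simp only [Pi.add_apply]
      rw [h3]
      simp [hg, integral_const_mul]
  have hP := finiteMoment_tensorPower hm N
  have hgi : ∀ {μ : Measure (Config (Fin N) d)}, IsProbabilityMeasure μ →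
      FiniteMoment configDist 2 μ → ∀ i, Integrable (fun x => g (x i)) μ := by
    intro μ _ hμ i
    have := hD.integrable_integral (finiteMoment_configDist_iff.1 hμ i) hm
    exact (integrable_map_measure hgm.aestronglyMeasurable
      (measurable_pi_apply i).aemeasurable).1 this
  have hgP : ∀ i, ∫ x : Config (Fin N) d, g (x i) ∂(tensorPower m N) = 2 * totalVar m := by
    intro i
    have h := integral_map (μ := tensorPower m N) (φ := fun x => x i) (f := g)
      (measurable_pi_apply i).aemeasurable hgm.aestronglyMeasurable
    have hmap : (tensorPower m N).map (fun x => x i) = m :=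
      (measurePreserving_eval (fun _ : Fin N => m) i).map_eq
    rw [hmap] at h
    rw [← h, ← integral_integral_dist_sq hm]
  have hdiag := fun i : Fin N => hK.integrable_comp (measurable_pi_apply i)
    (measurable_pi_apply i) (integrable_norm_sq_coord hν i) (integrable_norm_sq_coord hν i)
  have key : ∀ π ∈ couplings ν (tensorPower m N), ∑ i, ∫ x, K (x i) (x i) ∂ν
      ≤ L * (2 * (∫⁻ z, ENNReal.ofReal (configDist z.1 z.2 ^ 2) ∂π).toReal
        + 4 * N * totalVar m) := by
    intro π hπ
    have hπP := isProbabilityMeasure_of_coupling hπ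
    have hcost := lintegral_configDist_sq_lt_top hπ hν hP
    have hci : Integrable (fun z => configDist z.1 z.2 ^ 2) π :=
      (lintegral_ofReal_ne_top_iff_integrable (by fun_prop)
        (Filter.Eventually.of_forall fun z => by positivity)).1 hcost.ne
    rw [← integral_eq_lintegral_of_nonneg_ae
      (Filter.Eventually.of_forall fun z => by positivity) hci.aestronglyMeasurable]
    have h1 : ∀ i, Integrable (fun z : Config (Fin N) d × Config (Fin N) d =>
        K (z.1 i) (z.1 i)) π := fun i => by
      have := hdiag i
      rw [← hπ.1] at this
      exact this.comp_measurable measurable_fst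
    have h2 : ∀ i, Integrable (fun z : Config (Fin N) d × Config (Fin N) d => g (z.2 i)) π :=
      fun i => by
      have := hgi inferInstance hP i
      rw [← hπ.2] at this
      exact this.comp_measurable measurable_snd
    have e1 : ∀ i, ∫ x, K (x i) (x i) ∂ν = ∫ z, K (z.1 i) (z.1 i) ∂π := fun i => by
      have h3 := (hdiag i).aestronglyMeasurable
      rw [← hπ.1] at h3
      conv_lhs => rw [← hπ.1]
      exact integral_map measurable_fst.aemeasurable h3
    have e2 : ∀ i, ∫ z, g (z.2 i) ∂π = 2 * totalVar m := fun i => by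
      rw [← hgP i]
      conv_rhs => rw [← hπ.2]
      exact (integral_map (f := fun x : Config (Fin N) d => g (x i)) measurable_snd.aemeasurable
        (hgm.comp (measurable_pi_apply i)).aestronglyMeasurable).symm
    simp_rw [e1]
    rw [← integral_finsetSum _ fun i _ => h1 i]
    have h3 : Integrable (fun z : Config (Fin N) d × Config (Fin N) d =>
        2 * configDist z.1 z.2 ^ 2) π := hci.const_mul 2
    have h4 : Integrable (fun z : Config (Fin N) d × Config (Fin N) d =>
        ∑ i, 2 * g (z.2 i)) π := integrable_finsetSum _ fun i _ => (h2 i).const_mul 2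
    refine (integral_mono (integrable_finsetSum _ fun i _ => h1 i)
      ((h3.add h4).const_mul L) fun z => ?_).trans_eq ?_
    · simp only [Pi.add_apply]
      rw [configDist_sq, Finset.mul_sum, ← Finset.sum_add_distrib, Finset.mul_sum]
      refine Finset.sum_le_sum fun i _ => (hL _).trans (mul_le_mul_of_nonneg_left ?_ hL0)
      rw [dist_eq_norm]
      exact hgtri _ _
    · have h5 := integral_add h3 h4
      simp only [Pi.add_apply]
      rw [integral_const_mul, h5, integral_const_mul,
        integral_finsetSum _ fun i _ => (h2 i).const_mul 2]
      simp_rw [integral_const_mul, e2]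
      simp only [Finset.sum_const, Finset.card_univ, Fintype.card_fin, nsmul_eq_mul]
      ring
  have hW : wassersteinPow configDist 2 ν (tensorPower m N) ≠ ∞ := by
    refine ne_top_of_le_ne_top (lintegral_configDist_sq_lt_top
      (π := ν.prod (tensorPower m N)) ⟨by simp, by simp⟩ hν hP).ne ?_
    exact iInf₂_le (ν.prod (tensorPower m N)) ⟨by simp, by simp⟩
  refine le_of_forall_pos_le_add fun η hη => ?_
  obtain ⟨π, hπ, hπc⟩ := exists_coupling_le (μ := ν) (ν := tensorPower m N) configDist 2
    (η := (η / (2 * L + 1)).toNNReal) (l := 1)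
    (G := (wassersteinPow configDist 2 ν (tensorPower m N)).toNNReal)
    (by simp only [ne_eq, Real.toNNReal_eq_zero, not_le, pos_iff_ne_zero]; positivity)
    (by simp [hW])
  refine (key π hπ).trans ?_
  have h6 : (∫⁻ z, ENNReal.ofReal (configDist z.1 z.2 ^ 2) ∂π).toReal
      ≤ (wassersteinPow configDist 2 ν (tensorPower m N)).toReal + η / (2 * L + 1) := by
    have := ENNReal.toReal_mono (by simp) hπc
    rw [ENNReal.toReal_add (by simp) (by simp)] at this
    simpa only [ENNReal.coe_one, one_mul, ENNReal.coe_toReal, ENNReal.coe_toNNReal_eq_toReal,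
      Real.coe_toNNReal _ (by positivity : 0 ≤ η / (2 * L + 1))] using this
  have h7 : L * (2 * (η / (2 * L + 1))) ≤ η := by
    rw [← mul_div_assoc, ← mul_div_assoc, div_le_iff₀ (by positivity)]
    nlinarith
  have h8 := mul_le_mul_of_nonneg_left h6 (by positivity : 0 ≤ 2 * L)
  linarith

end Core

lemma totalVar_nonneg {d : ℕ} (m : Measure (Pt d)) : 0 ≤ totalVar m :=
  Finset.sum_nonneg fun _ _ => variance_nonneg _ _

/-- The non-linear `T2` inequality in terms of the centered kernel. -/
lemma NonlinearT2.ofReal_pairing_add_le {d : ℕ} {Wm : Pt d → Pt d → ℝ} {m : Measure (Pt d)}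
    [IsProbabilityMeasure m] {ε lam : ℝ} (hε : 0 ≤ ε) (hlam : 0 ≤ lam)
    (hT : NonlinearT2 Wm m ε lam) (hpos : PositiveType Wm)
    (hmeas : Measurable fun z : Pt d × Pt d => Wm z.1 z.2) (hm : FiniteMoment dist 2 m)
    {κ : Measure (Pt d)} [IsProbabilityMeasure κ] (hκ : FiniteMoment dist 2 κ) :
    ENNReal.ofReal ((1 + ε) / 2 * pairing (centered Wm m) κ κ)
      + (lam / 2).toNNReal * wassersteinPow dist 2 κ m ≤ klDiv κ m := by
  have h := hT κ ⟨inferInstance, hκ⟩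
  have hK := hpos.psdKernel_centered hmeas hm
  rw [kernelForm_eq_pairing_centered ⟨hmeas, hpos.growth⟩ hpos.symm hm hκ] at h
  have hr : 0 ≤ (1 + ε) / 2 * pairing (centered Wm m) κ κ :=
    mul_nonneg (by positivity) (hK.pairing_self_nonneg κ hκ)
  have h2 := add_le_add_right h (((1 + ε) / 2 * pairing (centered Wm m) κ κ : ℝ) : EReal)
  rw [← add_assoc, ← EReal.coe_add, neg_mul, add_neg_cancel, EReal.coe_zero, zero_add] at h2
  rw [← EReal.coe_ennreal_le_coe_ennreal_iff, EReal.coe_ennreal_add, EReal.coe_ennreal_mul,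
    EReal.coe_ennreal_ofReal, max_eq_left hr]
  convert h2 using 3
  change ((ENNReal.ofReal (lam / 2) : ℝ≥0∞) : EReal) = _
  rw [EReal.coe_ennreal_ofReal, max_eq_left (by positivity)]

lemma centered_sub {d : ℕ} {W Wp Wm : Pt d → Pt d → ℝ} {m : Measure (Pt d)}
    [IsProbabilityMeasure m] (hW : ∀ x y, W x y = Wp x y - Wm x y) (hp : QuadraticKernel Wp)
    (hn : QuadraticKernel Wm) (hm : FiniteMoment dist 2 m) (x y : Pt d) :
    centered W m x y = centered Wp m x y - centered Wm m x y := by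
  have h1 : ∀ x, ∫ z, W x z ∂m = (∫ z, Wp x z ∂m) - ∫ z, Wm x z ∂m := fun x => by
    simp_rw [hW]
    exact integral_sub (hp.integrable_section hm x) (hn.integrable_section hm x)
  have h2 : pairing W m m = pairing Wp m m - pairing Wm m m := by
    unfold pairing
    simp_rw [h1]
    exact integral_sub (hp.integrable_integral hm hm) (hn.integrable_integral hm hm)
  unfold centered
  rw [h1, h1, h2, hW]
  ring

/-- The defective `T2` inequality, with `B` any upper bound of twice the sum of the weights. -/
theorem defectiveT2_gibbsMeasure {d N : ℕ} (hN : 1 ≤ N) {V : Pt d → ℝ}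
    {W Wp Wm : Pt d → Pt d → ℝ} (hW : ∀ x y, W x y = Wp x y - Wm x y)
    (hWp : ContDiff ℝ 2 (fun z : Pt d × Pt d => Wp z.1 z.2))
    (hWm : ContDiff ℝ 2 (fun z : Pt d × Pt d => Wm z.1 z.2))
    (hWp_pos : PositiveType Wp) (hWm_pos : PositiveType Wm) {Lp Lm : ℝ}
    (hLp : ∀ x y, ‖mixedHessian Wp x y‖ ≤ Lp) (hLm : ∀ x y, ‖mixedHessian Wm x y‖ ≤ Lm)
    (hGibbs : Integrable (fun x : Config (Fin N) d => Real.exp (-particleEnergy V W N x)) volume)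
    {m : Measure (Pt d)} [IsProbabilityMeasure m] (hm : FiniteMoment dist 2 m)
    (hm_fix : m = meanFieldMap V W m) {ε lam B : ℝ} (hε : 0 ≤ ε) (hlam : 0 ≤ lam)
    (hT : NonlinearT2 Wm m ε lam) (hB : 2 * weightSum N ε ≤ B) :
    DefectiveT2 m (gibbsMeasure V W N) (lam - B * Lm / N) ((B * Lm + Lp) * totalVar m) := by
  rintro ν ⟨hνP, hν2⟩
  by_cases hkl : klDiv ν (gibbsMeasure V W N) = ∞
  · rw [hkl, EReal.coe_ennreal_top, EReal.top_add_coe]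
    exact le_top
  have hN0 : (0 : ℝ) < N := by exact_mod_cast hN
  have hqp : QuadraticKernel Wp := ⟨hWp.continuous.measurable, hWp_pos.growth⟩
  have hqm : QuadraticKernel Wm := ⟨hWm.continuous.measurable, hWm_pos.growth⟩
  have hKp := hWp_pos.psdKernel_centered hqp.measurable hm
  have hKm := hWm_pos.psdKernel_centered hqm.measurable hm
  have hLm0 : 0 ≤ Lm := (norm_nonneg (mixedHessian Wm 0 0)).trans (hLm 0 0)
  have hP2 := finiteMoment_tensorPower hm N
  have hv := totalVar_nonneg m
  set P := tensorPower m N with hPdef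
  set Kp := centered Wp m
  set Km := centered Wm m
  -- the energy splits into the parts of positive type
  have hΦ : ∀ x, meanFieldEnergy (centered W m) N x
      = meanFieldEnergy Kp N x - meanFieldEnergy Km N x := by
    intro x
    unfold meanFieldEnergy
    simp_rw [centered_sub hW hqp hqm hm, Finset.sum_sub_distrib]
    ring
  have hint : ∀ {K}, QuadraticKernel K → ∀ {μ : Measure (Config (Fin N) d)},
      IsProbabilityMeasure μ → FiniteMoment configDist 2 μ →
      Integrable (meanFieldEnergy K N) μ := fun hK _ _ hμ =>
    (integrable_sum_sum_kernel hK hμ).const_mul _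
  have hqpc := hKp.toQuadraticKernel
  have hqmc := hKm.toQuadraticKernel
  -- entropies relative to the Gibbs measure and to the product measure
  obtain ⟨hexp, hμ⟩ := gibbsMeasure_eq_tilted hN hm_fix hGibbs
  simp_rw [hΦ] at hexp hμ
  rw [hμ] at hkl
  obtain ⟨hklP, hent⟩ := klDiv_le_of_tilted_neg
    ((hint hqpc inferInstance hP2).sub (hint hqmc inferInstance hP2))
    ((hint hqpc inferInstance hν2).sub (hint hqmc inferInstance hν2)) hexp hkl
  simp only [Pi.sub_apply] at hent
  rw [integral_sub (hint hqpc inferInstance hν2) (hint hqmc inferInstance hν2),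
    integral_sub (hint hqpc inferInstance hP2) (hint hqmc inferInstance hP2)] at hent
  have hsplit : ∀ K : Pt d → Pt d → ℝ, ∀ μ : Measure (Config (Fin N) d),
      ∫ x, meanFieldEnergy K N x ∂μ
        = 1 / (2 * (N : ℝ)) * ∫ x, ∑ i, ∑ j, K (x i) (x j) ∂μ := fun K μ =>
    integral_const_mul _ _
  have hPp : ∫ x, meanFieldEnergy Kp N x ∂P ≤ Lp * totalVar m := by
    rw [hsplit, integral_sum_sum_tensorPower hqpc hm (integral_centered hqp hm)]
    have h1 : ∫ x, Kp x x ∂m ≤ ∫ x, Lp * ∫ z, ‖x - z‖ ^ 2 ∂m ∂m :=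
      integral_mono (hqpc.integrable_comp measurable_id measurable_id
          (finiteMoment_two_iff.1 hm) (finiteMoment_two_iff.1 hm))
        ((quadraticKernel_dist_sq.integrable_integral hm hm).const_mul Lp)
        (centered_diag_le hqp hWp_pos.symm hm hWp hLp)
    rw [integral_const_mul, integral_integral_dist_sq hm] at h1
    have h2 : 1 / (2 * (N : ℝ)) * (N * ∫ x, Kp x x ∂m) = 1 / 2 * ∫ x, Kp x x ∂m := by
      field_simp
    rw [h2]
    linarith
  have hPm : 0 ≤ ∫ x, meanFieldEnergy Km N x ∂P := integral_nonneg fun x =>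
    mul_nonneg (by positivity) (hKm.sum_sum_nonneg x)
  have hνp : 0 ≤ ∫ x, meanFieldEnergy Kp N x ∂ν := integral_nonneg fun x =>
    mul_nonneg (by positivity) (hKp.sum_sum_nonneg x)
  -- particles are listed by increasing diagonal energy
  set k : Fin N → ℝ := fun i => ∫ x, Km (x i) (x i) ∂ν with hk
  have hk0 : 0 ≤ ∑ i, k i := Finset.sum_nonneg fun i _ => integral_nonneg fun x =>
    hKm.diag_nonneg _
  set σ := Tuple.sort k
  set c : Fin N → ℝ := fun i => (1 + ε) / (N * ε + ((i : ℕ) + 1)) with hc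
  have hcanti : Antitone c := by
    intro i j hij
    have : ((i : ℕ) : ℝ) ≤ (j : ℕ) := by exact_mod_cast hij
    simp only [hc]
    gcongr
  -- the larger weights meet the smaller energies, so Chebyshev's inequality averages the weights
  have hcheb := (hcanti.antivary (Tuple.monotone_sort k)).card_mul_sum_le_sum_mul_sum
  rw [Fintype.card_fin, show ∑ i, (k ∘ Tuple.sort k) i = ∑ i, k i from Equiv.sum_comp σ k]
    at hcheb
  set A := weightSum N ε
  have hcA : ∑ i, c i = A := rfl
  rw [hcA] at hcheb
  have hA0 : 0 ≤ A := Finset.sum_nonneg fun i _ => by positivity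
  have hdiag := sum_diag_le hqmc hm hLm0
    (centered_diag_le hqm hWm_pos.symm hm hWm hLm) hν2
  set w := (wassersteinPow configDist 2 ν P).toReal with hw
  have hW2 : wassersteinPow configDist 2 ν P ≠ ∞ := by
    refine ne_top_of_le_ne_top (lintegral_configDist_sq_lt_top
      (π := ν.prod P) ⟨by simp, by simp⟩ hν2 hP2).ne ?_
    exact iInf₂_le (ν.prod P) ⟨by simp, by simp⟩
  have hmain : lam / 2 * w + ∫ x, meanFieldEnergy Km N x ∂ν
      ≤ (klDiv ν P).toReal + 1 / 2 * ∑ i, c i * k (σ i) := by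
    refine le_of_forall_pos_le_add fun η hη => ?_
    -- with this `a₀` the final weight `a₀ + N b` is `N`, as in the Gibbs energy
    obtain ⟨π, hπ, h⟩ := hKm.exists_coupling_tensorPower_perm hm (l := (lam / 2).toNNReal)
      (b := (1 + ε)⁻¹) (by positivity) (fun κ _ hκ => by
        rw [inv_inv]
        exact hT.ofReal_pairing_add_le hε hlam hWm_pos hqm.measurable hm hκ)
      (a₀ := N * ε / (1 + ε)) (by positivity) σ ν hν2 hklP hη
    have h1 : (N * ε / (1 + ε) + N * (1 + ε)⁻¹)⁻¹ / 2 = 1 / (2 * (N : ℝ)) := by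
      field_simp
      ring
    have h2 : ∀ i : Fin N, (N * ε / (1 + ε) + ((i : ℕ) + 1) * (1 + ε)⁻¹)⁻¹ = c i := by
      intro i
      simp only [hc]
      rw [← div_eq_mul_inv, ← add_div, inv_div]
    simp_rw [h1, h2] at h
    rw [Real.coe_toNNReal _ (by positivity)] at h
    rw [hsplit]
    have h3 : w ≤ (∫⁻ z, ENNReal.ofReal (configDist z.1 z.2 ^ 2) ∂π).toReal :=
      ENNReal.toReal_mono (lintegral_configDist_sq_lt_top hπ hν2 hP2).ne
        (iInf₂_le (f := fun π (_ : π ∈ couplings ν P) =>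
          ∫⁻ z, ENNReal.ofReal (configDist z.1 z.2 ^ 2) ∂π) π hπ)
    have h4 := mul_le_mul_of_nonneg_left h3 (by positivity : 0 ≤ lam / 2)
    linarith
  have hcheb' : ∑ i, c i * k (σ i) ≤ B / (2 * N) * (Lm * (2 * w + 4 * N * totalVar m)) := by
    have h1 : ∑ i, c i * k (σ i) ≤ A / N * ∑ i, k i := by
      rw [div_mul_eq_mul_div, le_div_iff₀ hN0, mul_comm]
      exact hcheb
    refine h1.trans (mul_le_mul ?_ hdiag hk0 ?_)
    · rw [div_le_div_iff₀ hN0 (by positivity)]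
      nlinarith
    · have : 0 ≤ B := by linarith
      positivity
  have hfinal : (lam - B * Lm / N) / 2 * w
      ≤ (klDiv ν (gibbsMeasure V W N)).toReal + (B * Lm + Lp) * totalVar m := by
    rw [hμ]
    have h1 : 1 / 2 * (B / (2 * N) * (Lm * (2 * w + 4 * N * totalVar m)))
        = B * Lm / N / 2 * w + B * Lm * totalVar m := by
      field_simp
      ring
    have h2 : (lam - B * Lm / N) / 2 * w = lam / 2 * w - B * Lm / N / 2 * w := by ring
    linarith
  rw [← hμ] at hkl
  rw [← ENNReal.ofReal_toReal hW2, ← ENNReal.ofReal_toReal hkl, EReal.coe_ennreal_ofReal,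
    EReal.coe_ennreal_ofReal, max_eq_left ENNReal.toReal_nonneg,
    max_eq_left ENNReal.toReal_nonneg, ← EReal.coe_mul, ← EReal.coe_add]
  exact EReal.coe_le_coe_iff.2 hfinal

/-! ### Elementary inequalities for the entropy function -/

/-- The density `x / p` of a restriction to a set of mass `p ≥ 1 / 2` has controlled entropy. -/
lemma klFun_div_le {p x : ℝ} (hp : 1 / 2 ≤ p) (hp1 : p ≤ 1) (hx : 0 ≤ x) :
    klFun (x / p) ≤ 2 * klFun x + 2 * x + 1 := by
  have hp0 : 0 < p := by linarith
  rcases hx.eq_or_lt with rfl | hx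
  · simp [klFun_zero]
  have hq : 1 ≤ p⁻¹ ∧ p⁻¹ ≤ 2 := ⟨(one_le_inv₀ hp0).2 hp1, by
    rw [inv_le_comm₀ hp0 two_pos]; linarith⟩
  have hlog := Real.log_le_sub_one_of_pos (inv_pos.2 hp0)
  have hlog0 := Real.log_nonneg hq.1
  have hk := klFun_nonneg hx.le
  have h1 : klFun (x / p) = p⁻¹ * klFun x + (1 - p⁻¹) + x * (p⁻¹ * Real.log p⁻¹) := by
    rw [klFun_apply, klFun_apply, div_eq_mul_inv, Real.log_mul hx.ne' (inv_pos.2 hp0).ne']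
    ring
  rw [h1]
  have h2 : p⁻¹ * Real.log p⁻¹ ≤ 2 * 1 :=
    mul_le_mul hq.2 (by linarith) hlog0 (by norm_num)
  nlinarith

lemma klFun_le_sq {x : ℝ} (hx : 0 ≤ x) : klFun x ≤ (x - 1) ^ 2 := by
  rcases hx.eq_or_lt with rfl | hx
  · simp [klFun_zero]
  have := Real.log_le_sub_one_of_pos hx
  rw [klFun_apply]
  nlinarith

lemma sq_mul_klFun_div_le_sq {a τ : ℝ} (hτ : 0 < τ) (ha : 0 ≤ a) :
    τ ^ 2 * klFun (a / τ) ≤ a ^ 2 + τ ^ 2 := by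
  have h := mul_le_mul_of_nonneg_left (klFun_le_sq (div_nonneg ha hτ.le)) (sq_nonneg τ)
  have h2 : τ ^ 2 * (a / τ - 1) ^ 2 = (a - τ) ^ 2 := by
    field_simp
  nlinarith [mul_nonneg ha hτ.le]

lemma sq_le_mul_klFun {a : ℝ} (ha : 0 ≤ a) : a ^ 2 ≤ (a + 2) * klFun (1 + a) := by
  have h := Real.le_log_one_add_of_nonneg ha
  rw [div_le_iff₀ (by positivity)] at h
  rw [klFun_apply]
  nlinarith

lemma sq_le_two_mul_klFun {x : ℝ} (hx : 0 ≤ x) (hx1 : x ≤ 1) : (1 - x) ^ 2 ≤ 2 * klFun x := by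
  rcases hx.eq_or_lt with rfl | hx
  · simp [klFun_zero]
  have h := Real.sinh_le_self_iff.2 (Real.log_nonpos hx.le hx1)
  rw [Real.sinh_log hx] at h
  have h2 := mul_le_mul_of_nonneg_left h hx.le
  have h3 : x * ((x - x⁻¹) / 2) = (x ^ 2 - 1) / 2 := by
    field_simp
  rw [klFun_apply]
  nlinarith

/-- The normalized excess `a / τ`, for `a = (f - 1)₊`, has entropy controlled by that of `f`
after scaling by `τ²`. -/
lemma sq_mul_klFun_div_le {a τ : ℝ} (hτ : 0 < τ) (hτ1 : τ ≤ 1) (ha : 0 ≤ a) :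
    τ ^ 2 * klFun (a / τ) ≤ 7 * klFun (1 + a) + τ ^ 2 := by
  rcases le_total a 5 with h5 | h5
  · have h1 := sq_mul_klFun_div_le_sq hτ ha
    have h2 := sq_le_mul_klFun ha
    have h3 := klFun_nonneg (by linarith : 0 ≤ 1 + a)
    nlinarith
  · -- for large `a` the two sides are compared with `a log a`
    have ha0 : 0 < a := by linarith
    have h1 := Real.log_le_sub_one_of_pos (inv_pos.2 hτ)
    rw [Real.log_inv] at h1
    have h2 : τ * -Real.log τ ≤ 1 - τ := by
      refine (mul_le_mul_of_nonneg_left h1 hτ.le).trans_eq ?_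
      field_simp
    have h3 : (4 / 3 : ℝ) ≤ Real.log a := by
      have h4 := Real.le_log_one_add_of_nonneg (x := 4) (by norm_num)
      norm_num at h4
      exact h4.trans (Real.log_le_log (by norm_num) h5)
    have h6 : Real.log a ≤ Real.log (1 + a) := Real.log_le_log ha0 (by linarith)
    have h7 : τ ^ 2 * klFun (a / τ)
        = a * (τ * Real.log a) + a * (τ * -Real.log τ) + τ ^ 2 - τ * a := by
      rw [klFun_apply, Real.log_div ha0.ne' hτ.ne']
      field_simp
      ring
    have h8 : τ * Real.log a ≤ Real.log a := by nlinarith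
    have h9 := mul_le_mul_of_nonneg_left h8 ha
    have h10 := mul_le_mul_of_nonneg_left h2 ha
    have h11 := mul_le_mul_of_nonneg_left h6 (by linarith : 0 ≤ 1 + a)
    have h12 := mul_le_mul_of_nonneg_left h3 ha
    rw [h7, klFun_apply]
    nlinarith [mul_pos hτ ha0]

/-! ### From the defective `T2` inequality to `T1` -/

lemma sq_lintegral_le {X : Type} [MeasurableSpace X] {γ : Measure X} [IsProbabilityMeasure γ]
    {F : X → ℝ≥0∞} (hF : Measurable F) : (∫⁻ x, F x ∂γ) ^ 2 ≤ ∫⁻ x, F x ^ 2 ∂γ := by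
  have h := ENNReal.lintegral_mul_le_Lp_mul_Lq γ Real.HolderConjugate.two_two hF.aemeasurable
    (aemeasurable_const (b := (1 : ℝ≥0∞)))
  simp only [Pi.mul_apply, mul_one, ENNReal.one_rpow, lintegral_const, measure_univ] at h
  calc (∫⁻ x, F x ∂γ) ^ 2 ≤ ((∫⁻ x, F x ^ (2 : ℝ) ∂γ) ^ (1 / 2 : ℝ)) ^ 2 := by gcongr
    _ = ∫⁻ x, F x ^ 2 ∂γ := by
      rw [← ENNReal.rpow_natCast, ← ENNReal.rpow_mul]
      norm_num

section T1
variable {ι : Type} [Fintype ι] {d : ℕ}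

lemma configDist_triangle (x y z : Config ι d) :
    configDist x z ≤ configDist x y + configDist y z := by
  have h := dist_triangle (WithLp.toLp 2 x : PiLp 2 fun _ : ι => Pt d) (WithLp.toLp 2 y)
    (WithLp.toLp 2 z)
  rw [PiLp.dist_eq_of_L2, PiLp.dist_eq_of_L2, PiLp.dist_eq_of_L2] at h
  exact h

lemma configDist_nonneg (x y : Config ι d) : 0 ≤ configDist x y := Real.sqrt_nonneg _

lemma configDist_self (x : Config ι d) : configDist x x = 0 := by simp [configDist]

lemma ofReal_configDist_sq_le (x y z : Config ι d) :
    ENNReal.ofReal (configDist x z ^ 2)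
      ≤ 2 * ENNReal.ofReal (configDist x y ^ 2) + 2 * ENNReal.ofReal (configDist y z ^ 2) := by
  rw [← ENNReal.ofReal_ofNat 2, ← ENNReal.ofReal_mul zero_le_two, ← ENNReal.ofReal_mul zero_le_two,
    ← ENNReal.ofReal_add (by positivity) (by positivity)]
  refine ENNReal.ofReal_le_ofReal ?_
  have h1 := configDist_triangle x y z
  have h2 : configDist x z ^ 2 ≤ (configDist x y + configDist y z) ^ 2 := by
    gcongr
    exact configDist_nonneg x z
  nlinarith [sq_nonneg (configDist x y - configDist y z)]

/-- The second moment of `ν` is controlled by that of `P` and the transport cost. -/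
lemma lintegral_sq_le_wassersteinPow (ν P : Measure (Config ι d)) :
    ∫⁻ x, ENNReal.ofReal (configDist x 0 ^ 2) ∂ν ≤ 2 * wassersteinPow configDist 2 ν P
      + 2 * ∫⁻ y, ENNReal.ofReal (configDist y 0 ^ 2) ∂P := by
  rw [← tsub_le_iff_right, mul_comm 2 (wassersteinPow _ _ _ _),
    ← ENNReal.div_le_iff_le_mul (by simp) (by simp)]
  unfold wassersteinPow
  refine le_iInf₂ fun π hπ => ?_
  rw [ENNReal.div_le_iff_le_mul (by simp) (by simp), tsub_le_iff_right, mul_comm]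
  have hm : Measurable fun x : Config ι d => ENNReal.ofReal (configDist x 0 ^ 2) := by fun_prop
  conv_lhs => rw [← hπ.1]
  conv_rhs => rw [← hπ.2]
  rw [lintegral_map hm measurable_fst, lintegral_map hm measurable_snd,
    ← lintegral_const_mul _ (by fun_prop), ← lintegral_const_mul _ (by fun_prop),
    ← lintegral_add_left (by fun_prop)]
  exact lintegral_mono fun z => ofReal_configDist_sq_le _ _ _

variable {μ P : Measure (Config ι d)} [IsProbabilityMeasure μ]
  {l δ : NNReal}

/-- A defective `T2` inequality forces laws of finite entropy to have a finite second moment: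
it bounds the second moments of their restrictions to balls uniformly. -/
lemma finiteMoment_of_klDiv_ne_top (hP : FiniteMoment configDist 2 P) (hl : l ≠ 0)
    (hD : ∀ ν : Measure (Config ι d), IsProbabilityMeasure ν → FiniteMoment configDist 2 ν →
      l * wassersteinPow configDist 2 ν P ≤ klDiv ν μ + δ)
    {ν : Measure (Config ι d)} [IsProbabilityMeasure ν] (hν : klDiv ν μ ≠ ∞) :
    FiniteMoment configDist 2 ν := by
  obtain ⟨f, hf, hνf⟩ := exists_nnreal_density (klDiv_ne_top_iff.1 hν).1
  have hf1 : ∫⁻ x, (f x : ℝ≥0∞) ∂μ = 1 := by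
    have : ν Set.univ = 1 := measure_univ
    rwa [hνf, withDensity_apply _ MeasurableSet.univ, setLIntegral_univ] at this
  have hkl : klDiv ν μ = ∫⁻ x, ENNReal.ofReal (klFun (f x)) ∂μ := by
    rw [hνf, klDiv_withDensity hf (by simp [hf1])]
  have hsqm : Measurable fun x : Config ι d => ENNReal.ofReal (configDist x 0 ^ 2) := by fun_prop
  have hklm : Measurable fun x => ENNReal.ofReal (klFun (f x)) :=
    (measurable_klFun.comp hf.coe_nnreal_real).ennreal_ofReal
  set B : ℕ → Set (Config ι d) := fun n => {x | configDist x 0 ≤ n} with hB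
  have hBm : ∀ n, MeasurableSet (B n) := fun n =>
    measurableSet_le (by fun_prop) measurable_const
  have hBmono : Monotone B := fun i j hij x (hx : configDist x 0 ≤ i) =>
    hx.trans (by exact_mod_cast hij : (i : ℝ) ≤ j)
  have hBU : ⋃ n, B n = Set.univ := Set.eq_univ_of_forall fun x =>
    Set.mem_iUnion.2 (exists_nat_ge (configDist x 0))
  have htend := tendsto_measure_iUnion_atTop (μ := ν) hBmono
  rw [hBU, measure_univ] at htend
  obtain ⟨n₀, hn₀⟩ := Filter.eventually_atTop.1
    (htend.eventually (lt_mem_nhds (ENNReal.one_half_lt_one)))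
  set C : ℝ≥0∞ := 2 * (2 * klDiv ν μ + 3 + δ) + 2 * (l * ∫⁻ y, ENNReal.ofReal (configDist y 0 ^ 2) ∂P)
    with hC
  have hCtop : C < ∞ := by
    have := ENNReal.mul_lt_top (a := (l : ℝ≥0∞)) (by simp) hP
    simp only [hC]
    finiteness
  have hball : ∀ n, n₀ ≤ n → l * ∫⁻ x in B n, ENNReal.ofReal (configDist x 0 ^ 2) ∂ν ≤ C := by
    intro n hn
    set p : NNReal := (ν (B n)).toNNReal with hp
    have hpν : (p : ℝ≥0∞) = ν (B n) := ENNReal.coe_toNNReal (measure_ne_top ν _)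
    have hp1 : p ≤ 1 := by
      have : (p : ℝ≥0∞) ≤ 1 := hpν ▸ prob_le_one
      exact_mod_cast this
    have hp2 : (1 / 2 : ℝ) ≤ p := by
      have h : 2⁻¹ < ν (B n) := hn₀ n hn
      rw [← hpν] at h
      have h2 := (ENNReal.toReal_lt_toReal (by simp) (by simp)).2 h
      simp only [one_div, ENNReal.toReal_inv, ENNReal.toReal_ofNat, ENNReal.coe_toReal] at h2 ⊢
      exact h2.le
    have hp0 : p ≠ 0 := by
      rintro h
      rw [h] at hp2
      norm_num at hp2
    set g : Config ι d → NNReal := (B n).indicator fun x => f x / p with hg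
    have hgm : Measurable g := (hf.div_const p).indicator (hBm n)
    have hgE : ∀ x, (g x : ℝ≥0∞) = (B n).indicator (fun x => (f x : ℝ≥0∞) / p) x := by
      intro x
      simp only [hg, Set.indicator]
      split_ifs
      · rw [ENNReal.coe_div hp0]
      · simp
    have hpf : ∫⁻ x in B n, (f x : ℝ≥0∞) ∂μ = p := by
      rw [hpν, hνf, withDensity_apply _ (hBm n)]
    have hg1 : ∫⁻ x, (g x : ℝ≥0∞) ∂μ = 1 := by
      simp_rw [hgE]
      rw [lintegral_indicator (hBm n)]
      simp_rw [div_eq_mul_inv]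
      rw [lintegral_mul_const _ (by fun_prop), hpf, ENNReal.mul_inv_cancel (by simpa) (by simp)]
    set νn := μ.withDensity fun x => (g x : ℝ≥0∞) with hνn
    have hνnP : IsProbabilityMeasure νn := ⟨by
      rw [hνn, withDensity_apply _ MeasurableSet.univ, setLIntegral_univ, hg1]⟩
    have hmom : FiniteMoment configDist 2 νn := by
      unfold FiniteMoment
      rw [hνn, lintegral_withDensity_eq_lintegral_mul _ (by fun_prop) hsqm]
      have : ∀ x, (g x : ℝ≥0∞) * ENNReal.ofReal (configDist x 0 ^ 2)
          ≤ g x * ENNReal.ofReal ((n : ℝ) ^ 2) := by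
        intro x
        simp only [hgE]
        by_cases hx : x ∈ B n
        · gcongr
          · exact configDist_nonneg x 0
          · exact hx
        · simp [hx]
      refine (lintegral_mono this).trans_lt ?_
      rw [lintegral_mul_const _ (by fun_prop), hg1]
      simp
    have hent : klDiv νn μ ≤ 2 * klDiv ν μ + 3 := by
      rw [hνn, klDiv_withDensity hgm (by simp [hg1]), hkl]
      have : ∀ x, ENNReal.ofReal (klFun (g x)) ≤ 2 * ENNReal.ofReal (klFun (f x))
          + (2 * f x + 1) := by
        intro x
        have h0 := klFun_nonneg (f x).coe_nonneg
        have h1 : klFun (g x) ≤ 2 * klFun (f x) + (2 * f x + 1) := by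
          by_cases hx : x ∈ B n
          · have := klFun_div_le hp2 (by exact_mod_cast hp1) (f x).coe_nonneg
            simp only [hg, Set.indicator_of_mem hx, NNReal.coe_div]
            linarith
          · simp only [hg, Set.indicator_of_notMem hx, NNReal.coe_zero, klFun_zero]
            have := (f x).coe_nonneg
            linarith
        refine (ENNReal.ofReal_le_ofReal h1).trans_eq ?_
        rw [ENNReal.ofReal_add (by positivity) (by positivity), ENNReal.ofReal_mul zero_le_two,
          ENNReal.ofReal_add (by positivity) zero_le_one, ENNReal.ofReal_mul zero_le_two]
        simp
      refine (lintegral_mono this).trans_eq ?_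
      rw [lintegral_add_left (by fun_prop), lintegral_const_mul _ hklm,
        lintegral_add_left (by fun_prop), lintegral_const_mul _ (by fun_prop), hf1]
      simp only [mul_one, lintegral_const, measure_univ]
      norm_num
    have hle : ∫⁻ x in B n, ENNReal.ofReal (configDist x 0 ^ 2) ∂ν
        ≤ ∫⁻ x, ENNReal.ofReal (configDist x 0 ^ 2) ∂νn := by
      rw [hνf, hνn, setLIntegral_withDensity_eq_setLIntegral_mul _ (by fun_prop) hsqm (hBm n),
        lintegral_withDensity_eq_lintegral_mul _ (by fun_prop) hsqm,
        ← lintegral_indicator (hBm n)]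
      refine lintegral_mono fun x => ?_
      simp only [Pi.mul_apply, hgE, Set.indicator]
      split_ifs
      · gcongr
        rw [ENNReal.le_div_iff_mul_le (by simp [hp0]) (by simp)]
        exact mul_le_of_le_one_right' (by exact_mod_cast hp1)
      · simp
    calc l * ∫⁻ x in B n, ENNReal.ofReal (configDist x 0 ^ 2) ∂ν
        ≤ l * (2 * wassersteinPow configDist 2 νn P
          + 2 * ∫⁻ y, ENNReal.ofReal (configDist y 0 ^ 2) ∂P) := by
          gcongr
          exact hle.trans (lintegral_sq_le_wassersteinPow νn P)
      _ = 2 * (l * wassersteinPow configDist 2 νn P)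
          + 2 * (l * ∫⁻ y, ENNReal.ofReal (configDist y 0 ^ 2) ∂P) := by ring
      _ ≤ C := by
          rw [hC]
          gcongr
          exact (hD νn hνnP hmom).trans (by gcongr)
  have hsup : l * ∫⁻ x, ENNReal.ofReal (configDist x 0 ^ 2) ∂ν ≤ C := by
    rw [← setLIntegral_univ, ← hBU, setLIntegral_iUnion_of_directed _ hBmono.directed_le,
      ENNReal.mul_iSup]
    refine iSup_le fun n => le_trans ?_ (hball (max n n₀) (le_max_right _ _))
    gcongr
    exact hBmono (le_max_left _ _)
  exact ENNReal.lt_top_of_mul_ne_top_right (hsup.trans_lt hCtop).ne (by simpa using hl)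

end T1

section Excess
variable {ι : Type} [Fintype ι] {d : ℕ} {μ P : Measure (Config ι d)}

lemma lintegral_configDist_sq_triangle {Ω : Type} [MeasurableSpace Ω] (ω : Measure Ω)
    {X Y Z : Ω → Config ι d} (hX : Measurable X) (hY : Measurable Y) (hZ : Measurable Z) :
    ∫⁻ p, ENNReal.ofReal (configDist (X p) (Z p) ^ 2) ∂ω
      ≤ 2 * ∫⁻ p, ENNReal.ofReal (configDist (X p) (Y p) ^ 2) ∂ω
        + 2 * ∫⁻ p, ENNReal.ofReal (configDist (Y p) (Z p) ^ 2) ∂ω := by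
  rw [← lintegral_const_mul _ (by fun_prop), ← lintegral_const_mul _ (by fun_prop),
    ← lintegral_add_left (by fun_prop)]
  exact lintegral_mono fun p => ofReal_configDist_sq_le _ _ _

/-- Two laws close to `P` are close to each other: their nearly optimal couplings with `P` are
glued along `P`. -/
lemma exists_coupling_triangle [IsProbabilityMeasure P] {α β : Measure (Config ι d)} [IsProbabilityMeasure α]
    [IsProbabilityMeasure β] {l a b η : NNReal} (hη : 0 < η)
    (hα : l * wassersteinPow configDist 2 α P ≤ a)
    (hβ : l * wassersteinPow configDist 2 β P ≤ b) :
    ∃ γ ∈ couplings α β,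
      l * ∫⁻ z, ENNReal.ofReal (configDist z.1 z.2 ^ 2) ∂γ ≤ 2 * (a + b + 2 * η) := by
  obtain ⟨π, hπ, hπc⟩ := exists_coupling_le configDist 2 hη hα
  obtain ⟨ρ, hρ, hρc⟩ := exists_coupling_le configDist 2 hη hβ
  have hπP := isProbabilityMeasure_of_coupling hπ
  have hρP := isProbabilityMeasure_of_coupling hρ
  have hρ' : IsProbabilityMeasure (ρ.map Prod.swap) :=
    Measure.isProbabilityMeasure_map measurable_swap.aemeasurable
  obtain ⟨ω, hω, hω1, hω2⟩ := exists_gluing (π := π) (ρ := ρ.map Prod.swap) (by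
    rw [hπ.2, Measure.map_map measurable_fst measurable_swap]
    exact hρ.2.symm)
  refine ⟨ω.map fun p => (p.1.1, p.2), ⟨?_, ?_⟩, ?_⟩
  · rw [Measure.map_map measurable_fst (by fun_prop)]
    change ω.map (Prod.fst ∘ Prod.fst) = α
    rw [← Measure.map_map measurable_fst measurable_fst, hω1, hπ.1]
  · rw [Measure.map_map measurable_snd (by fun_prop)]
    change ω.map (Prod.snd ∘ fun p => (p.1.2, p.2)) = β
    rw [← Measure.map_map measurable_snd (by fun_prop), hω2,
      Measure.map_map measurable_snd measurable_swap]
    exact hρ.1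
  · have hm : Measurable fun z : Config ι d × Config ι d =>
        ENNReal.ofReal (configDist z.1 z.2 ^ 2) := by fun_prop
    rw [lintegral_map hm (by fun_prop)]
    have h1 : ∫⁻ p, ENNReal.ofReal (configDist p.1.1 p.1.2 ^ 2) ∂ω
        = ∫⁻ z, ENNReal.ofReal (configDist z.1 z.2 ^ 2) ∂π := by
      rw [← hω1, lintegral_map hm measurable_fst]
    have h2 : ∫⁻ p, ENNReal.ofReal (configDist p.1.2 p.2 ^ 2) ∂ω
        = ∫⁻ z, ENNReal.ofReal (configDist z.1 z.2 ^ 2) ∂ρ := by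
      have h3 := lintegral_map (μ := ω) hm
        (g := fun p : (Config ι d × Config ι d) × Config ι d => (p.1.2, p.2)) (by fun_prop)
      rw [hω2, lintegral_map hm measurable_swap] at h3
      rw [← h3]
      simp only [Prod.fst_swap, Prod.snd_swap, configDist, dist_comm]
    calc l * ∫⁻ p, ENNReal.ofReal (configDist p.1.1 p.2 ^ 2) ∂ω
        ≤ l * (2 * ∫⁻ z, ENNReal.ofReal (configDist z.1 z.2 ^ 2) ∂π
          + 2 * ∫⁻ z, ENNReal.ofReal (configDist z.1 z.2 ^ 2) ∂ρ) := by
          rw [← h1, ← h2]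
          exact mul_le_mul_right (lintegral_configDist_sq_triangle ω (by fun_prop) (by fun_prop)
            (by fun_prop)) _
      _ = 2 * (l * ∫⁻ z, ENNReal.ofReal (configDist z.1 z.2 ^ 2) ∂π
          + l * ∫⁻ z, ENNReal.ofReal (configDist z.1 z.2 ^ 2) ∂ρ) := by ring
      _ ≤ 2 * ((a + η) + (b + η)) := by gcongr
      _ = _ := by ring

/-- The common mass of two densities stays in place; only the excess mass is transported. -/
lemma wassersteinPow_one_sq_le_of_excess {f : Config ι d → ℝ≥0∞} (hf : Measurable f)
    {τ : ℝ≥0∞} {α β : Measure (Config ι d)} [IsProbabilityMeasure α]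
    (hα : τ • α = μ.withDensity fun x => f x - 1) (hβ : τ • β = μ.withDensity fun x => 1 - f x)
    {γ : Measure (Config ι d × Config ι d)} (hγ : γ ∈ couplings α β) :
    wassersteinPow configDist 1 (μ.withDensity f) μ ^ 2
      ≤ τ ^ 2 * ∫⁻ z, ENNReal.ofReal (configDist z.1 z.2 ^ 2) ∂γ := by
  have hγP := isProbabilityMeasure_of_coupling hγ
  have hdiag : Measurable fun x : Config ι d => (x, x) := by fun_prop
  set Γ : Measure (Config ι d × Config ι d) :=
    (μ.withDensity fun x => min (f x) 1).map (fun x => (x, x)) + τ • γ with hΓ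
  have hmem : Γ ∈ couplings (μ.withDensity f) μ := by
    constructor
    · rw [hΓ, Measure.map_add _ _ measurable_fst, Measure.map_map measurable_fst hdiag,
        Measure.map_smul, hγ.1, hα]
      change Measure.map id _ + _ = _
      rw [Measure.map_id, ← withDensity_add_left (by fun_prop)]
      congr 1
      ext1 x
      exact min_add_tsub _ _
    · rw [hΓ, Measure.map_add _ _ measurable_snd, Measure.map_map measurable_snd hdiag,
        Measure.map_smul, hγ.2, hβ]
      change Measure.map id _ + _ = _
      rw [Measure.map_id, ← withDensity_add_left (by fun_prop)]
      conv_rhs => rw [← withDensity_one (μ := μ)]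
      congr 1
      ext1 x
      simp only [Pi.add_apply, Pi.one_apply]
      rw [min_comm]
      exact min_add_tsub _ _
  have hW : wassersteinPow configDist 1 (μ.withDensity f) μ
      ≤ τ * ∫⁻ z, ENNReal.ofReal (configDist z.1 z.2) ∂γ := by
    refine (iInf₂_le Γ hmem).trans_eq ?_
    simp only [pow_one]
    rw [hΓ, lintegral_add_measure, lintegral_map (by fun_prop) hdiag, lintegral_smul_measure]
    simp [configDist_self]
  calc wassersteinPow configDist 1 (μ.withDensity f) μ ^ 2
      ≤ (τ * ∫⁻ z, ENNReal.ofReal (configDist z.1 z.2) ∂γ) ^ 2 := by gcongr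
    _ = τ ^ 2 * (∫⁻ z, ENNReal.ofReal (configDist z.1 z.2) ∂γ) ^ 2 := mul_pow _ _ _
    _ ≤ τ ^ 2 * ∫⁻ z, ENNReal.ofReal (configDist z.1 z.2) ^ 2 ∂γ := by
      gcongr
      exact sq_lintegral_le (by fun_prop)
    _ = _ := by
      simp_rw [ENNReal.ofReal_pow (configDist_nonneg _ _)]

/-- The entropy of a normalized nonnegative function, scaled by the square of its mass. -/
lemma sq_mul_klDiv_withDensity_div_le {X : Type} [MeasurableSpace X] {μ : Measure X}
    [IsProbabilityMeasure μ] {g f : X → NNReal} (hg : Measurable g) (hf : Measurable f)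
    {τ C : NNReal} (hτ : τ ≠ 0) (hgτ : ∫⁻ x, (g x : ℝ≥0∞) ∂μ = τ)
    (h : ∀ x, (τ : ℝ) ^ 2 * klFun (g x / τ) ≤ C * klFun (f x) + τ ^ 2) :
    (τ : ℝ≥0∞) ^ 2 * klDiv (μ.withDensity fun x => ((g x / τ : NNReal) : ℝ≥0∞)) μ
      ≤ C * (∫⁻ x, ENNReal.ofReal (klFun (f x)) ∂μ) + τ ^ 2 := by
  have hm : Measurable fun x => ENNReal.ofReal (klFun (f x)) :=
    (measurable_klFun.comp hf.coe_nnreal_real).ennreal_ofReal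
  rw [klDiv_withDensity (hg.div_const τ), ← lintegral_const_mul' _ _ (by simp)]
  · calc ∫⁻ x, (τ : ℝ≥0∞) ^ 2 * ENNReal.ofReal (klFun (g x / τ : NNReal)) ∂μ
        ≤ ∫⁻ x, (C * ENNReal.ofReal (klFun (f x)) + (τ : ℝ≥0∞) ^ 2) ∂μ := by
          refine lintegral_mono fun x => ?_
          have h1 := ENNReal.ofReal_le_ofReal (h x)
          have hk := klFun_nonneg (f x).coe_nonneg
          rw [ENNReal.ofReal_mul (by positivity), ENNReal.ofReal_add (by positivity)
            (by positivity), ENNReal.ofReal_mul (by positivity),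
            ENNReal.ofReal_pow (by positivity)] at h1
          simpa only [ENNReal.ofReal_coe_nnreal, NNReal.coe_div] using h1
      _ = _ := by
          rw [lintegral_add_left (by fun_prop), lintegral_const_mul _ hm]
          simp
  · simp_rw [ENNReal.coe_div hτ, div_eq_mul_inv]
    rw [lintegral_mul_const _ (by fun_prop), hgτ]
    exact (ENNReal.mul_lt_top (by simp) (by simpa [pos_iff_ne_zero] using hτ)).ne

/-- A defective `T2` inequality towards a reference measure `P` implies a `T1` inequality for `μ`:
the parts of `ν` above and below `μ` are compared to each other through `P`, and their masses
are small when the entropy is. -/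
theorem wassersteinPow_one_sq_le [IsProbabilityMeasure μ] [IsProbabilityMeasure P] (hP : FiniteMoment configDist 2 P) {l δ : NNReal} (hl : l ≠ 0)
    (hD : ∀ ν : Measure (Config ι d), IsProbabilityMeasure ν → FiniteMoment configDist 2 ν →
      l * wassersteinPow configDist 2 ν P ≤ klDiv ν μ + δ)
    (ν : Measure (Config ι d)) [IsProbabilityMeasure ν] :
    l * wassersteinPow configDist 1 ν μ ^ 2 ≤ (26 + 8 * δ) * klDiv ν μ := by
  rcases eq_or_ne (klDiv ν μ) ∞ with hν | hν
  · rw [hν, ENNReal.mul_top (by simp)]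
    exact le_top
  obtain ⟨f, hf, hνf⟩ := exists_nnreal_density (klDiv_ne_top_iff.1 hν).1
  have hf1 : ∫⁻ x, (f x : ℝ≥0∞) ∂μ = 1 := by
    have : ν Set.univ = 1 := measure_univ
    rwa [hνf, withDensity_apply _ MeasurableSet.univ, setLIntegral_univ] at this
  have hkl : klDiv ν μ = ∫⁻ x, ENNReal.ofReal (klFun (f x)) ∂μ := by
    rw [hνf, klDiv_withDensity hf (by simp [hf1])]
  have hm : Measurable fun x => ENNReal.ofReal (klFun (f x)) :=
    (measurable_klFun.comp hf.coe_nnreal_real).ennreal_ofReal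
  -- the mass that has to be moved
  have hτ1 : ∫⁻ x, ((1 - f x : NNReal) : ℝ≥0∞) ∂μ ≤ 1 := by
    calc ∫⁻ x, ((1 - f x : NNReal) : ℝ≥0∞) ∂μ ≤ ∫⁻ _, 1 ∂μ := by
          gcongr with x
          exact_mod_cast tsub_le_self
      _ = 1 := by simp
  obtain ⟨τ, hτ⟩ : ∃ τ : NNReal, ∫⁻ x, ((1 - f x : NNReal) : ℝ≥0∞) ∂μ = τ :=
    ⟨_, (ENNReal.coe_toNNReal (hτ1.trans_lt ENNReal.one_lt_top).ne).symm⟩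
  have hτ' : ∫⁻ x, ((f x - 1 : NNReal) : ℝ≥0∞) ∂μ = τ := by
    rw [← hτ]
    have := lintegral_tsub_comm (m := μ) hf.coe_nnreal_ennreal
      (measurable_const (a := (1 : ℝ≥0∞))) hf1 (by simp)
    simpa only [ENNReal.coe_sub, ENNReal.coe_one] using this
  have hτ1' : (τ : ℝ) ≤ 1 := by
    rw [hτ] at hτ1
    exact_mod_cast hτ1
  -- the defect is multiplied by `τ ^ 2`, which the entropy controls
  have hτ2 : (τ : ℝ≥0∞) ^ 2 ≤ 2 * klDiv ν μ := by
    rw [← hτ, hkl, ← lintegral_const_mul _ hm]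
    refine (sq_lintegral_le (by fun_prop)).trans (lintegral_mono fun x => ?_)
    rcases le_total (f x) 1 with hx | hx
    · have h1 := sq_le_two_mul_klFun (f x).coe_nonneg (by exact_mod_cast hx)
      have h2 := ENNReal.ofReal_le_ofReal h1
      rw [ENNReal.ofReal_mul zero_le_two, ENNReal.ofReal_pow (by
        have : (f x : ℝ) ≤ 1 := by exact_mod_cast hx
        linarith)] at h2
      have h3 : ENNReal.ofReal (1 - (f x : ℝ)) = ((1 - f x : NNReal) : ℝ≥0∞) := by
        rw [← ENNReal.ofReal_coe_nnreal, NNReal.coe_sub hx, NNReal.coe_one]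
      rw [h3] at h2
      simpa using h2
    · simp [tsub_eq_zero_of_le hx]
  rcases eq_or_ne τ 0 with h0 | h0
  · -- no mass has to be moved
    subst h0
    have hz : ∀ g : Config ι d → NNReal, Measurable g → ∫⁻ x, (g x : ℝ≥0∞) ∂μ = (0 : NNReal) →
        (0 : ℝ≥0∞) • μ = μ.withDensity fun x => (g x : ℝ≥0∞) := by
      intro g hg h
      rw [zero_smul, eq_comm, withDensity_eq_zero_iff (by fun_prop)]
      exact (lintegral_eq_zero_iff (by fun_prop)).1 (by simpa using h)
    have hW := wassersteinPow_one_sq_le_of_excess (μ := μ) (τ := 0) hf.coe_nnreal_ennreal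
      (by simpa only [ENNReal.coe_sub, ENNReal.coe_one] using hz (fun x => f x - 1) (by fun_prop) hτ')
      (by simpa only [ENNReal.coe_sub, ENNReal.coe_one] using hz (fun x => 1 - f x) (by fun_prop) hτ)
      (γ := μ.prod μ) ⟨by simp, by simp⟩
    rw [← hνf] at hW
    have hW0 : wassersteinPow configDist 1 ν μ ^ 2 = 0 := by simpa using hW
    simp [hW0]
  have hτpos : (0 : ℝ) < τ := by exact_mod_cast pos_iff_ne_zero.2 h0
  set α := μ.withDensity fun x => (((f x - 1) / τ : NNReal) : ℝ≥0∞) with hα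
  set β := μ.withDensity fun x => (((1 - f x) / τ : NNReal) : ℝ≥0∞) with hβ
  have hsm : ∀ g : Config ι d → NNReal, Measurable g →
      (τ : ℝ≥0∞) • μ.withDensity (fun x => ((g x / τ : NNReal) : ℝ≥0∞))
        = μ.withDensity fun x => (g x : ℝ≥0∞) := by
    intro g hg
    rw [← withDensity_smul _ (by fun_prop)]
    congr 1
    ext1 x
    simp only [Pi.smul_apply, smul_eq_mul]
    rw [← ENNReal.coe_mul, mul_div_cancel₀ _ h0]
  have hpr : ∀ g : Config ι d → NNReal, Measurable g → ∫⁻ x, (g x : ℝ≥0∞) ∂μ = τ →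
      IsProbabilityMeasure (μ.withDensity fun x => ((g x / τ : NNReal) : ℝ≥0∞)) := by
    intro g hg hgτ
    constructor
    rw [withDensity_apply _ MeasurableSet.univ, setLIntegral_univ]
    simp_rw [ENNReal.coe_div h0, div_eq_mul_inv]
    rw [lintegral_mul_const _ (by fun_prop), hgτ, ENNReal.mul_inv_cancel (by simpa) (by simp)]
  have hαP : IsProbabilityMeasure α := hpr _ (by fun_prop) hτ'
  have hβP : IsProbabilityMeasure β := hpr _ (by fun_prop) hτ
  have hkα : (τ : ℝ≥0∞) ^ 2 * klDiv α μ ≤ 7 * klDiv ν μ + τ ^ 2 := by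
    rw [hkl]
    refine sq_mul_klDiv_withDensity_div_le (C := 7) (by fun_prop) hf h0 hτ' fun x => ?_
    rcases le_total (f x) 1 with hx | hx
    · have := klFun_nonneg (f x).coe_nonneg
      simp [tsub_eq_zero_of_le hx, klFun_zero, this]
    · have h := sq_mul_klFun_div_le (a := ((f x - 1 : NNReal) : ℝ)) hτpos hτ1' NNReal.zero_le_coe
      rwa [show 1 + ((f x - 1 : NNReal) : ℝ) = f x by rw [NNReal.coe_sub hx]; simp] at h
  have hkβ : (τ : ℝ≥0∞) ^ 2 * klDiv β μ ≤ 2 * klDiv ν μ + τ ^ 2 := by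
    rw [hkl]
    refine sq_mul_klDiv_withDensity_div_le (C := 2) (by fun_prop) hf h0 hτ fun x => ?_
    rcases le_total (f x) 1 with hx | hx
    · have h1 := sq_mul_klFun_div_le_sq (a := ((1 - f x : NNReal) : ℝ)) hτpos NNReal.zero_le_coe
      have h2 := sq_le_two_mul_klFun (f x).coe_nonneg (by exact_mod_cast hx)
      rw [NNReal.coe_sub hx, NNReal.coe_one] at h1 ⊢
      simp only [NNReal.coe_ofNat]
      linarith
    · have := klFun_nonneg (f x).coe_nonneg
      simp [tsub_eq_zero_of_le hx, klFun_zero, this]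
  have hfin : ∀ {c : ℝ≥0∞} {κ : Measure (Config ι d)}, c ≠ ∞ →
      (τ : ℝ≥0∞) ^ 2 * klDiv κ μ ≤ c * klDiv ν μ + τ ^ 2 → klDiv κ μ ≠ ∞ := by
    intro c κ hc h
    refine (ENNReal.lt_top_of_mul_ne_top_right (h.trans_lt ?_).ne (by simpa using h0)).ne
    have := hν.lt_top
    finiteness
  have hfα := hfin (by simp) hkα
  have hfβ := hfin (by simp) hkβ
  have hTα := hD α hαP (finiteMoment_of_klDiv_ne_top hP hl hD hfα)
  have hTβ := hD β hβP (finiteMoment_of_klDiv_ne_top hP hl hD hfβ)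
  lift klDiv α μ to NNReal using hfα with a ha
  lift klDiv β μ to NNReal using hfβ with b hb
  refine ENNReal.le_of_forall_pos_le_add fun η hη _ => ?_
  obtain ⟨γ, hγ, hγc⟩ := exists_coupling_triangle (l := l) (a := a + δ) (b := b + δ)
    (η := η / 4) (by positivity) (by exact_mod_cast hTα) (by exact_mod_cast hTβ)
  have hW := wassersteinPow_one_sq_le_of_excess (μ := μ) hf.coe_nnreal_ennreal
    (by simpa only [ENNReal.coe_sub, ENNReal.coe_one] using hsm (fun x => f x - 1) (by fun_prop))
    (by simpa only [ENNReal.coe_sub, ENNReal.coe_one] using hsm (fun x => 1 - f x) (by fun_prop))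
    hγ
  rw [← hνf] at hW
  have hlW : l * wassersteinPow configDist 1 ν μ ^ 2
      ≤ (τ : ℝ≥0∞) ^ 2 * (2 * (((a + δ : NNReal) : ℝ≥0∞) + ((b + δ : NNReal) : ℝ≥0∞)
        + 2 * ((η / 4 : NNReal) : ℝ≥0∞))) := by
    calc l * wassersteinPow configDist 1 ν μ ^ 2
        ≤ l * ((τ : ℝ≥0∞) ^ 2 * ∫⁻ z, ENNReal.ofReal (configDist z.1 z.2 ^ 2) ∂γ) := by gcongr
      _ = (τ : ℝ≥0∞) ^ 2 * (l * ∫⁻ z, ENNReal.ofReal (configDist z.1 z.2 ^ 2) ∂γ) := by ring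
      _ ≤ _ := by gcongr
  refine hlW.trans ?_
  lift klDiv ν μ to NNReal using hν with h
  -- `26 = 2 * (7 + 2 + 2 * 2)`, from the two entropy bounds and `τ ^ 2 ≤ 2 * h` in each,
  -- and `8 = 2 * 2 * 2`, from the two defects
  norm_cast at hkα hkβ hτ2 ⊢
  have h1 : (τ : ℝ) ^ 2 * a ≤ 7 * h + τ ^ 2 := by exact_mod_cast hkα
  have h2 : (τ : ℝ) ^ 2 * b ≤ 2 * h + τ ^ 2 := by exact_mod_cast hkβ
  have h3 : (τ : ℝ) ^ 2 ≤ 2 * h := by exact_mod_cast hτ2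
  have h4 : (τ : ℝ) ^ 2 ≤ 1 := pow_le_one₀ hτpos.le hτ1'
  have h5 := mul_le_mul_of_nonneg_left h3 δ.coe_nonneg
  have h6 := mul_le_mul_of_nonneg_left h4 η.coe_nonneg
  rw [← NNReal.coe_le_coe]
  push_cast
  linarith

end Excess

/-! ### Marginals and conclusion -/

lemma wassersteinPow_one_map_le {ι κ : Type} [Fintype ι] [Fintype κ] {d : ℕ}
    {p : Config ι d → Config κ d} (hp : Measurable p)
    (hlip : ∀ x y, configDist (p x) (p y) ≤ configDist x y) (ν μ : Measure (Config ι d)) :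
    wassersteinPow configDist 1 (ν.map p) (μ.map p) ≤ wassersteinPow configDist 1 ν μ := by
  refine le_iInf₂ fun π hπ => ?_
  have hpp : Measurable (Prod.map p p) := hp.prodMap hp
  have hmem : π.map (Prod.map p p) ∈ couplings (ν.map p) (μ.map p) := by
    constructor
    · rw [Measure.map_map measurable_fst hpp]
      change π.map (p ∘ Prod.fst) = _
      rw [← Measure.map_map hp measurable_fst, hπ.1]
    · rw [Measure.map_map measurable_snd hpp]
      change π.map (p ∘ Prod.snd) = _
      rw [← Measure.map_map hp measurable_snd, hπ.2]
  refine (iInf₂_le _ hmem).trans ?_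
  rw [lintegral_map (by fun_prop) hpp]
  simp only [Prod.map_fst, Prod.map_snd, pow_one]
  exact lintegral_mono fun z => ENNReal.ofReal_le_ofReal (hlip _ _)

/-- A measure on the image space lifts along `p`, with the same density and hence the same
relative entropy. -/
lemma exists_lift_klDiv_eq {X Y : Type} [MeasurableSpace X] [MeasurableSpace Y] {p : X → Y}
    (hp : Measurable p) (μ : Measure X) [IsProbabilityMeasure μ] {ν : Measure Y}
    [IsProbabilityMeasure ν] (h : ν ≪ μ.map p) :
    ∃ ν' : Measure X, IsProbabilityMeasure ν' ∧ ν'.map p = ν ∧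
      klDiv ν' μ = klDiv ν (μ.map p) := by
  have hμp : IsProbabilityMeasure (μ.map p) := Measure.isProbabilityMeasure_map hp.aemeasurable
  obtain ⟨f, hf, rfl⟩ := exists_nnreal_density h
  have hf1 : ∫⁻ y, (f y : ℝ≥0∞) ∂(μ.map p) = 1 := by
    have : ((μ.map p).withDensity fun y => (f y : ℝ≥0∞)) Set.univ = 1 := measure_univ
    rwa [withDensity_apply _ MeasurableSet.univ, setLIntegral_univ] at this
  have hf1' : ∫⁻ x, (f (p x) : ℝ≥0∞) ∂μ = 1 := by
    rw [← hf1, lintegral_map (by fun_prop) hp]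
  refine ⟨μ.withDensity fun x => (f (p x) : ℝ≥0∞), ⟨?_⟩, ?_, ?_⟩
  · rw [withDensity_apply _ MeasurableSet.univ, setLIntegral_univ, hf1']
  · ext s hs
    rw [Measure.map_apply hp hs, withDensity_apply _ (hp hs), withDensity_apply _ hs,
      setLIntegral_map hs (by fun_prop) hp]
  · rw [klDiv_withDensity (f := fun x => f (p x)) (hf.comp hp) (by simp [hf1']),
      klDiv_withDensity hf (by simp [hf1])]
    exact (lintegral_map (measurable_klFun.comp hf.coe_nnreal_real).ennreal_ofReal hp).symm

lemma configDist_restrict_le {d N : ℕ} (S : Finset (Fin N)) (x y : Config (Fin N) d) :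
    configDist (fun i : {i // i ∈ S} => x i.1) (fun i => y i.1) ≤ configDist x y := by
  refine Real.sqrt_le_sqrt ?_
  rw [Finset.sum_coe_sort S fun i => dist (x i) (y i) ^ 2]
  exact Finset.sum_le_sum_of_subset_of_nonneg (Finset.subset_univ _) fun i _ _ => by positivity

/-- The defective `T2` inequality implies the `T1` inequality for the measure and its marginals. -/
theorem DefectiveT2.transportT1 {d N : ℕ} {m : Measure (Pt d)} [IsProbabilityMeasure m]
    (hm : FiniteMoment dist 2 m) {μ : Measure (Config (Fin N) d)} [IsProbabilityMeasure μ]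
    {lam δ : ℝ} (hT : DefectiveT2 m μ lam δ) (hlam : 0 < lam) (hδ : 0 ≤ δ) :
    TransportT1 μ (64 * (1 + δ) ^ 2 / lam) ∧
      ∀ S : Finset (Fin N), TransportT1 (marginal μ S) (64 * (1 + δ) ^ 2 / lam) := by
  have hl : (lam / 2).toNNReal ≠ 0 := by
    simpa [pos_iff_ne_zero] using hlam
  have hD : ∀ ν : Measure (Config (Fin N) d), IsProbabilityMeasure ν →
      FiniteMoment configDist 2 ν → ((lam / 2).toNNReal : ℝ≥0∞)
        * wassersteinPow configDist 2 ν (tensorPower m N) ≤ klDiv ν μ + (δ.toNNReal : ℝ≥0∞) := by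
    intro ν hν hν2
    have h := hT ν ⟨hν, hν2⟩
    have e1 : (((lam / 2).toNNReal : ℝ≥0∞) : EReal) = ((lam / 2 : ℝ) : EReal) := by
      change ((ENNReal.ofReal (lam / 2) : ℝ≥0∞) : EReal) = _
      rw [EReal.coe_ennreal_ofReal, max_eq_left (by positivity)]
    have e2 : ((δ.toNNReal : ℝ≥0∞) : EReal) = (δ : EReal) := by
      change ((ENNReal.ofReal δ : ℝ≥0∞) : EReal) = _
      rw [EReal.coe_ennreal_ofReal, max_eq_left hδ]
    rw [← EReal.coe_ennreal_le_coe_ennreal_iff, EReal.coe_ennreal_add, EReal.coe_ennreal_mul,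
      e1, e2]
    exact h
  have key : ∀ ν : Measure (Config (Fin N) d), IsProbabilityMeasure ν →
      wassersteinPow configDist 1 ν μ ^ 2
        ≤ ENNReal.ofReal (64 * (1 + δ) ^ 2 / lam) * klDiv ν μ := by
    intro ν hν
    have h := wassersteinPow_one_sq_le (finiteMoment_tensorPower hm N) hl hD ν
    -- `(λ / 2) * 64 (1 + δ)² / λ = 32 (1 + δ)²` exceeds `26 + 8 δ`
    have hc : (26 + 8 * (δ.toNNReal : ℝ≥0∞))
        ≤ ((lam / 2).toNNReal : ℝ≥0∞) * ENNReal.ofReal (64 * (1 + δ) ^ 2 / lam) := by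
      change 26 + 8 * ENNReal.ofReal δ ≤ ENNReal.ofReal (lam / 2) * _
      rw [← ENNReal.ofReal_mul (by positivity), ← ENNReal.ofReal_ofNat 26,
        ← ENNReal.ofReal_ofNat 8, ← ENNReal.ofReal_mul (by norm_num),
        ← ENNReal.ofReal_add (by norm_num) (by positivity)]
      refine ENNReal.ofReal_le_ofReal ?_
      have : lam / 2 * (64 * (1 + δ) ^ 2 / lam) = 32 * (1 + δ) ^ 2 := by
        field_simp
        ring
      rw [this]
      nlinarith
    refine (ENNReal.mul_le_mul_iff_right (a := ((lam / 2).toNNReal : ℝ≥0∞))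
      (by simpa using hlam) (by simp)).1 (h.trans ?_)
    rw [← mul_assoc]
    gcongr
  refine ⟨fun ν hν => key ν hν.1, fun S ν hν => ?_⟩
  have hν1 := hν.1
  have hp : Measurable fun (x : Config (Fin N) d) (i : {i // i ∈ S}) => x i.1 := by fun_prop
  rcases eq_or_ne (klDiv ν (marginal μ S)) ∞ with h | h
  · rw [h, ENNReal.mul_top (by simpa using by positivity)]
    exact le_top
  obtain ⟨ν', hν', hmap, hkl⟩ := exists_lift_klDiv_eq hp μ (klDiv_ne_top_iff.1 h).1
  have h1 := wassersteinPow_one_map_le hp (configDist_restrict_le S) ν' μ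
  rw [hmap] at h1
  calc wassersteinPow configDist 1 ν (marginal μ S) ^ 2
      ≤ wassersteinPow configDist 1 ν' μ ^ 2 := by
        gcongr
        exact h1
    _ ≤ ENNReal.ofReal (64 * (1 + δ) ^ 2 / lam) * klDiv ν' μ := key ν' hν'
    _ = _ := by rw [hkl]; rfl

theorem theorem3 {d N : ℕ} (hd : 1 ≤ d) (hN : 1 ≤ N)
    (V : Pt d → ℝ) (hV : ContDiff ℝ 1 V)
    (W Wp Wm : Pt d → Pt d → ℝ)
    (hW : ∀ x y, W x y = Wp x y - Wm x y)
    (hWp : ContDiff ℝ 2 (fun z : Pt d × Pt d => Wp z.1 z.2))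
    (hWm : ContDiff ℝ 2 (fun z : Pt d × Pt d => Wm z.1 z.2))
    (hWp_pos : PositiveType Wp) (hWm_pos : PositiveType Wm)
    (Lp Lm : ℝ)
    (hLp : ∀ x y, ‖mixedHessian Wp x y‖ ≤ Lp)
    (hLm : ∀ x y, ‖mixedHessian Wm x y‖ ≤ Lm)
    (hGibbs : Integrable (fun x : Config (Fin N) d => Real.exp (-particleEnergy V W N x)) volume)
    (m : Measure (Pt d)) (hm : InP dist 2 m) (hm_fix : m = meanFieldMap V W m)
    (lam : ℝ) (hlam : 0 ≤ lam) :
    (∀ ε : ℝ, 0 ≤ ε → ε ≤ 1 / 2 → NonlinearT2 Wm m ε lam →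
      DefectiveT2 m (gibbsMeasure V W N) (lambdaN N ε lam Lm)
          (deltaN N ε Lp Lm (totalVar m)) ∧
        (0 < lambdaN N ε lam Lm →
          TransportT1 (gibbsMeasure V W N)
              (64 * (1 + deltaN N ε Lp Lm (totalVar m)) ^ 2 / lambdaN N ε lam Lm) ∧
            ∀ S : Finset (Fin N), TransportT1 (marginal (gibbsMeasure V W N) S)
              (64 * (1 + deltaN N ε Lp Lm (totalVar m)) ^ 2 / lambdaN N ε lam Lm))) ∧
    ((∀ x y, Wm x y = 0) → TalagrandT2 m lam →
      DefectiveT2 m (gibbsMeasure V W N) lam (Lp * totalVar m) ∧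
        (0 < lam →
          TransportT1 (gibbsMeasure V W N) (64 * (1 + Lp * totalVar m) ^ 2 / lam) ∧
            ∀ S : Finset (Fin N), TransportT1 (marginal (gibbsMeasure V W N) S)
              (64 * (1 + Lp * totalVar m) ^ 2 / lam))) := by
  obtain ⟨hmP, hm2⟩ := hm
  have hv := totalVar_nonneg m
  have hLp0 : 0 ≤ Lp := (norm_nonneg (mixedHessian Wp 0 0)).trans (hLp 0 0)
  have hLm0 : 0 ≤ Lm := (norm_nonneg (mixedHessian Wm 0 0)).trans (hLm 0 0)
  have hμ : IsProbabilityMeasure (gibbsMeasure V W N) := by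
    obtain ⟨h1, h2⟩ := gibbsMeasure_eq_tilted hN hm_fix hGibbs
    rw [h2]
    exact isProbabilityMeasure_tilted h1
  refine ⟨fun ε hε hε2 hT => ?_, fun hW0 hT => ?_⟩
  · have hdef : DefectiveT2 m (gibbsMeasure V W N) (lambdaN N ε lam Lm)
        (deltaN N ε Lp Lm (totalVar m)) := by
      unfold lambdaN deltaN
      split_ifs with h0
      · subst h0
        exact defectiveT2_gibbsMeasure hN hW hWp hWm hWp_pos hWm_pos hLp hLm hGibbs hm2 hm_fix
          le_rfl hlam hT two_mul_weightSum_zero_le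
      · have hε0 : 0 < ε := lt_of_le_of_ne hε (Ne.symm h0)
        exact defectiveT2_gibbsMeasure hN hW hWp hWm hWp_pos hWm_pos hLp hLm hGibbs hm2 hm_fix
          hε hlam hT (two_mul_weightSum_le hN hε0 hε2)
    have hδ : 0 ≤ deltaN N ε Lp Lm (totalVar m) := by
      have := Real.log_nonneg (by exact_mod_cast hN : (1 : ℝ) ≤ N)
      unfold deltaN
      split_ifs <;> positivity
    exact ⟨hdef, fun hpos => hdef.transportT1 hm2 hpos hδ⟩
  · have hWm0 : Wm = fun _ _ => 0 := by
      ext x y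
      exact hW0 x y
    subst hWm0
    have hT' : NonlinearT2 (fun _ _ => 0) m 0 lam := fun ν hν => by
      simpa [kernelForm] using hT ν hν
    have hdef := defectiveT2_gibbsMeasure hN hW hWp hWm hWp_pos hWm_pos hLp (Lm := 0)
      (fun x y => by
        rw [show mixedHessian (fun _ _ : Pt d => (0 : ℝ)) x y = 0 by simp [mixedHessian]]
        exact ContinuousLinearMap.opNorm_zero.le) hGibbs hm2 hm_fix le_rfl hlam hT' two_mul_weightSum_zero_le
    simp only [mul_zero, zero_div, sub_zero, zero_add] at hdef
    exact ⟨hdef, fun hpos => hdef.transportT1 hm2 hpos (by positivity)⟩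

end
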